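/- Let $n\ge 2$, let $\mathbb S^n\subset\mathbb R^{n+1}$ be the unit sphere, with canonical metric $\bar g$, and call equators the sets $\Sigma_v=\{x\in\mathbb S^n : \langle x,v\rangle=0\}$, $v\in\mathbb R^{n+1}\setminus\{0\}$. Let $\mathcal E(\mathbb S^n)$ be the set of smooth Riemannian metrics $g$ on $\mathbb S^n$ for which all equators are minimal hypersurfaces of $(\mathbb S^n,g)$ (that is, have zero mean curvature). Let $Curv_+(\mathbb R^{n+1})$ be the set of algebraic curvature tensors $R$ on $\mathbb R^{n+1}$ (four-linear maps with $R(x,y,z,w)=-R(y,x,z,w)=-R(x,y,w,z)=R(z,w,x,y)$ and $R(x,y,z,w)+R(x,z,w,y)+R(x,w,y,z)=0$) with positive sectional curvature, i.e. $R(v,w,v,w)>0$ for every orthonormal pair $v,w$. For $T\in GL(n+1,\mathbb R)$ let $\phi(T):\mathbb S^n\to\mathbb S^n$, $\phi(T)(x)=T(x)/|T(x)|$. The formulas $$R\cdot[T](x,y,z,w)=\frac{1}{|\det T|^{\frac{4}{n+1}}}R(Tx,Ty,Tz,Tw),\qquad g\cdot[T]=\phi(T)^*g$$ define right actions of $PGL(n+1,\mathbb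 R)=GL(n+1,\mathbb R)/\{\lambda\,\mathrm{Id}:\lambda\ne0\}$ on $Curv_+(\mathbb R^{n+1})$ and on $\mathcal E(\mathbb S^n)$ respectively, and there is a $PGL(n+1,\mathbb R)$-equivariant bijection $Curv_+(\mathbb R^{n+1})\to\mathcal E(\mathbb S^n)$, $R\mapsto g_R$, which, together with its inverse $g\mapsto R_g$, is given explicitly as follows. (1) Given $R\in Curv_+(\mathbb R^{n+1})$, put $(k_R)_p(v,w)=R(p,v,p,w)$ for $p\in\mathbb S^n$ and $v,w\in T_p\mathbb S^n=p^\perp$. There is a unique positive smooth function $D_R$ on $\mathbb S^n$ such that the volume elements satisfy $dV_{k_R}=D_R^{\frac{n-1}{4}}\,dV_{\bar g}$, and $g_R=\frac{1}{D_R}k_R$. (2) Given $g\in\mathcal E(\mathbb S^n)$, there is a unique positive smooth function $F_g$ on $\mathbb S^n$ such that $dV_g=F_g^{\frac{n+1}{4}}\,dV_{\bar g}$. Put $k_g=\frac{1}{F_g}g$. Then $R_g\in Curv_+(\mathbb R^{n+1})$ is the unique algebraic curvature tensor on $\mathbb R^{n+1}$ with $R_g(p,v,p,v)=(k_g)_p(v,v)$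 for all $p\in\mathbb S^n$ and $v\in T_p\mathbb S^n$. -/

import Mathlib

open scoped Manifold ContDiff RealInnerProductSpace

noncomputable section

namespace MinimalEquators

/-! ### Riemannian geometry in local coordinates -/

section Coordinates

variable {n : ℕ} {M : Type*} [TopologicalSpace M] [ChartedSpace (EuclideanSpace ℝ (Fin n)) M]
  [IsManifold (𝓡 n) ∞ M]

variable (n M) in
/-- Smooth Riemannian metrics on the `n`-dimensional manifold `M`. -/
abbrev RiemMetric : Type _ :=
  Bundle.ContMDiffRiemannianMetric (𝓡 n) ∞ (EuclideanSpace ℝ (Fin n))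
    (fun p : M => TangentSpace (𝓡 n) p)

/-- The partial derivative `∂ᵢ F` at `x`. -/
def partialDeriv (i : Fin n) (F : EuclideanSpace ℝ (Fin n) → ℝ)
    (x : EuclideanSpace ℝ (Fin n)) : ℝ :=
  fderiv ℝ F x (EuclideanSpace.single i 1)

/-- The coordinate vector field `∂ᵢ` of the preferred chart at `p`, at the point of `M` with
coordinates `x`. -/
def coordVector (p : M) (x : EuclideanSpace ℝ (Fin n)) (i : Fin n) :
    TangentSpace (𝓡 n) ((extChartAt (𝓡 n) p).symm x) :=
  mfderiv 𝓘(ℝ, EuclideanSpace ℝ (Fin n)) (𝓡 n) (extChartAt (𝓡 n) p).symm x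
    (EuclideanSpace.single i (1 : ℝ) : EuclideanSpace ℝ (Fin n))

/-- The matrix `gᵢⱼ = g(∂ᵢ, ∂ⱼ)` of the metric `g` in the preferred chart at `p`. -/
def metricMatrix (g : RiemMetric n M) (p : M) (x : EuclideanSpace ℝ (Fin n)) :
    Matrix (Fin n) (Fin n) ℝ :=
  Matrix.of fun i j =>
    g.inner ((extChartAt (𝓡 n) p).symm x) (coordVector p x i) (coordVector p x j)

/-- The Christoffel symbol `Γᵏᵢⱼ` of the Levi-Civita connection of `g`, that is
`∇_{∂ᵢ} ∂ⱼ = ∑ₖ Γᵏᵢⱼ ∂ₖ`, in the preferred chart at `p`. -/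
def christoffel (g : RiemMetric n M) (p : M) (x : EuclideanSpace ℝ (Fin n)) (i j k : Fin n) : ℝ :=
  (1 / 2) * ∑ l, (metricMatrix g p x)⁻¹ k l *
    (partialDeriv i (fun y => metricMatrix g p y j l) x
      + partialDeriv j (fun y => metricMatrix g p y i l) x
      - partialDeriv l (fun y => metricMatrix g p y i j) x)

/-- The `k`-th component of the `g`-gradient of `f`, in the preferred chart at `p`. -/
def gradientCoord (g : RiemMetric n M) (f : M → ℝ) (p : M) (x : EuclideanSpace ℝ (Fin n))
    (k : Fin n) : ℝ :=
  ∑ l, (metricMatrix g p x)⁻¹ k l * partialDeriv l (f ∘ (extChartAt (𝓡 n) p).symm) x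

/-- The `k`-th component of `N = ∇f / |∇f|`, the unit vector field that is `g`-normal to the level
sets of `f`, in the preferred chart at `p`. -/
def unitNormalCoord (g : RiemMetric n M) (f : M → ℝ) (p : M) (x : EuclideanSpace ℝ (Fin n))
    (k : Fin n) : ℝ :=
  gradientCoord g f p x k /
    √(∑ i, ∑ j, metricMatrix g p x i j * gradientCoord g f p x i * gradientCoord g f p x j)

/-- The `k`-th component of the Levi-Civita covariant derivative `∇_{∂ᵢ} N`. -/
def covDerivUnitNormal (g : RiemMetric n M) (f : M → ℝ) (p : M) (x : EuclideanSpace ℝ (Fin n))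
    (i k : Fin n) : ℝ :=
  partialDeriv i (fun y => unitNormalCoord g f p y k) x
    + ∑ j, christoffel g p x i j k * unitNormalCoord g f p x j

/-- The components `Aᵢⱼ = g(∇_{∂ᵢ} N, ∂ⱼ)`, in the preferred chart at `p`. On vectors tangent to a
level set of `f`, this bilinear form is the second fundamental form of the level set. -/
def secondFundForm (g : RiemMetric n M) (f : M → ℝ) (p : M) (x : EuclideanSpace ℝ (Fin n))
    (i j : Fin n) : ℝ :=
  ∑ k, metricMatrix g p x k j * covDerivUnitNormal g f p x i k

/-- The mean curvature at `p`, with respect to `g`, of the level set of `f` through the regular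
point `p`: the trace of the second fundamental form over the tangent space of the level set. For a
`g`-orthonormal basis `(eₐ)` of the hyperplane orthogonal to `N`, one has
`∑ₐ eₐⁱ eₐʲ = gⁱʲ - Nⁱ Nʲ`, so the sum below is `∑ₐ A(eₐ, eₐ)`. -/
def meanCurvature (g : RiemMetric n M) (f : M → ℝ) (p : M) : ℝ :=
  let x := extChartAt (𝓡 n) p p
  ∑ i, ∑ j, ((metricMatrix g p x)⁻¹ i j - unitNormalCoord g f p x i * unitNormalCoord g f p x j) *
    secondFundForm g f p x i j

end Coordinates

/-! ### The sphere, its equators, and volume elements -/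

/-- The unit sphere `𝕊ⁿ` of `ℝⁿ⁺¹`. -/
abbrev Sph (n : ℕ) : Type := Metric.sphere (0 : EuclideanSpace ℝ (Fin (n + 1))) 1

/-- The inclusion `T_p 𝕊ⁿ → ℝⁿ⁺¹`, with image the orthogonal complement of `p`. -/
def tangentIncl {n : ℕ} (p : Sph n) :
    TangentSpace (𝓡 n) p →L[ℝ] EuclideanSpace ℝ (Fin (n + 1)) :=
  mvfderiv (𝓡 n) ((↑) : Sph n → EuclideanSpace ℝ (Fin (n + 1))) p

/-- The function `x ↦ ⟨x, v⟩` on `𝕊ⁿ`. -/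
def height {n : ℕ} (v : EuclideanSpace ℝ (Fin (n + 1))) (x : Sph n) : ℝ :=
  ⟪(x : EuclideanSpace ℝ (Fin (n + 1))), v⟫

/-- The equator of `𝕊ⁿ` orthogonal to `v`, for `v ≠ 0`. -/
def equator {n : ℕ} (v : EuclideanSpace ℝ (Fin (n + 1))) : Set (Sph n) :=
  {x | height v x = 0}

/-- All equators are minimal hypersurfaces of `(𝕊ⁿ, g)`: their mean curvature vanishes. -/
def HasMinimalEquators {n : ℕ} (g : RiemMetric n (Sph n)) : Prop :=
  ∀ v : EuclideanSpace ℝ (Fin (n + 1)), v ≠ 0 →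
    ∀ p ∈ equator v, meanCurvature g (height v) p = 0

/-- The set of Riemannian metrics on `𝕊ⁿ` with minimal equators. -/
abbrev MinimalEquatorMetric (n : ℕ) : Type :=
  {g : RiemMetric n (Sph n) // HasMinimalEquators g}

/-- Families of real-valued functions of two tangent vectors on `𝕊ⁿ`. -/
abbrev TwoTensor (n : ℕ) : Type :=
  ∀ p : Sph n, TangentSpace (𝓡 n) p → TangentSpace (𝓡 n) p → ℝ

/-- The canonical metric of `𝕊ⁿ`. -/
def roundTensor (n : ℕ) : TwoTensor n := fun p v w => ⟪tangentIncl p v, tangentIncl p w⟫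

/-- The two-tensor underlying a Riemannian metric. -/
def metricTensor {n : ℕ} (g : RiemMetric n (Sph n)) : TwoTensor n := fun p v w => g.inner p v w

/-- The volume element `dV_b`, evaluated on `n` tangent vectors: the square root of their Gram
determinant, which is the `b`-volume of the parallelepiped that they span. -/
def volumeElement {n : ℕ} (b : TwoTensor n) (p : Sph n) (e : Fin n → TangentSpace (𝓡 n) p) : ℝ :=
  √(Matrix.det (Matrix.of fun i j => b p (e i) (e j)))

/-- `D` is a positive smooth function on `𝕊ⁿ` with `dV_b = D ^ α dV_ḡ`, where `ḡ` is the canonical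
metric. -/
def IsVolumeNormalisation {n : ℕ} (b : TwoTensor n) (α : ℝ) (D : Sph n → ℝ) : Prop :=
  ContMDiff (𝓡 n) 𝓘(ℝ) ∞ D ∧ (∀ p, 0 < D p) ∧
    ∀ (p : Sph n) (e : Fin n → TangentSpace (𝓡 n) p),
      volumeElement b p e = D p ^ α * volumeElement (roundTensor n) p e

/-! ### Algebraic curvature tensors -/

/-- Four-linear maps on `ℝⁿ⁺¹`. -/
abbrev FourTensor (n : ℕ) : Type :=
  EuclideanSpace ℝ (Fin (n + 1)) →ₗ[ℝ] EuclideanSpace ℝ (Fin (n + 1)) →ₗ[ℝ]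
    EuclideanSpace ℝ (Fin (n + 1)) →ₗ[ℝ] EuclideanSpace ℝ (Fin (n + 1)) →ₗ[ℝ] ℝ

/-- Algebraic curvature tensors. -/
structure IsAlgCurvatureTensor {n : ℕ} (R : FourTensor n) : Prop where
  skew_left : ∀ x y z w, R x y z w = -R y x z w
  skew_right : ∀ x y z w, R x y z w = -R x y w z
  pair_symm : ∀ x y z w, R x y z w = R z w x y
  bianchi : ∀ x y z w, R x y z w + R x z w y + R x w y z = 0

/-- Positivity of the sectional curvature. -/
def HasPositiveSec {n : ℕ} (R : FourTensor n) : Prop :=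
  ∀ v w : EuclideanSpace ℝ (Fin (n + 1)), ‖v‖ = 1 → ‖w‖ = 1 → ⟪v, w⟫ = 0 → 0 < R v w v w

/-- The set of algebraic curvature tensors on `ℝⁿ⁺¹` with positive sectional curvature. -/
abbrev PositiveCurvatureTensor (n : ℕ) : Type :=
  {R : FourTensor n // IsAlgCurvatureTensor R ∧ HasPositiveSec R}

/-- The two-tensor `(k_R)_p(v, w) = R(p, v, p, w)` on `𝕊ⁿ`. -/
def curvTwoTensor {n : ℕ} (R : FourTensor n) : TwoTensor n := fun p v w =>
  R (p : EuclideanSpace ℝ (Fin (n + 1))) (tangentIncl p v)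
    (p : EuclideanSpace ℝ (Fin (n + 1))) (tangentIncl p w)

/-! ### The general linear group -/

/-- The linear map `ℝⁿ⁺¹ → ℝⁿ⁺¹` given by an invertible matrix. -/
def linMap {n : ℕ} (T : GL (Fin (n + 1)) ℝ) :
    EuclideanSpace ℝ (Fin (n + 1)) →ₗ[ℝ] EuclideanSpace ℝ (Fin (n + 1)) :=
  Matrix.toEuclideanLin (T : Matrix (Fin (n + 1)) (Fin (n + 1)) ℝ)

theorem linMap_ne_zero {n : ℕ} (T : GL (Fin (n + 1)) ℝ) {x : EuclideanSpace ℝ (Fin (n + 1))}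
    (hx : x ≠ 0) : linMap T x ≠ 0 := by
  intro h
  apply hx
  have h1 : (T : Matrix (Fin (n + 1)) (Fin (n + 1)) ℝ).mulVec x.ofLp = 0 := by
    have h2 := congrArg WithLp.ofLp h
    simpa [linMap, Matrix.toEuclideanLin] using h2
  have h3 : x.ofLp = 0 := by
    have h4 := congrArg (((T⁻¹ : GL (Fin (n + 1)) ℝ) : Matrix (Fin (n + 1)) (Fin (n + 1)) ℝ).mulVec) h1
    rw [Matrix.mulVec_mulVec, ← Units.val_mul, inv_mul_cancel] at h4
    simpa using h4
  ext i
  simpa using congrFun h3 i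

/-- The diffeomorphism `x ↦ T x / |T x|` of `𝕊ⁿ`. -/
def sphereMap {n : ℕ} (T : GL (Fin (n + 1)) ℝ) (x : Sph n) : Sph n :=
  ⟨‖linMap T x‖⁻¹ • linMap T x, by
    have hx : (x : EuclideanSpace ℝ (Fin (n + 1))) ≠ 0 := ne_zero_of_mem_unit_sphere x
    rw [mem_sphere_zero_iff_norm, norm_smul, norm_inv, norm_norm]
    exact inv_mul_cancel₀ (norm_ne_zero_iff.mpr (linMap_ne_zero T hx))⟩

end MinimalEquators

end

open MinimalEquators

/-! Both directions of the correspondence are rescalings of a metric by a power of its volume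
density. The link is that g has minimal equators exactly when k = g / F_g is a quadratic first
integral of the great circles, that is, when k(γ', γ') is constant along every unit-speed great
circle γ.

Minimality. In the stereographic chart centred at p, the functions ⟨·, v⟩ with v orthogonal to p
have vanishing second derivatives at the centre. The mean curvature at p of the equators through p
therefore involves only the metric and its first derivatives there, and the gradients u of these
functions exhaust the non-zero vectors. Vanishing for all u is a cubic identity in u. Polarised and
contracted with the inverse metric (`cubic_eq_iff`), it becomes (n + 1) (D_u g)(u, u) = 2 tr(g⁻¹ D_u
g) g(u, u). By Jacobi's formula the trace is D_u log det g, and det g is F ^ ((n + 1) / 2) times an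
even function of the coordinates, so the condition reads D_u (g(u, u) / F) = 0 at the centre of
every chart (`hasMinimalEquators_iff`).

First integrals. R(γ, γ', γ, γ') depends only on γ ∧ γ', which is constant along a great circle, so
k_R is a first integral (`fderiv_curvFamily`). Conversely, let Q_x(y, z) be the extension of k to
ℝⁿ⁺¹ that is homogeneous of degree two in x and ignores the components of y and z along x. Constancy
along great circles amounts to Q_x(y, y) = Q_y(x, x) (`homogForm_swap`). Hence Q is biquadratic, and
since Q_x(x, ·) = 0, polarisation produces an algebraic curvature tensor
(`exists_isAlgCurvatureTensor`). Such a tensor is determined by its values R(x, y, x, y), which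
gives uniqueness.

Normalisation. Since (n - 1) / 4 + (n + 1) / 4 = n / 2, dividing k_R by D_R gives a metric with F =
1 / D_R (`IsVolumeNormalisation.one_div_smul`), so the two constructions are mutually inverse.

Equivariance. The differential of φ(T) at p is T / |Tp| modulo the normal direction, and its
Jacobian is |det T| / |Tp| ^ (n + 1). With m = |det T| ^ (-4 / (n + 1)) |Tp| ^ 4, both k and D of R
· [T] are m times the pull-backs of those of R, so the quotient g_R is simply pulled back. -/

noncomputable section

open scoped Topology

namespace MinimalEquators

/-! ### Stereographic charts of the sphere -/

section Charts

variable {n : ℕ}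

/-- The point of the sphere with coordinates `x` in the preferred chart at `p`. -/
def chartPoint (p : Sph n) (x : EuclideanSpace ℝ (Fin n)) : Sph n :=
  (extChartAt (𝓡 n) p).symm x

/-- The inverse of the preferred chart at `p`, as a map into `ℝⁿ⁺¹`. -/
def chartMap (p : Sph n) (x : EuclideanSpace ℝ (Fin n)) : EuclideanSpace ℝ (Fin (n + 1)) :=
  (chartPoint p x : EuclideanSpace ℝ (Fin (n + 1)))

/-- The tangent vector at `chartPoint p x` with coordinates `w`. -/
def chartVector (p : Sph n) (x : EuclideanSpace ℝ (Fin n)) :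
    EuclideanSpace ℝ (Fin n) →L[ℝ] TangentSpace (𝓡 n) (chartPoint p x) :=
  mfderiv 𝓘(ℝ, EuclideanSpace ℝ (Fin n)) (𝓡 n) (extChartAt (𝓡 n) p).symm x

/-- The preferred chart at p is stereographic projection from -p, so p itself sits at the origin; J
is the inverse of the isometry that identifies the orthogonal complement of p with ℝⁿ. Every later
computation in charts starts from this formula. -/
theorem exists_chartMap_eq (p : Sph n) :
    ∃ J : EuclideanSpace ℝ (Fin n) →ₗᵢ[ℝ] EuclideanSpace ℝ (Fin (n + 1)),
      (∀ y, ⟪(p : EuclideanSpace ℝ (Fin (n + 1))), J y⟫ = 0) ∧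
      (∀ w, ⟪(p : EuclideanSpace ℝ (Fin (n + 1))), w⟫ = 0 → ∃ y, J y = w) ∧
      ∀ x, chartMap p x = (‖x‖ ^ 2 + 4)⁻¹ • ((4 : ℝ) • J x - (‖x‖ ^ 2 - 4) • (p : EuclideanSpace ℝ (Fin (n + 1)))) := by
  have := Fact.mk (@finrank_euclideanSpace_fin ℝ _ (n + 1))
  let U : (ℝ ∙ ((-p : Sph n) : EuclideanSpace ℝ (Fin (n + 1))))ᗮ ≃ₗᵢ[ℝ] EuclideanSpace ℝ (Fin n) :=
        (OrthonormalBasis.fromOrthogonalSpanSingleton n (ne_zero_of_mem_unit_sphere (-p))).repr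
  refine ⟨(Submodule.subtypeₗᵢ _).comp U.symm.toLinearIsometry, ?_, ?_, ?_⟩
  · intro y
    have h := (U.symm y).2
    rw [Submodule.mem_orthogonal_singleton_iff_inner_right] at h
    simp only [coe_neg_sphere, inner_neg_left, neg_eq_zero] at h
    exact h
  · intro w hw
    have h : w ∈ (ℝ ∙ ((-p : Sph n) : EuclideanSpace ℝ (Fin (n + 1))))ᗮ := by
      rw [Submodule.mem_orthogonal_singleton_iff_inner_right]
      simpa using hw
    exact ⟨U ⟨w, h⟩, congrArg Subtype.val (U.symm_apply_apply ⟨w, h⟩)⟩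
  · intro x
    have h := stereographic'_symm_apply (-p) x
    have h2 : chartMap p x = ((stereographic' n (-p)).symm x : EuclideanSpace ℝ (Fin (n + 1))) := rfl
    rw [h2, h]
    have h3 : ‖((OrthonormalBasis.fromOrthogonalSpanSingleton n (ne_zero_of_mem_unit_sphere (-p))).repr.symm x : EuclideanSpace ℝ (Fin (n + 1)))‖ = ‖x‖ := by
      rw [← Submodule.coe_norm, LinearIsometryEquiv.norm_map]
    dsimp only
    rw [h3]
    simp only [coe_neg_sphere, smul_neg, smul_sub]
    rw [sub_eq_add_neg]
    rfl

theorem extChartAt_self (p : Sph n) : extChartAt (𝓡 n) p p = 0 := by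
  have := Fact.mk (@finrank_euclideanSpace_fin ℝ _ (n + 1))
  have h : stereographic (E := EuclideanSpace ℝ (Fin (n + 1))) (norm_eq_of_mem_sphere (-p)) p = 0 :=
    stereographic_neg_apply p
  change (OrthonormalBasis.fromOrthogonalSpanSingleton n (ne_zero_of_mem_unit_sphere (-p))).repr
    (stereographic (norm_eq_of_mem_sphere (-p)) p) = 0
  rw [h]
  exact map_zero _

theorem extChartAt_target_eq (p : Sph n) : (extChartAt (𝓡 n) p).target = Set.univ := by
  have := Fact.mk (@finrank_euclideanSpace_fin ℝ _ (n + 1))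
  rw [extChartAt_target]
  have : (chartAt (EuclideanSpace ℝ (Fin n)) p).target = Set.univ :=
    stereographic'_target (-p)
  simp [this]

theorem chartPoint_zero (p : Sph n) : chartPoint p 0 = p := by
  rw [chartPoint, ← extChartAt_self p, extChartAt_to_inv]

theorem contMDiff_chartPoint (p : Sph n) :
    ContMDiff 𝓘(ℝ, EuclideanSpace ℝ (Fin n)) (𝓡 n) ∞ (chartPoint p) := by
  have h := contMDiffOn_extChartAt_symm (I := 𝓡 n) (n := ∞) p
  rw [extChartAt_target_eq] at h
  exact contMDiffOn_univ.1 h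

theorem contMDiff_sphere_coe :
    ContMDiff (𝓡 n) 𝓘(ℝ, EuclideanSpace ℝ (Fin (n + 1))) ∞
      ((↑) : Sph n → EuclideanSpace ℝ (Fin (n + 1))) := by
  have := Fact.mk (@finrank_euclideanSpace_fin ℝ _ (n + 1))
  exact contMDiff_coe_sphere

theorem contDiff_chartMap (p : Sph n) : ContDiff ℝ ∞ (chartMap p) :=
  (contMDiff_sphere_coe.comp (contMDiff_chartPoint p)).contDiff

theorem tangentIncl_chartVector (p : Sph n) (x w : EuclideanSpace ℝ (Fin n)) :
    tangentIncl (chartPoint p x) (chartVector p x w) = fderiv ℝ (chartMap p) x w := by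
  have h1 : MDifferentiableAt (𝓡 n) 𝓘(ℝ, EuclideanSpace ℝ (Fin (n + 1)))
      ((↑) : Sph n → EuclideanSpace ℝ (Fin (n + 1))) (chartPoint p x) :=
    (contMDiff_sphere_coe _).mdifferentiableAt (by simp)
  have h2 : MDifferentiableAt 𝓘(ℝ, EuclideanSpace ℝ (Fin n)) (𝓡 n) (chartPoint p) x :=
    (contMDiff_chartPoint p x).mdifferentiableAt (by simp)
  have h3 := mfderiv_comp_apply x h1 h2 w
  rw [show ((↑) : Sph n → EuclideanSpace ℝ (Fin (n + 1))) ∘ chartPoint p = chartMap p from rfl,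
    mfderiv_eq_fderiv] at h3
  exact h3.symm

theorem tangentIncl_injective (p : Sph n) : Function.Injective (tangentIncl p) := by
  have := Fact.mk (@finrank_euclideanSpace_fin ℝ _ (n + 1))
  exact injective_mvfderiv_subtypeVal_sphere p

theorem range_tangentIncl (p : Sph n) :
    (tangentIncl p).range = (ℝ ∙ (p : EuclideanSpace ℝ (Fin (n + 1))))ᗮ := by
  have := Fact.mk (@finrank_euclideanSpace_fin ℝ _ (n + 1))
  exact range_mvfderiv_subtypeVal p

theorem inner_tangentIncl (p : Sph n) (v : TangentSpace (𝓡 n) p) :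
    ⟪(p : EuclideanSpace ℝ (Fin (n + 1))), tangentIncl p v⟫ = 0 := by
  have h : tangentIncl p v ∈ (tangentIncl p).range := ⟨v, rfl⟩
  rwa [range_tangentIncl, Submodule.mem_orthogonal_singleton_iff_inner_right] at h

theorem exists_tangentIncl_eq (p : Sph n) {w : EuclideanSpace ℝ (Fin (n + 1))}
    (hw : ⟪(p : EuclideanSpace ℝ (Fin (n + 1))), w⟫ = 0) : ∃ v, tangentIncl p v = w := by
  rw [← Submodule.mem_orthogonal_singleton_iff_inner_right, ← range_tangentIncl] at hw
  exact hw

theorem tangentIncl_eq_zero_iff {p : Sph n} {v : TangentSpace (𝓡 n) p} :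
    tangentIncl p v = 0 ↔ v = 0 := by
  refine ⟨fun h => tangentIncl_injective p (h.trans (map_zero _).symm), fun h => ?_⟩
  rw [h, map_zero]

/-- The metric in the preferred chart at `p`, as a bilinear form. -/
def chartForm (g : RiemMetric n (Sph n)) (p : Sph n) (x : EuclideanSpace ℝ (Fin n)) :
    EuclideanSpace ℝ (Fin n) →ₗ[ℝ] EuclideanSpace ℝ (Fin n) →ₗ[ℝ] ℝ :=
  LinearMap.mk₂ ℝ (fun v w => g.inner (chartPoint p x) (chartVector p x v) (chartVector p x w))
    (fun _ _ _ => by simp) (fun _ _ _ => by simp) (fun _ _ _ => by simp) (fun _ _ _ => by simp)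

theorem chartForm_apply (g : RiemMetric n (Sph n)) (p : Sph n)
    (x v w : EuclideanSpace ℝ (Fin n)) : chartForm g p x v w =
      g.inner (chartPoint p x) (chartVector p x v) (chartVector p x w) := rfl

theorem metricMatrix_apply (g : RiemMetric n (Sph n)) (p : Sph n)
    (x : EuclideanSpace ℝ (Fin n)) (i j : Fin n) : metricMatrix g p x i j =
      chartForm g p x (EuclideanSpace.single i 1) (EuclideanSpace.single j 1) := rfl

theorem eq_sum_single (w : EuclideanSpace ℝ (Fin n)) :
    w = ∑ i, w i • EuclideanSpace.single i (1 : ℝ) := by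
  ext i
  simp [Pi.single_apply]

theorem chartForm_eq_sum (g : RiemMetric n (Sph n)) (p : Sph n)
    (x v w : EuclideanSpace ℝ (Fin n)) :
    chartForm g p x v w = ∑ i, ∑ j, v i * w j * metricMatrix g p x i j := by
  conv_lhs => rw [eq_sum_single v, eq_sum_single w]
  simp only [map_sum, map_smul, LinearMap.sum_apply, LinearMap.smul_apply,
    smul_eq_mul, Finset.mul_sum, metricMatrix_apply]
  rw [Finset.sum_comm]
  refine Finset.sum_congr rfl fun i _ => Finset.sum_congr rfl fun j _ => ?_
  ring

theorem symm_trivializationAt_eq_mfderiv {M : Type*} [TopologicalSpace M]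
    [ChartedSpace (EuclideanSpace ℝ (Fin n)) M] [IsManifold (𝓡 n) ∞ M] [IsManifold (𝓡 n) 1 M]
    (p : M) (x v : EuclideanSpace ℝ (Fin n))
    (hx : x ∈ (extChartAt (𝓡 n) p).target) :
    (trivializationAt (EuclideanSpace ℝ (Fin n)) (TangentSpace (𝓡 n) : M → Type _) p).symm
      ((extChartAt (𝓡 n) p).symm x) v =
      mfderiv 𝓘(ℝ, EuclideanSpace ℝ (Fin n)) (𝓡 n) (extChartAt (𝓡 n) p).symm x v := by
  have hb : (extChartAt (𝓡 n) p).symm x ∈ (chartAt (EuclideanSpace ℝ (Fin n)) p).source := by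
    have := (extChartAt (𝓡 n) p).map_target hx
    rwa [extChartAt_source] at this
  have hr : extChartAt (𝓡 n) p ((extChartAt (𝓡 n) p).symm x) = x :=
    (extChartAt (𝓡 n) p).right_inv hx
  have hs := TangentBundle.symmL_trivializationAt (I := 𝓡 n) hb
  rw [ModelWithCorners.range_eq_univ, mfderivWithin_univ] at hs
  rw [← Bundle.Trivialization.symmL_apply (R := ℝ) _ hb, hs]
  -- The base point of the derivative is the round trip of x through the chart; it has to become a
  -- variable before it can be replaced by x.
  generalize extChartAt (𝓡 n) p ((extChartAt (𝓡 n) p).symm x) = z at hr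
  subst hr
  rfl

theorem chartPoint_mem_source (p : Sph n) (x : EuclideanSpace ℝ (Fin n)) :
    chartPoint p x ∈ (chartAt (EuclideanSpace ℝ (Fin n)) p).source := by
  have hx : x ∈ (extChartAt (𝓡 n) p).target := by rw [extChartAt_target_eq]; trivial
  have := (extChartAt (𝓡 n) p).map_target hx
  rwa [extChartAt_source] at this

theorem linearMapAt_trivial {M : Type*} [TopologicalSpace M] (p q : M) (c : ℝ) :
    (trivializationAt ℝ (Bundle.Trivial M ℝ) p).linearMapAt ℝ q c = c := by
  simp

/-- Smoothness of g is stated through bundle trivialisations; this identifies the trivialised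
section with the coefficients used in charts. -/
theorem trivializationAt_inner_apply (g : RiemMetric n (Sph n)) (p : Sph n)
    (x v w : EuclideanSpace ℝ (Fin n)) :
    (trivializationAt (EuclideanSpace ℝ (Fin n) →L[ℝ] EuclideanSpace ℝ (Fin n) →L[ℝ] ℝ)
        (fun b : Sph n => TangentSpace (𝓡 n) b →L[ℝ] TangentSpace (𝓡 n) b →L[ℝ] ℝ) p
        ⟨chartPoint p x, g.inner (chartPoint p x)⟩).2 v w = chartForm g p x v w := by
  have hb := chartPoint_mem_source p x
  have hs : ∀ v, (trivializationAt (EuclideanSpace ℝ (Fin n))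
      (TangentSpace (𝓡 n) : Sph n → Type _) p).symm (chartPoint p x) v = chartVector p x v :=
    fun v => symm_trivializationAt_eq_mfderiv p x v (by rw [extChartAt_target_eq]; trivial)
  rw [hom_trivializationAt_apply]
  dsimp only
  rw [inCoordinates_apply_eq₂ hb hb (Set.mem_univ _)]
  rw [hs, hs]
  exact linearMapAt_trivial p _ _

/-- Smoothness at the centre of the chart is enough throughout, because each point is the centre of
its own preferred chart. -/
theorem contDiffAt_chartForm (g : RiemMetric n (Sph n)) (p : Sph n)
    (v w : EuclideanSpace ℝ (Fin n)) : ContDiffAt ℝ ∞ (fun x => chartForm g p x v w) 0 := by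
  have h := g.contMDiff p
  rw [Bundle.contMDiffAt_section] at h
  have h2 := ContMDiffAt.comp_of_eq (x := (0 : EuclideanSpace ℝ (Fin n))) h
    (contMDiff_chartPoint p 0) (chartPoint_zero p)
  have h3 := (h2.contDiffAt.clm_apply (contDiffAt_const (c := v))).clm_apply
    (contDiffAt_const (c := w))
  refine h3.congr_of_eventuallyEq (Filter.Eventually.of_forall fun x => ?_)
  exact (trivializationAt_inner_apply g p x v w).symm

end Charts

/-! ### The mean curvature of a level set in a chart -/

section LevelSets

section MeanCurvature

variable {n : ℕ} {M : Type*} [TopologicalSpace M] [ChartedSpace (EuclideanSpace ℝ (Fin n)) M]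
  [IsManifold (𝓡 n) ∞ M]

theorem _root_.DifferentiableAt.matrix_det {E ι : Type*} [NormedAddCommGroup E] [NormedSpace ℝ E]
    [Fintype ι] [DecidableEq ι] {A : E → Matrix ι ι ℝ} {x : E}
    (hA : ∀ i j, DifferentiableAt ℝ (fun y => A y i j) x) :
    DifferentiableAt ℝ (fun y => (A y).det) x := by
  simp only [Matrix.det_apply]
  fun_prop

theorem _root_.DifferentiableAt.matrix_inv_apply {E ι : Type*} [NormedAddCommGroup E]
    [NormedSpace ℝ E] [Fintype ι] [DecidableEq ι] {A : E → Matrix ι ι ℝ} {x : E}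
    (hA : ∀ i j, DifferentiableAt ℝ (fun y => A y i j) x) (h : (A x).det ≠ 0) (i j : ι) :
    DifferentiableAt ℝ (fun y => (A y)⁻¹ i j) x := by
  simp only [Matrix.inv_def, Ring.inverse_eq_inv', Matrix.smul_apply, Matrix.adjugate_apply,
    smul_eq_mul]
  refine ((DifferentiableAt.matrix_det hA).inv h).mul (DifferentiableAt.matrix_det fun k l => ?_)
  by_cases hk : k = j
  · subst hk
    simp
  · simpa [Matrix.updateRow_ne hk] using hA k l

theorem partialDeriv_mul {i : Fin n} {F H : EuclideanSpace ℝ (Fin n) → ℝ}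
    {x : EuclideanSpace ℝ (Fin n)} (hF : DifferentiableAt ℝ F x) (hH : DifferentiableAt ℝ H x) :
    partialDeriv i (fun y => F y * H y) x =
      partialDeriv i F x * H x + F x * partialDeriv i H x := by
  rw [partialDeriv, partialDeriv, partialDeriv, fderiv_fun_mul hF hH]
  simp
  ring

theorem partialDeriv_sum {ι : Type*} {s : Finset ι} {i : Fin n}
    {F : ι → EuclideanSpace ℝ (Fin n) → ℝ} {x : EuclideanSpace ℝ (Fin n)}
    (hF : ∀ k ∈ s, DifferentiableAt ℝ (F k) x) :
    partialDeriv i (fun y => ∑ k ∈ s, F k y) x = ∑ k ∈ s, partialDeriv i (F k) x := by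
  simp only [partialDeriv]
  rw [fderiv_fun_sum hF]
  simp

theorem sum_metricMatrix_mul_gradientCoord {g : RiemMetric n M} {f : M → ℝ} {p : M}
    {x : EuclideanSpace ℝ (Fin n)} (hsymm : (metricMatrix g p x).IsSymm)
    (hdet : IsUnit (metricMatrix g p x).det) (j : Fin n) :
    ∑ k, metricMatrix g p x k j * gradientCoord g f p x k =
      partialDeriv j (f ∘ (extChartAt (𝓡 n) p).symm) x := by
  have h1 : ∀ l, ∑ k, metricMatrix g p x k j * (metricMatrix g p x)⁻¹ k l =
      if j = l then 1 else 0 := by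
    intro l
    have := congrFun (congrFun (Matrix.mul_nonsing_inv _ hdet) j) l
    rw [Matrix.mul_apply, Matrix.one_apply] at this
    rw [← this]
    exact Finset.sum_congr rfl fun k _ => by rw [← hsymm.apply]
  simp only [gradientCoord, Finset.mul_sum]
  rw [Finset.sum_comm]
  simp only [← mul_assoc, ← Finset.sum_mul, h1]
  simp

/-- By `hf` the coordinate Hessian of f vanishes at x. Differentiating G N = df / |∇f| then leaves
derivatives of G and a term proportional to df, and the latter is killed by the trace over the
tangent space of the level set. The result depends on f through N(x) only. -/
theorem meanCurvature_eq {g : RiemMetric n M} {f : M → ℝ} {p : M} {x : EuclideanSpace ℝ (Fin n)}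
    (hx : extChartAt (𝓡 n) p p = x)
    (hsymm : ∀ y, (metricMatrix g p y).IsSymm)
    (hpos : ∀ y, (metricMatrix g p y).PosDef)
    (hG : ∀ i j, DifferentiableAt ℝ (fun y => metricMatrix g p y i j) x)
    (hf : ∀ l, HasFDerivAt (partialDeriv l (f ∘ (extChartAt (𝓡 n) p).symm))
      (0 : EuclideanSpace ℝ (Fin n) →L[ℝ] ℝ) x)
    (hne : ∃ l, partialDeriv l (f ∘ (extChartAt (𝓡 n) p).symm) x ≠ 0) :
    meanCurvature g f p = -(1 / 2) * ∑ i, ∑ j,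
      ((metricMatrix g p x)⁻¹ i j - unitNormalCoord g f p x i * unitNormalCoord g f p x j) *
      ∑ l, (partialDeriv i (fun y => metricMatrix g p y l j) x
        + partialDeriv j (fun y => metricMatrix g p y i l) x
        - partialDeriv l (fun y => metricMatrix g p y i j) x) * unitNormalCoord g f p x l ∧
    0 < ∑ i, ∑ j, metricMatrix g p x i j * gradientCoord g f p x i * gradientCoord g f p x j := by
  set F := f ∘ (extChartAt (𝓡 n) p).symm with hF
  have hu : ∀ y, IsUnit (metricMatrix g p y).det := fun y => (hpos y).isUnit.map Matrix.detMonoidHom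
  have hgrad := fun y j => sum_metricMatrix_mul_gradientCoord (f := f) (hsymm y) (hu y) j
  rw [← hF] at hgrad
  have hWsq : ∀ y, ∑ i, ∑ j, metricMatrix g p y i j * gradientCoord g f p y i *
      gradientCoord g f p y j = ∑ j, partialDeriv j F y * gradientCoord g f p y j := by
    intro y
    rw [Finset.sum_comm]
    simp only [← Finset.sum_mul, hgrad]
  have hWpos : 0 < ∑ i, ∑ j, metricMatrix g p x i j * gradientCoord g f p x i *
      gradientCoord g f p x j := by
    have h0 : (fun k => gradientCoord g f p x k) ≠ 0 := by
      intro h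
      obtain ⟨l, hl⟩ := hne
      apply hl
      rw [← hgrad]
      refine Finset.sum_eq_zero fun k _ => ?_
      rw [show gradientCoord g f p x k = 0 from congrFun h k, mul_zero]
    have := (hpos x).dotProduct_mulVec_pos h0
    simp only [dotProduct, Matrix.mulVec, Finset.mul_sum, Pi.star_apply, star_trivial] at this
    refine this.trans_eq (Finset.sum_congr rfl fun i _ => Finset.sum_congr rfl fun j _ => ?_)
    ring
  refine ⟨?_, hWpos⟩
  set W : EuclideanSpace ℝ (Fin n) → ℝ := fun y => √(∑ i, ∑ j, metricMatrix g p y i j *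
    gradientCoord g f p y i * gradientCoord g f p y j) with hW
  have hW0 : W x ≠ 0 := (Real.sqrt_pos.2 hWpos).ne'
  have hWW : W x * W x = ∑ j, partialDeriv j F x * gradientCoord g f p x j := by
    rw [← hWsq]
    exact Real.mul_self_sqrt hWpos.le
  have hN : ∀ y k, unitNormalCoord g f p y k = gradientCoord g f p y k / W y := fun _ _ => rfl
  have hdg : ∀ k, DifferentiableAt ℝ (fun y => gradientCoord g f p y k) x := by
    intro k
    simp only [gradientCoord]
    exact DifferentiableAt.fun_sum fun l _ =>
      (DifferentiableAt.matrix_inv_apply hG (hu x).ne_zero k l).mul (hf l).differentiableAt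
  have hdW : DifferentiableAt ℝ W x := by
    refine DifferentiableAt.sqrt ?_ hWpos.ne'
    exact DifferentiableAt.fun_sum fun i _ => DifferentiableAt.fun_sum fun j _ =>
      ((hG i j).mul (hdg i)).mul (hdg j)
  have hdN : ∀ k, DifferentiableAt ℝ (fun y => unitNormalCoord g f p y k) x := by
    intro k
    simp only [hN, div_eq_mul_inv]
    exact (hdg k).fun_mul (hdW.inv hW0)
  have hGN : ∀ y j, ∑ k, metricMatrix g p y k j * unitNormalCoord g f p y k =
      partialDeriv j F y * (W y)⁻¹ := by
    intro y j
    simp only [hN, div_eq_mul_inv, ← mul_assoc, ← Finset.sum_mul, hgrad]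
  -- Product rule applied to `hGN`; the second derivatives of F drop out by `hf`.
  have hS : ∀ i j, ∑ k, metricMatrix g p x k j *
      partialDeriv i (fun y => unitNormalCoord g f p y k) x =
      partialDeriv j F x * partialDeriv i (fun y => (W y)⁻¹) x -
        ∑ k, partialDeriv i (fun y => metricMatrix g p y k j) x * unitNormalCoord g f p x k := by
    intro i j
    have h1 : partialDeriv i (fun y => ∑ k, metricMatrix g p y k j * unitNormalCoord g f p y k) x =
        partialDeriv i (fun y => partialDeriv j F y * (W y)⁻¹) x := by
      simp only [hGN]
    rw [partialDeriv_sum (F := fun k y => metricMatrix g p y k j * unitNormalCoord g f p y k)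
      fun k _ => (hG k j).fun_mul (hdN k),
      partialDeriv_mul (H := fun y => (W y)⁻¹) (hf j).differentiableAt (hdW.inv hW0)] at h1
    simp only [partialDeriv_mul (hG _ j) (hdN _)] at h1
    rw [Finset.sum_add_distrib] at h1
    have h2 : partialDeriv i (partialDeriv j F) x = 0 := by
      rw [partialDeriv, (hf j).fderiv]; rfl
    rw [h2] at h1
    linarith
  -- The tensor gⁱʲ - NⁱNʲ annihilates df, since g⁻¹ df = ∇f = W N and df(N) = W.
  have hP : ∀ i, ∑ j, ((metricMatrix g p x)⁻¹ i j -
      unitNormalCoord g f p x i * unitNormalCoord g f p x j) * partialDeriv j F x = 0 := by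
    intro i
    simp only [sub_mul, Finset.sum_sub_distrib]
    have h1 : ∑ j, (metricMatrix g p x)⁻¹ i j * partialDeriv j F x = gradientCoord g f p x i := rfl
    have h2 : ∑ j, unitNormalCoord g f p x i * unitNormalCoord g f p x j * partialDeriv j F x =
        unitNormalCoord g f p x i * (W x)⁻¹ * (W x * W x) := by
      rw [hWW, Finset.mul_sum]
      refine Finset.sum_congr rfl fun j _ => ?_
      rw [hN x j]
      ring
    rw [h1, h2, hN]
    field_simp
    ring
  -- Lowering the upper index turns the Christoffel symbols into those of the first kind.
  have hC : ∀ i j, ∑ k, metricMatrix g p x k j *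
      ∑ l, christoffel g p x i l k * unitNormalCoord g f p x l =
      1 / 2 * ∑ l, (partialDeriv i (fun y => metricMatrix g p y l j) x
        + partialDeriv l (fun y => metricMatrix g p y i j) x
        - partialDeriv j (fun y => metricMatrix g p y i l) x) * unitNormalCoord g f p x l := by
    intro i j
    have h1 : ∀ l, ∑ k, metricMatrix g p x k j * (metricMatrix g p x)⁻¹ k l =
        if j = l then 1 else 0 := by
      intro l
      have := congrFun (congrFun (Matrix.mul_nonsing_inv _ (hu x)) j) l
      rw [Matrix.mul_apply, Matrix.one_apply] at this
      rw [← this]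
      exact Finset.sum_congr rfl fun k _ => by rw [← (hsymm x).apply]
    simp only [Finset.mul_sum]
    rw [Finset.sum_comm]
    refine Finset.sum_congr rfl fun l _ => ?_
    simp only [← mul_assoc, ← Finset.sum_mul]
    congr 1
    simp only [christoffel, Finset.mul_sum]
    rw [Finset.sum_comm]
    have h2 : ∀ m k, metricMatrix g p x k j * (1 / 2 * ((metricMatrix g p x)⁻¹ k m *
      (partialDeriv i (fun y => metricMatrix g p y l m) x +
            partialDeriv l (fun y => metricMatrix g p y i m) x -
          partialDeriv m (fun y => metricMatrix g p y i l) x))) =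
       (metricMatrix g p x k j * (metricMatrix g p x)⁻¹ k m) * (1 / 2 *
      (partialDeriv i (fun y => metricMatrix g p y l m) x +
            partialDeriv l (fun y => metricMatrix g p y i m) x -
          partialDeriv m (fun y => metricMatrix g p y i l) x)) := by
      intro m k
      ring
    simp only [h2, ← Finset.sum_mul, h1]
    simp
  have hA : ∀ i j, secondFundForm g f p x i j =
      partialDeriv j F x * partialDeriv i (fun y => (W y)⁻¹) x - 1 / 2 *
      ∑ l, (partialDeriv i (fun y => metricMatrix g p y l j) x
        + partialDeriv j (fun y => metricMatrix g p y i l) x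
        - partialDeriv l (fun y => metricMatrix g p y i j) x) * unitNormalCoord g f p x l := by
    intro i j
    simp only [secondFundForm, covDerivUnitNormal, mul_add, Finset.sum_add_distrib]
    rw [hS, hC, Finset.mul_sum, Finset.mul_sum, sub_add, ← Finset.sum_sub_distrib]
    congr 1
    refine Finset.sum_congr rfl fun l _ => ?_
    ring
  simp only [meanCurvature, hx, hA, mul_sub, Finset.sum_sub_distrib]
  have h0 : ∑ i, ∑ j, ((metricMatrix g p x)⁻¹ i j -
      unitNormalCoord g f p x i * unitNormalCoord g f p x j) *
      (partialDeriv j F x * partialDeriv i (fun y => (W y)⁻¹) x) = 0 := by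
    simp only [← mul_assoc, ← Finset.sum_mul, hP]
    simp
  rw [h0, zero_sub, neg_mul, Finset.mul_sum]
  congr 1
  refine Finset.sum_congr rfl fun i _ => ?_
  rw [Finset.mul_sum]
  refine Finset.sum_congr rfl fun j _ => ?_
  ring

end MeanCurvature

end LevelSets

/-! ### Cubic forms and traces -/

section CubicForms

section Cubic

variable {ι : Type*} [Fintype ι]

/-- The trilinear form with coefficients `T`. -/
def triForm (T : ι → ι → ι → ℝ) (a b c : ι → ℝ) : ℝ := ∑ l, ∑ i, ∑ j, T l i j * (a l * b i * c j)

/-- The bilinear form with coefficients `G`. -/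
def biForm (G : Matrix ι ι ℝ) (a b : ι → ℝ) : ℝ := ∑ i, ∑ j, G i j * (a i * b j)

/-- The linear form with coefficients `β`. -/
def linForm (β a : ι → ℝ) : ℝ := ∑ i, β i * a i

/-- Polarisation: two cubic forms that agree have the same symmetrised coefficients, seen by
inclusion-exclusion over sums of basis vectors. -/
theorem coeff_cyclic_of_cubic_eq [DecidableEq ι] {T : ι → ι → ι → ℝ}
    (hT : ∀ l i j, T l i j = T l j i) {G : Matrix ι ι ℝ} (hG : G.IsSymm) {β : ι → ℝ}
    (h : ∀ u, biForm G u u * linForm β u = triForm T u u u) (l i j : ι) :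
    T l i j + T i j l + T j l i = β l * G i j + β i * G j l + β j * G l i := by
  have t1 : ∀ a a' b c, triForm T (a + a') b c = triForm T a b c + triForm T a' b c := by
    intro a a' b c
    simp only [triForm, Pi.add_apply, add_mul, mul_add, Finset.sum_add_distrib]
  have t2 : ∀ a b b' c, triForm T a (b + b') c = triForm T a b c + triForm T a b' c := by
    intro a a' b c
    simp only [triForm, Pi.add_apply, add_mul, mul_add, Finset.sum_add_distrib]
  have t3 : ∀ a b c c', triForm T a b (c + c') = triForm T a b c + triForm T a b c' := by
    intro a a' b c
    simp only [triForm, Pi.add_apply, mul_add, Finset.sum_add_distrib]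
  have g1 : ∀ a a' b, biForm G (a + a') b = biForm G a b + biForm G a' b := by
    intro a a' b
    simp only [biForm, Pi.add_apply, add_mul, mul_add, Finset.sum_add_distrib]
  have g2 : ∀ a b b', biForm G a (b + b') = biForm G a b + biForm G a b' := by
    intro a b b'
    simp only [biForm, Pi.add_apply, mul_add, Finset.sum_add_distrib]
  have l1 : ∀ a a', linForm β (a + a') = linForm β a + linForm β a' := by
    intro a a'
    simp only [linForm, Pi.add_apply, mul_add, Finset.sum_add_distrib]
  have et : ∀ l i j, triForm T (Pi.single l 1) (Pi.single i 1) (Pi.single j 1) = T l i j := by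
    intro l i j
    simp [triForm, Pi.single_apply, mul_ite]
  have eg : ∀ i j, biForm G (Pi.single i 1) (Pi.single j 1) = G i j := by
    intro i j
    simp [biForm, Pi.single_apply, mul_ite]
  have el : ∀ i, linForm β (Pi.single i 1) = β i := by
    intro i
    simp [linForm, Pi.single_apply]
  have h1 := h (Pi.single l 1 + Pi.single i 1 + Pi.single j 1)
  have h2 := h (Pi.single l 1 + Pi.single i 1)
  have h3 := h (Pi.single l 1 + Pi.single j 1)
  have h4 := h (Pi.single i 1 + Pi.single j 1)
  have h5 := h (Pi.single l 1)
  have h6 := h (Pi.single i 1)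
  have h7 := h (Pi.single j 1)
  simp only [t1, t2, t3, g1, g2, l1, et, eg, el] at h1 h2 h3 h4 h5 h6 h7
  have s1 := hT l i j
  have s2 := hT i j l
  have s3 := hT j l i
  have s4 := hG.apply i j
  have s5 := hG.apply j l
  have s6 := hG.apply l i
  rw [← s1, ← s2, ← s3] at h1
  rw [s4, s5, s6] at h1
  rw [s6] at h2
  rw [s5] at h3
  rw [s4] at h4
  -- Each of the three cyclic terms arises from two permutations, identified by the symmetry in the
  -- last two indices; hence the factor 1/2.
  linear_combination (-1 / 2) * (h1 - h2 - h3 - h4 + h5 + h6 + h7)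

/-- Contraction of the polarised identity with A = G⁻¹: the term β_l G_ij contributes the dimension
times β_l, the other two contribute β_l each. -/
theorem trace_of_cubic_eq [DecidableEq ι] {T : ι → ι → ι → ℝ} (hT : ∀ l i j, T l i j = T l j i)
    {G A : Matrix ι ι ℝ} (hG : G.IsSymm) (hA : A.IsSymm) (hGA : G * A = 1) {β : ι → ℝ}
    (h : ∀ u, biForm G u u * linForm β u = triForm T u u u) (l : ι) :
    (∑ i, ∑ j, A i j * T l i j) + 2 * ∑ i, ∑ j, A i j * T i j l =
      (Fintype.card ι + 2) * β l := by
  have h1 := fun i j => coeff_cyclic_of_cubic_eq hT hG h l i j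
  have h2 : ∑ i, ∑ j, A i j * T j l i = ∑ i, ∑ j, A i j * T i j l := by
    rw [Finset.sum_comm]
    refine Finset.sum_congr rfl fun i _ => Finset.sum_congr rfl fun j _ => ?_
    rw [hA.apply, hT i l j]
  have h3 : ∀ i j, ∑ k, G i k * A j k = if i = j then 1 else 0 := by
    intro i j
    rw [← Matrix.one_apply, ← hGA, Matrix.mul_apply]
    exact Finset.sum_congr rfl fun k _ => by rw [hA.apply]
  have h4 : ∑ i, ∑ j, A i j * (T l i j + T i j l + T j l i) =
      ∑ i, ∑ j, A i j * (β l * G i j + β i * G j l + β j * G l i) := by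
    simp only [h1]
  simp only [mul_add, Finset.sum_add_distrib] at h4
  rw [h2] at h4
  have e1 : ∑ i, ∑ j, A i j * (β l * G i j) = Fintype.card ι * β l := by
    have : ∀ i, ∑ j, A i j * (β l * G i j) = β l := by
      intro i
      have := h3 i i
      rw [if_pos rfl] at this
      calc _ = β l * ∑ k, G i k * A i k := by
            rw [Finset.mul_sum]; exact Finset.sum_congr rfl fun k _ => by ring
        _ = β l := by rw [this, mul_one]
    simp [this]
  have e2 : ∑ i, ∑ j, A i j * (β i * G j l) = β l := by
    have : ∀ i, ∑ j, A i j * (β i * G j l) = β i * if l = i then 1 else 0 := by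
      intro i
      rw [← h3 l i, Finset.mul_sum]
      exact Finset.sum_congr rfl fun k _ => by rw [← hG.apply k l]; ring
    simp [this]
  have e3 : ∑ i, ∑ j, A i j * (β j * G l i) = β l := by
    rw [Finset.sum_comm, ← e2]
    refine Finset.sum_congr rfl fun i _ => Finset.sum_congr rfl fun j _ => ?_
    rw [hA.apply, hG.apply]
  rw [e1, e2, e3] at h4
  linarith

/-- Write a_l = ∑ A_ij T_lij, d_l = ∑ A_ij T_ijl and N for the dimension. Any solution β satisfies a
+ 2d = (N + 2) β by `trace_of_cubic_eq`. Substituting β = 2d - a gives (N + 1) β = 2a; conversely β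
= 2a / (N + 1) forces 2d - a = β. So the divergence d is eliminated in favour of the trace a. -/
theorem cubic_eq_iff [DecidableEq ι] {T : ι → ι → ι → ℝ} (hT : ∀ l i j, T l i j = T l j i)
    {G A : Matrix ι ι ℝ} (hG : G.IsSymm) (hA : A.IsSymm) (hGA : G * A = 1) :
    (∀ u, biForm G u u * linForm (fun l => 2 * (∑ i, ∑ j, A i j * T i j l) -
        ∑ i, ∑ j, A i j * T l i j) u = triForm T u u u) ↔
    ∀ u, (Fintype.card ι + 1) * triForm T u u u =
      2 * linForm (fun l => ∑ i, ∑ j, A i j * T l i j) u * biForm G u u := by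
  have hs : ∀ (c : ℝ) (β u : ι → ℝ), linForm (fun l => c * β l) u = c * linForm β u := by
    intro c β u
    simp only [linForm, Finset.mul_sum, mul_assoc]
  have hc : (0 : ℝ) < Fintype.card ι + 1 := by positivity
  constructor
  · intro h u
    have h1 := fun l => trace_of_cubic_eq hT hG hA hGA h l
    have h2 : (Fintype.card ι + 1) * linForm (fun l => 2 * (∑ i, ∑ j, A i j * T i j l) -
        ∑ i, ∑ j, A i j * T l i j) u = 2 * linForm (fun l => ∑ i, ∑ j, A i j * T l i j) u := by
      rw [← hs, ← hs]
      congr 1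
      funext l
      linarith [h1 l]
    rw [← h u, ← h2]
    ring
  · intro h
    have h0 : ∀ u, biForm G u u * linForm (fun l => (2 / (Fintype.card ι + 1)) *
        ∑ i, ∑ j, A i j * T l i j) u = triForm T u u u := by
      intro u
      rw [hs]
      field_simp
      linarith [h u]
    have h1 := fun l => trace_of_cubic_eq hT hG hA hGA h0 l
    intro u
    rw [← h0 u]
    congr 2
    funext l
    have h2 := h1 l
    field_simp at h2 ⊢
    linarith

end Cubic

end CubicForms

/-! ### The mean curvature and the derivative of the metric -/

section FirstDerivatives

/-- With N = u / W, the A-part of the projector contributes the linear form 2d - a evaluated at u,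
while in the N ⊗ N part the three index arrangements of T all become T(u, u, u), with signs adding
up to one. -/
theorem sum_proj_mul_eq {ι : Type*} [Fintype ι] {T : ι → ι → ι → ℝ}
    (hT : ∀ l i j, T l i j = T l j i) {A : Matrix ι ι ℝ} (hA : A.IsSymm) (u : ι → ℝ) {W : ℝ}
    (hW : W ≠ 0) :
    W ^ 3 * ∑ i, ∑ j, (A i j - u i / W * (u j / W)) *
      ∑ l, (T i l j + T j i l - T l i j) * (u l / W) =
    W ^ 2 * linForm (fun l => 2 * (∑ i, ∑ j, A i j * T i j l) - ∑ i, ∑ j, A i j * T l i j) u -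
      triForm T u u u := by
  have h1 : ∑ i, ∑ j, (A i j - u i / W * (u j / W)) *
      ∑ l, (T i l j + T j i l - T l i j) * (u l / W) =
      W⁻¹ * (∑ i, ∑ j, ∑ l, A i j * (T i l j + T j i l - T l i j) * u l) - W⁻¹ ^ 3 *
      (∑ i, ∑ j, ∑ l, (T i l j + T j i l - T l i j) * (u i * u j * u l)) := by
    simp only [Finset.mul_sum, ← Finset.sum_sub_distrib]
    refine Finset.sum_congr rfl fun i _ => Finset.sum_congr rfl fun j _ =>
      Finset.sum_congr rfl fun l _ => ?_
    rw [div_eq_mul_inv, div_eq_mul_inv, div_eq_mul_inv]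
    ring
  have h2 : ∑ i, ∑ j, ∑ l, (T i l j + T j i l - T l i j) * (u i * u j * u l) =
      triForm T u u u := by
    have e1 : ∑ i, ∑ j, ∑ l, T i l j * (u i * u j * u l) = triForm T u u u := by
      refine Finset.sum_congr rfl fun i _ => Finset.sum_congr rfl fun j _ =>
        Finset.sum_congr rfl fun l _ => ?_
      rw [hT]
    have e2 : ∑ i, ∑ j, ∑ l, T j i l * (u i * u j * u l) = triForm T u u u := by
      rw [Finset.sum_comm]
      refine Finset.sum_congr rfl fun i _ => Finset.sum_congr rfl fun j _ =>
        Finset.sum_congr rfl fun l _ => ?_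
      ring
    have e3 : ∑ i, ∑ j, ∑ l, T l i j * (u i * u j * u l) = triForm T u u u := by
      rw [Finset.sum_congr rfl fun i _ => Finset.sum_comm, Finset.sum_comm]
      refine Finset.sum_congr rfl fun i _ => Finset.sum_congr rfl fun j _ =>
        Finset.sum_congr rfl fun l _ => ?_
      ring
    simp only [sub_mul, add_mul, Finset.sum_add_distrib, Finset.sum_sub_distrib, e1, e2, e3]
    ring
  have h3 : ∑ i, ∑ j, ∑ l, A i j * (T i l j + T j i l - T l i j) * u l =
      linForm (fun l => 2 * (∑ i, ∑ j, A i j * T i j l) - ∑ i, ∑ j, A i j * T l i j) u := by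
    have e1 : ∀ l, ∑ i, ∑ j, A i j * T j i l = ∑ i, ∑ j, A i j * T i j l := by
      intro l
      rw [Finset.sum_comm]
      refine Finset.sum_congr rfl fun i _ => Finset.sum_congr rfl fun j _ => ?_
      rw [hA.apply]
    rw [Finset.sum_congr rfl fun i _ => Finset.sum_comm, Finset.sum_comm, linForm]
    refine Finset.sum_congr rfl fun l _ => ?_
    simp only [← Finset.sum_mul, mul_sub, mul_add, Finset.sum_add_distrib,
      Finset.sum_sub_distrib, e1]
    simp only [hT _ l]
    ring
  rw [h1, h2, h3]
  field_simp

/-- Multiplication by W ^ 3, where W ^ 2 = g(u, u) and u is the gradient, makes minimality a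
homogeneous cubic equation in u. -/
theorem meanCurvature_eq_zero_iff {n : ℕ} {M : Type*} [TopologicalSpace M]
    [ChartedSpace (EuclideanSpace ℝ (Fin n)) M] [IsManifold (𝓡 n) ∞ M]
    {g : RiemMetric n M} {f : M → ℝ} {p : M} {x : EuclideanSpace ℝ (Fin n)}
    (hx : extChartAt (𝓡 n) p p = x)
    (hsymm : ∀ y, (metricMatrix g p y).IsSymm)
    (hpos : ∀ y, (metricMatrix g p y).PosDef)
    (hG : ∀ i j, DifferentiableAt ℝ (fun y => metricMatrix g p y i j) x)
    (hf : ∀ l, HasFDerivAt (partialDeriv l (f ∘ (extChartAt (𝓡 n) p).symm))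
      (0 : EuclideanSpace ℝ (Fin n) →L[ℝ] ℝ) x)
    (hne : ∃ l, partialDeriv l (f ∘ (extChartAt (𝓡 n) p).symm) x ≠ 0) :
    meanCurvature g f p = 0 ↔
      biForm (metricMatrix g p x) (gradientCoord g f p x) (gradientCoord g f p x) *
        linForm (fun l =>
          2 * (∑ i, ∑ j, (metricMatrix g p x)⁻¹ i j *
            partialDeriv i (fun y => metricMatrix g p y j l) x) -
          ∑ i, ∑ j, (metricMatrix g p x)⁻¹ i j *
            partialDeriv l (fun y => metricMatrix g p y i j) x) (gradientCoord g f p x) =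
      triForm (fun l i j => partialDeriv l (fun y => metricMatrix g p y i j) x)
        (gradientCoord g f p x) (gradientCoord g f p x) (gradientCoord g f p x) := by
  obtain ⟨h1, h2⟩ := meanCurvature_eq hx hsymm hpos hG hf hne
  set W := √(∑ i, ∑ j, metricMatrix g p x i j * gradientCoord g f p x i *
    gradientCoord g f p x j) with hW
  have hW0 : W ≠ 0 := (Real.sqrt_pos.2 h2).ne'
  have hWW : W ^ 2 = biForm (metricMatrix g p x) (gradientCoord g f p x)
      (gradientCoord g f p x) := by
    rw [hW, Real.sq_sqrt h2.le]
    simp only [biForm, mul_assoc]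
  have hT : ∀ l i j, partialDeriv l (fun y => metricMatrix g p y i j) x =
      partialDeriv l (fun y => metricMatrix g p y j i) x := by
    intro l i j
    simp only [fun y => (hsymm y).apply i j]
  have hA : ((metricMatrix g p x)⁻¹).IsSymm := by
    rw [Matrix.IsSymm, Matrix.transpose_nonsing_inv, (hsymm x).eq]
  have h3 := sum_proj_mul_eq (T := fun l i j => partialDeriv l (fun y => metricMatrix g p y i j) x)
    hT hA (gradientCoord g f p x) hW0
  have hN : ∀ k, unitNormalCoord g f p x k = gradientCoord g f p x k / W := fun _ => rfl
  simp only [hN] at h1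
  rw [← hWW, ← sub_eq_zero (b := triForm _ _ _ _), ← h3, h1]
  simp [hW0]

theorem fderiv_chartMap_apply_eq {n : ℕ} {p : Sph n}
    {J : EuclideanSpace ℝ (Fin n) →ₗᵢ[ℝ] EuclideanSpace ℝ (Fin (n + 1))}
    (hJ : ∀ x, chartMap p x = (‖x‖ ^ 2 + 4)⁻¹ •
      ((4 : ℝ) • J x - (‖x‖ ^ 2 - 4) • (p : EuclideanSpace ℝ (Fin (n + 1)))))
    (x w : EuclideanSpace ℝ (Fin n)) :
    fderiv ℝ (chartMap p) x w = (4 / (‖x‖ ^ 2 + 4)) • J w -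
      (8 * ⟪x, w⟫ / (‖x‖ ^ 2 + 4) ^ 2) • J x -
      (16 * ⟪x, w⟫ / (‖x‖ ^ 2 + 4) ^ 2) • (p : EuclideanSpace ℝ (Fin (n + 1))) := by
  have hs : ‖x‖ ^ 2 + 4 ≠ 0 := by positivity
  have h0 : HasFDerivAt (fun y : EuclideanSpace ℝ (Fin n) => ‖y‖ ^ 2) (2 • innerSL ℝ x) x :=
    (hasStrictFDerivAt_norm_sq x).hasFDerivAt
  have h1 : HasFDerivAt (fun y : EuclideanSpace ℝ (Fin n) => (‖y‖ ^ 2 + 4)⁻¹)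
      (-((‖x‖ ^ 2 + 4) ^ 2)⁻¹ • (2 • innerSL ℝ x)) x :=
    (hasDerivAt_inv hs).comp_hasFDerivAt x (h0.add_const 4)
  have h2 : HasFDerivAt (fun y : EuclideanSpace ℝ (Fin n) => (4 : ℝ) • J y -
      (‖y‖ ^ 2 - 4) • (p : EuclideanSpace ℝ (Fin (n + 1))))
      ((4 : ℝ) • J.toContinuousLinearMap -
        (2 • innerSL ℝ x).smulRight (p : EuclideanSpace ℝ (Fin (n + 1)))) x :=
    ((J.toContinuousLinearMap.hasFDerivAt).const_smul (4 : ℝ)).sub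
      ((h0.sub_const 4).smul_const _)
  have h3 := h1.fun_smul h2
  rw [show chartMap p = fun y => _ from funext hJ, h3.fderiv]
  simp only [add_apply, smul_apply, sub_apply,
    ContinuousLinearMap.smulRight_apply, LinearIsometry.coe_toContinuousLinearMap,
    innerSL_apply_apply, smul_eq_mul, nsmul_eq_mul]
  match_scalars <;> field_simp <;> ring

/-- Stereographic projection is conformal. The conformal factor is even in x and equals 1 at the
centre; both facts are used later. -/
theorem inner_fderiv_chartMap {n : ℕ} (p : Sph n) (x v w : EuclideanSpace ℝ (Fin n)) :
    ⟪fderiv ℝ (chartMap p) x v, fderiv ℝ (chartMap p) x w⟫ =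
      (4 / (‖x‖ ^ 2 + 4)) ^ 2 * ⟪v, w⟫ := by
  obtain ⟨J, hp, -, hJ⟩ := exists_chartMap_eq p
  have hp' : ∀ y, ⟪J y, (p : EuclideanSpace ℝ (Fin (n + 1)))⟫ = 0 := fun y => by
    rw [real_inner_comm, hp]
  have hs : ‖x‖ ^ 2 + 4 ≠ 0 := by positivity
  have hpp : ⟪(p : EuclideanSpace ℝ (Fin (n + 1))), (p : EuclideanSpace ℝ (Fin (n + 1)))⟫ = 1 := by
    rw [real_inner_self_eq_norm_sq, norm_eq_of_mem_sphere]; norm_num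
  rw [fderiv_chartMap_apply_eq hJ, fderiv_chartMap_apply_eq hJ]
  simp only [inner_sub_left, inner_sub_right, inner_smul_left, inner_smul_right, hp, hp',
    LinearIsometry.inner_map_map, hpp, real_inner_self_eq_norm_sq, real_inner_comm x]
  simp only [conj_trivial]
  field_simp
  ring

theorem chartVector_injective {n : ℕ} (p : Sph n) (x : EuclideanSpace ℝ (Fin n)) :
    Function.Injective (chartVector p x) := by
  rw [injective_iff_map_eq_zero]
  intro v hv
  have h := inner_fderiv_chartMap p x v v
  rw [← tangentIncl_chartVector, hv, map_zero, inner_zero_left, real_inner_self_eq_norm_sq] at h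
  have hs : ‖x‖ ^ 2 + 4 ≠ 0 := by positivity
  have h2 : ‖v‖ = 0 := by
    by_contra h3
    have : (4 / (‖x‖ ^ 2 + 4)) ^ 2 * ‖v‖ ^ 2 ≠ 0 := by positivity
    exact this h.symm
  simpa using h2

section

variable {n : ℕ} (g : RiemMetric n (Sph n)) (p : Sph n)

theorem chartForm_symm (x v w : EuclideanSpace ℝ (Fin n)) :
    chartForm g p x v w = chartForm g p x w v := g.symm _ _ _

theorem chartForm_pos (x : EuclideanSpace ℝ (Fin n)) {v : EuclideanSpace ℝ (Fin n)} (hv : v ≠ 0) :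
    0 < chartForm g p x v v :=
  g.pos _ _ fun h => hv (chartVector_injective p x (h.trans (map_zero _).symm))

theorem metricMatrix_isSymm (x : EuclideanSpace ℝ (Fin n)) : (metricMatrix g p x).IsSymm := by
  ext i j
  rw [Matrix.transpose_apply, metricMatrix_apply, metricMatrix_apply, chartForm_symm]

theorem biForm_metricMatrix (x v w : EuclideanSpace ℝ (Fin n)) :
    biForm (metricMatrix g p x) v w = chartForm g p x v w := by
  rw [chartForm_eq_sum]
  refine Finset.sum_congr rfl fun i _ => Finset.sum_congr rfl fun j _ => mul_comm _ _

theorem metricMatrix_posDef (x : EuclideanSpace ℝ (Fin n)) : (metricMatrix g p x).PosDef := by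
  refine Matrix.PosDef.of_dotProduct_mulVec_pos ?_ fun v hv => ?_
  · rw [Matrix.IsHermitian, Matrix.conjTranspose_eq_transpose_of_trivial]
    exact metricMatrix_isSymm g p x
  · have h : WithLp.toLp 2 v ≠ 0 := fun h => hv (by simpa using congrArg WithLp.ofLp h)
    have := chartForm_pos g p x h
    rw [← biForm_metricMatrix] at this
    refine this.trans_eq ?_
    simp only [biForm, dotProduct, Matrix.mulVec, Finset.mul_sum, Pi.star_apply, star_trivial]
    exact Finset.sum_congr rfl fun i _ => Finset.sum_congr rfl fun j _ => by ring

theorem differentiableAt_metricMatrix (i j : Fin n) :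
    DifferentiableAt ℝ (fun y => metricMatrix g p y i j) 0 := by
  simp only [metricMatrix_apply]
  exact (contDiffAt_chartForm g p _ _).differentiableAt (by simp)

end

end FirstDerivatives

/-! ### Minimal equators in terms of a volume normalisation -/

section EquatorCondition

variable {n : ℕ}

/-- The derivative L at 0 is also the derivative of x ↦ f(-x), so L = -L. -/
theorem hasFDerivAt_zero_of_even {E : Type*} [NormedAddCommGroup E] [NormedSpace ℝ E]
    {f : E → ℝ} (hf : DifferentiableAt ℝ f 0)
    (h : ∀ x, f (-x) = f x) : HasFDerivAt f (0 : E →L[ℝ] ℝ) 0 := by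
  have h1 : HasFDerivAt f (fderiv ℝ f 0) (-0) := by simpa using hf.hasFDerivAt
  have h2 := (h1.comp (0 : E) (hasFDerivAt_id (0 : E)).neg).unique
    (hf.hasFDerivAt.congr_of_eventuallyEq (Filter.Eventually.of_forall h))
  have h3 : fderiv ℝ f 0 = 0 := by
    ext u
    have := congrArg (fun L => L u) h2
    simp at this
    simp
    linarith
  exact h3 ▸ hf.hasFDerivAt

theorem partialDeriv_height {p : Sph n}
    {J : EuclideanSpace ℝ (Fin n) →ₗᵢ[ℝ] EuclideanSpace ℝ (Fin (n + 1))}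
    (hp : ∀ y, ⟪(p : EuclideanSpace ℝ (Fin (n + 1))), J y⟫ = 0)
    (hJ : ∀ x, chartMap p x = (‖x‖ ^ 2 + 4)⁻¹ •
      ((4 : ℝ) • J x - (‖x‖ ^ 2 - 4) • (p : EuclideanSpace ℝ (Fin (n + 1)))))
    (y x : EuclideanSpace ℝ (Fin n)) (l : Fin n) :
    partialDeriv l (height (J y) ∘ (extChartAt (𝓡 n) p).symm) x =
      4 / (‖x‖ ^ 2 + 4) * y l - 8 * x l / (‖x‖ ^ 2 + 4) ^ 2 * ⟪x, y⟫ := by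
  have h1 : fderiv ℝ (fun x => ⟪chartMap p x, J y⟫) x (EuclideanSpace.single l 1) =
      ⟪fderiv ℝ (chartMap p) x (EuclideanSpace.single l 1), J y⟫ := by
    rw [fderiv_inner_apply (𝕜 := ℝ) ((contDiff_chartMap p).differentiable (by simp) x)
      (differentiableAt_const _)]
    simp
  have h2 : partialDeriv l (height (J y) ∘ (extChartAt (𝓡 n) p).symm) x =
    fderiv ℝ (fun x => ⟪chartMap p x, J y⟫) x (EuclideanSpace.single l 1) := rfl
  rw [h2, h1, fderiv_chartMap_apply_eq hJ]
  simp [inner_sub_left, inner_smul_left, hp, EuclideanSpace.inner_single_left,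
    EuclideanSpace.inner_single_right]

/-- The first partial derivatives of these height functions are even in the stereographic
coordinates, so the coordinate Hessian vanishes at the centre. -/
theorem hasFDerivAt_partialDeriv_height {p : Sph n}
    {J : EuclideanSpace ℝ (Fin n) →ₗᵢ[ℝ] EuclideanSpace ℝ (Fin (n + 1))}
    (hp : ∀ y, ⟪(p : EuclideanSpace ℝ (Fin (n + 1))), J y⟫ = 0)
    (hJ : ∀ x, chartMap p x = (‖x‖ ^ 2 + 4)⁻¹ •
      ((4 : ℝ) • J x - (‖x‖ ^ 2 - 4) • (p : EuclideanSpace ℝ (Fin (n + 1)))))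
    (y : EuclideanSpace ℝ (Fin n)) (l : Fin n) :
    HasFDerivAt (partialDeriv l (height (J y) ∘ (extChartAt (𝓡 n) p).symm))
      (0 : EuclideanSpace ℝ (Fin n) →L[ℝ] ℝ) 0 := by
  have h1 : partialDeriv l (height (J y) ∘ (extChartAt (𝓡 n) p).symm) = fun x =>
      4 / (‖x‖ ^ 2 + 4) * y l - 8 * x l / (‖x‖ ^ 2 + 4) ^ 2 * ⟪x, y⟫ :=
    funext fun x => partialDeriv_height hp hJ y x l
  rw [h1]
  refine hasFDerivAt_zero_of_even ?_ fun x => ?_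
  · have h0 : DifferentiableAt ℝ (fun x : EuclideanSpace ℝ (Fin n) => ‖x‖ ^ 2 + 4) 0 :=
      ((hasStrictFDerivAt_norm_sq (0 : EuclideanSpace ℝ (Fin n))).differentiableAt).add_const 4
    have h2 : DifferentiableAt ℝ (fun x : EuclideanSpace ℝ (Fin n) => x l) 0 := by fun_prop
    simp only [div_eq_mul_inv]
    refine (((h0.inv (by simp)).const_mul 4).mul_const _).sub (((h2.const_mul 8).mul
      ((h0.pow 2).inv (by simp))).mul
      ((differentiableAt_id).inner ℝ (differentiableAt_const y)))
  · simp only [norm_neg, inner_neg_left, PiLp.neg_apply]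
    ring

/-- Jacobi's formula, obtained from det(B + tH) = det B · det(1 + t B⁻¹H) by differentiating along
the line t ↦ B + tH. -/
theorem hasFDerivAt_det {ι : Type*} [Fintype ι] [DecidableEq ι] (B H : ι → ι → ℝ)
    (hB : IsUnit (Matrix.of B).det) :
    fderiv ℝ (fun A : ι → ι → ℝ => (Matrix.of A).det) B H =
      (Matrix.of B).det * ((Matrix.of B)⁻¹ * Matrix.of H).trace := by
  have hd : DifferentiableAt ℝ (fun A : ι → ι → ℝ => (Matrix.of A).det) B :=
    DifferentiableAt.matrix_det fun i j => by simp only [Matrix.of_apply]; fun_prop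
  have h1 : HasDerivAt (fun t : ℝ => (Matrix.of (B + t • H)).det)
      (fderiv ℝ (fun A : ι → ι → ℝ => (Matrix.of A).det) B H) 0 := by
    have h2 : HasDerivAt (fun t : ℝ => B + t • H) H 0 := by
      simpa using ((hasDerivAt_id (0 : ℝ)).smul_const H).const_add B
    have h3 : HasFDerivAt (fun A : ι → ι → ℝ => (Matrix.of A).det)
        (fderiv ℝ (fun A : ι → ι → ℝ => (Matrix.of A).det) B) (B + (0 : ℝ) • H) := by
      simpa using hd.hasFDerivAt
    exact h3.comp_hasDerivAt (0 : ℝ) h2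
  set C := (Matrix.of B)⁻¹ * Matrix.of H with hC
  -- The remainder of the expansion of det(1 + tC) beyond 1 + t tr C is t ^ 2 times a polynomial,
  -- hence irrelevant at t = 0.
  have h4 : ∀ t : ℝ, (Matrix.of (B + t • H)).det = (Matrix.of B).det * (1 + C.trace * t +
      (Matrix.det (1 + (Polynomial.X : Polynomial ℝ) • C.map Polynomial.C)).divX.divX.eval t *
        t ^ 2) := by
    intro t
    rw [← Matrix.det_one_add_smul, ← Matrix.det_mul, mul_add, mul_one, mul_smul_comm, hC,
      Matrix.mul_nonsing_inv_cancel_left _ _ hB]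
    rfl
  have h5 : HasDerivAt (fun t : ℝ => (Matrix.of (B + t • H)).det)
      ((Matrix.of B).det * C.trace) 0 := by
    simp only [h4]
    refine HasDerivAt.const_mul _ ?_
    have e1 := (Polynomial.hasDerivAt (Matrix.det
      (1 + (Polynomial.X : Polynomial ℝ) • C.map Polynomial.C)).divX.divX (0 : ℝ)).mul
      (hasDerivAt_pow 2 (0 : ℝ))
    have e2 := (((hasDerivAt_id (0 : ℝ)).const_mul C.trace).const_add 1).add e1
    refine e2.congr_deriv ?_
    simp
  exact h1.unique h5

theorem fderiv_matrix_det {E ι : Type*} [NormedAddCommGroup E] [NormedSpace ℝ E] [Fintype ι]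
    [DecidableEq ι] {A : E → Matrix ι ι ℝ} {x : E}
    (hA : ∀ i j, DifferentiableAt ℝ (fun y => A y i j) x) (h : IsUnit (A x).det) (u : E) :
    fderiv ℝ (fun y => (A y).det) x u =
      (A x).det * ∑ i, ∑ j, (A x)⁻¹ i j * fderiv ℝ (fun y => A y j i) x u := by
  -- The values are regarded as points of a product space, so that the derivative can be assembled
  -- entry by entry.
  let A' : E → ι → ι → ℝ := A
  have hA' : HasFDerivAt A' (ContinuousLinearMap.pi fun i => ContinuousLinearMap.pi fun j =>
      fderiv ℝ (fun y => A y i j) x) x :=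
    hasFDerivAt_pi.2 fun i => hasFDerivAt_pi.2 fun j => (hA i j).hasFDerivAt
  have hd : DifferentiableAt ℝ (fun B : ι → ι → ℝ => (Matrix.of B).det) (A' x) :=
    DifferentiableAt.matrix_det fun i j => by simp only [Matrix.of_apply]; fun_prop
  have h1 := hd.hasFDerivAt.comp x hA'
  have h2 : (fun y => (A y).det) = (fun B : ι → ι → ℝ => (Matrix.of B).det) ∘ A' := rfl
  rw [h2, h1.fderiv, ContinuousLinearMap.comp_apply, hasFDerivAt_det _ _ h]
  rfl

/-- The cubic identity of `meanCurvature_eq_zero_iff` is required for every gradient of a height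
function at p, which means for every u; `cubic_eq_iff` then applies, and Jacobi's formula rewrites
the trace as the derivative of the determinant. -/
theorem hasMinimalEquators_iff_det (g : RiemMetric n (Sph n)) :
    HasMinimalEquators g ↔ ∀ (p : Sph n) (u : EuclideanSpace ℝ (Fin n)),
      (n + 1) * (metricMatrix g p 0).det * fderiv ℝ (fun x => chartForm g p x u u) 0 u =
        2 * fderiv ℝ (fun x => (metricMatrix g p x).det) 0 u * chartForm g p 0 u u := by
  have hpart : ∀ (F : EuclideanSpace ℝ (Fin n) → ℝ) (u : EuclideanSpace ℝ (Fin n)),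
      fderiv ℝ F 0 u = ∑ l, partialDeriv l F 0 * u l := by
    intro F u
    conv_lhs => rw [eq_sum_single u]
    simp [partialDeriv, mul_comm]
  have key : HasMinimalEquators g ↔ ∀ p : Sph n, ∀ u : Fin n → ℝ,
      biForm (metricMatrix g p 0) u u *
        linForm (fun l =>
          2 * (∑ i, ∑ j, (metricMatrix g p 0)⁻¹ i j *
            partialDeriv i (fun y => metricMatrix g p y j l) 0) -
          ∑ i, ∑ j, (metricMatrix g p 0)⁻¹ i j *
            partialDeriv l (fun y => metricMatrix g p y i j) 0) u =
      triForm (fun l i j => partialDeriv l (fun y => metricMatrix g p y i j) 0) u u u := by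
    have hp0 : ∀ (p : Sph n) (J : EuclideanSpace ℝ (Fin n) →ₗᵢ[ℝ] EuclideanSpace ℝ (Fin (n + 1)))
        (hp : ∀ y, ⟪(p : EuclideanSpace ℝ (Fin (n + 1))), J y⟫ = 0)
        (hJ : ∀ x, chartMap p x = (‖x‖ ^ 2 + 4)⁻¹ •
          ((4 : ℝ) • J x - (‖x‖ ^ 2 - 4) • (p : EuclideanSpace ℝ (Fin (n + 1)))))
        (y : EuclideanSpace ℝ (Fin n)) (l : Fin n),
        partialDeriv l (height (J y) ∘ (extChartAt (𝓡 n) p).symm) 0 = y l := by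
      intro p J hp hJ y l
      rw [partialDeriv_height hp hJ]
      simp
    have hgr : ∀ (p : Sph n) (J : EuclideanSpace ℝ (Fin n) →ₗᵢ[ℝ] EuclideanSpace ℝ (Fin (n + 1)))
        (hp : ∀ y, ⟪(p : EuclideanSpace ℝ (Fin (n + 1))), J y⟫ = 0)
        (hJ : ∀ x, chartMap p x = (‖x‖ ^ 2 + 4)⁻¹ •
          ((4 : ℝ) • J x - (‖x‖ ^ 2 - 4) • (p : EuclideanSpace ℝ (Fin (n + 1)))))
        (y : EuclideanSpace ℝ (Fin n)),
        gradientCoord g (height (J y)) p 0 = (metricMatrix g p 0)⁻¹.mulVec y.ofLp := by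
      intro p J hp hJ y
      funext k
      simp only [gradientCoord, hp0 p J hp hJ]
      rfl
    constructor
    · intro h p u
      obtain ⟨J, hp, -, hJ⟩ := exists_chartMap_eq p
      have hu := (metricMatrix_posDef g p 0).isUnit.map Matrix.detMonoidHom
      by_cases hu0 : u = 0
      · subst hu0
        simp [biForm, triForm]
      -- The differential of the height function of J y at the centre is y, so y = G u makes its
      -- gradient equal to u.
      set y : EuclideanSpace ℝ (Fin n) := WithLp.toLp 2 ((metricMatrix g p 0).mulVec u) with hy
      have hAy : (metricMatrix g p 0)⁻¹.mulVec y.ofLp = u := by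
        rw [hy, Matrix.mulVec_mulVec, Matrix.nonsing_inv_mul _ hu, Matrix.one_mulVec]
      have hy0 : y ≠ 0 := by
        intro h0
        rw [h0] at hAy
        exact hu0 (by rw [← hAy]; simp)
      have hl : ∃ l, partialDeriv l (height (J y) ∘ (extChartAt (𝓡 n) p).symm) 0 ≠ 0 := by
        by_contra! hl
        apply hy0
        ext l
        rw [← hp0 p J hp hJ, hl]
        rfl
      have h1 := (meanCurvature_eq_zero_iff (extChartAt_self p) (metricMatrix_isSymm g p)
        (metricMatrix_posDef g p) (differentiableAt_metricMatrix g p)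
        (hasFDerivAt_partialDeriv_height hp hJ y) hl).1
        (h (J y) (fun h0 => hy0 (J.injective (h0.trans (map_zero J).symm))) p (hp y))
      rwa [hgr p J hp hJ, hAy] at h1
    · intro h v hv p hpv
      obtain ⟨J, hp, hs, hJ⟩ := exists_chartMap_eq p
      obtain ⟨y, rfl⟩ := hs v hpv
      have hy0 : y ≠ 0 := fun h0 => hv (by rw [h0, map_zero])
      have hl : ∃ l, partialDeriv l (height (J y) ∘ (extChartAt (𝓡 n) p).symm) 0 ≠ 0 := by
        by_contra! hl
        apply hy0
        ext l
        rw [← hp0 p J hp hJ, hl]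
        rfl
      exact (meanCurvature_eq_zero_iff (extChartAt_self p) (metricMatrix_isSymm g p)
        (metricMatrix_posDef g p) (differentiableAt_metricMatrix g p)
        (hasFDerivAt_partialDeriv_height hp hJ y) hl).2 (h p _)
  rw [key]
  refine forall_congr' fun p => ?_
  have hu := (metricMatrix_posDef g p 0).isUnit.map Matrix.detMonoidHom
  have hT : ∀ l i j, partialDeriv l (fun y => metricMatrix g p y i j) 0 =
      partialDeriv l (fun y => metricMatrix g p y j i) 0 := by
    intro l i j
    simp only [fun y => (metricMatrix_isSymm g p y).apply i j]
  have hA : ((metricMatrix g p 0)⁻¹).IsSymm := by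
    rw [Matrix.IsSymm, Matrix.transpose_nonsing_inv, (metricMatrix_isSymm g p 0).eq]
  have hdG : ∀ (w : EuclideanSpace ℝ (Fin n)), fderiv ℝ (fun x => chartForm g p x w w) 0 w =
      triForm (fun l i j => partialDeriv l (fun y => metricMatrix g p y i j) 0) w w w := by
    intro w
    rw [hpart, triForm]
    refine Finset.sum_congr rfl fun l _ => ?_
    simp only [chartForm_eq_sum]
    have hd : ∀ i j, DifferentiableAt ℝ (fun y => w i * w j * metricMatrix g p y i j) 0 :=
      fun i j => (differentiableAt_metricMatrix g p i j).const_mul _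
    rw [partialDeriv_sum fun i _ => DifferentiableAt.fun_sum fun j _ => hd i j, Finset.sum_mul]
    refine Finset.sum_congr rfl fun i _ => ?_
    rw [partialDeriv_sum fun j _ => hd i j, Finset.sum_mul]
    refine Finset.sum_congr rfl fun j _ => ?_
    rw [partialDeriv_mul (differentiableAt_const _) (differentiableAt_metricMatrix g p i j)]
    simp only [partialDeriv, fderiv_fun_const]
    simp
    ring
  have hdd : ∀ (w : EuclideanSpace ℝ (Fin n)), fderiv ℝ (fun x => (metricMatrix g p x).det) 0 w =
      (metricMatrix g p 0).det * linForm (fun l => ∑ i, ∑ j, (metricMatrix g p 0)⁻¹ i j *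
            partialDeriv l (fun y => metricMatrix g p y i j) 0) w := by
    intro w
    rw [hpart, linForm, Finset.mul_sum]
    refine Finset.sum_congr rfl fun l _ => ?_
    rw [partialDeriv, fderiv_matrix_det (differentiableAt_metricMatrix g p) hu, ← mul_assoc]
    congr 2
    refine Finset.sum_congr rfl fun i _ => Finset.sum_congr rfl fun j _ => ?_
    rw [hT]
    rfl
  have hdet : (metricMatrix g p 0).det ≠ 0 := (metricMatrix_posDef g p 0).det_pos.ne'
  rw [cubic_eq_iff hT (metricMatrix_isSymm g p 0) hA (Matrix.mul_nonsing_inv _ hu),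
    Fintype.card_fin]
  constructor
  · intro h u
    rw [hdG, hdd, ← biForm_metricMatrix]
    linear_combination (metricMatrix g p 0).det * h u.ofLp
  · intro h u
    have h1 := h (WithLp.toLp 2 u)
    rw [hdG, hdd, ← biForm_metricMatrix] at h1
    refine mul_left_cancel₀ hdet ?_
    linear_combination h1

/-- In the preferred chart at `p`, the determinant of the metric is `F ^ (2 α)` times that of the
canonical metric. -/
theorem det_metricMatrix_eq {g : RiemMetric n (Sph n)} {α : ℝ} {F : Sph n → ℝ}
    (hF : IsVolumeNormalisation (metricTensor g) α F) (p : Sph n)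
    (x : EuclideanSpace ℝ (Fin n)) :
    (metricMatrix g p x).det =
      F (chartPoint p x) ^ (2 * α) * ((4 / (‖x‖ ^ 2 + 4)) ^ 2) ^ n := by
  have h := hF.2.2 (chartPoint p x) (fun i => coordVector p x i)
  have h1 : volumeElement (metricTensor g) (chartPoint p x) (fun i => coordVector p x i) =
    √(metricMatrix g p x).det := rfl
  have h2 : volumeElement (roundTensor n) (chartPoint p x) (fun i => coordVector p x i) =
      √(((4 / (‖x‖ ^ 2 + 4)) ^ 2) ^ n) := by
    have : (Matrix.of fun i j => roundTensor n (chartPoint p x) (coordVector p x i)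
        (coordVector p x j)) = Matrix.diagonal fun _ => (4 / (‖x‖ ^ 2 + 4)) ^ 2 := by
      ext i j
      change ⟪tangentIncl (chartPoint p x) (chartVector p x (EuclideanSpace.single i 1)),
        tangentIncl (chartPoint p x) (chartVector p x (EuclideanSpace.single j 1))⟫ = _
      rw [tangentIncl_chartVector, tangentIncl_chartVector, inner_fderiv_chartMap, Matrix.diagonal_apply,
        EuclideanSpace.inner_single_left]
      simp
    refine (congrArg (fun A => √(Matrix.det A)) this).trans ?_
    simp [Matrix.det_diagonal]
  rw [h1, h2] at h
  have h3 := congrArg (· ^ 2) h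
  simp only [mul_pow] at h3
  rw [Real.sq_sqrt (metricMatrix_posDef g p x).det_pos.le, Real.sq_sqrt (by positivity)] at h3
  rw [h3, mul_comm 2 α, Real.rpow_mul (hF.2.1 _).le, Real.rpow_two]

theorem differentiableAt_comp_chartPoint {F : Sph n → ℝ} (hF : ContMDiff (𝓡 n) 𝓘(ℝ) ∞ F)
    (p : Sph n) (x : EuclideanSpace ℝ (Fin n)) :
    DifferentiableAt ℝ (fun x => F (chartPoint p x)) x :=
  ((hF.comp (contMDiff_chartPoint p)).contDiff.differentiable (by simp)) x

/-- The exponent (n + 1) / 4 is chosen for this: det G is F ^ ((n + 1) / 2) times an even function,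
so d(det G) / det G = ((n + 1) / 2) dF / F at the centre. The factor n + 1 cancels and the numerator
of the quotient rule for g(u, u) / F remains. -/
theorem hasMinimalEquators_iff {g : RiemMetric n (Sph n)} {F : Sph n → ℝ}
    (hF : IsVolumeNormalisation (metricTensor g) (((n : ℝ) + 1) / 4) F) :
    HasMinimalEquators g ↔ ∀ (p : Sph n) (u : EuclideanSpace ℝ (Fin n)),
      fderiv ℝ (fun x => chartForm g p x u u / F (chartPoint p x)) 0 u = 0 := by
  rw [hasMinimalEquators_iff_det]
  refine forall_congr' fun p => forall_congr' fun u => ?_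
  have hdF := differentiableAt_comp_chartPoint hF.1 p 0
  have hdc : DifferentiableAt ℝ (fun x => chartForm g p x u u) 0 :=
    (contDiffAt_chartForm g p u u).differentiableAt (by simp)
  have hF0 : 0 < F (chartPoint p 0) := hF.2.1 _
  -- The determinant of the canonical metric is even in x, so it contributes nothing to first order.
  have hs : HasFDerivAt (fun x : EuclideanSpace ℝ (Fin n) => ((4 / (‖x‖ ^ 2 + 4)) ^ 2) ^ n)
      (0 : EuclideanSpace ℝ (Fin n) →L[ℝ] ℝ) 0 := by
    refine hasFDerivAt_zero_of_even ?_ fun x => by simp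
    have h0 : DifferentiableAt ℝ (fun x : EuclideanSpace ℝ (Fin n) => ‖x‖ ^ 2 + 4) 0 :=
      ((hasStrictFDerivAt_norm_sq (0 : EuclideanSpace ℝ (Fin n))).differentiableAt).add_const 4
    simp only [div_eq_mul_inv]
    exact (((h0.inv (by simp)).const_mul 4).pow 2).pow n
  have hr : HasFDerivAt (fun x => F (chartPoint p x) ^ (2 * (((n : ℝ) + 1) / 4)))
      ((2 * (((n : ℝ) + 1) / 4) * F (chartPoint p 0) ^ (2 * (((n : ℝ) + 1) / 4) - 1)) •
        fderiv ℝ (fun x => F (chartPoint p x)) 0) 0 :=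
    hdF.hasFDerivAt.rpow_const (Or.inl hF0.ne')
  have hdet : fderiv ℝ (fun x => (metricMatrix g p x).det) 0 u =
      ((n : ℝ) + 1) / 2 * (metricMatrix g p 0).det / F (chartPoint p 0) *
        fderiv ℝ (fun x => F (chartPoint p x)) 0 u := by
    simp only [det_metricMatrix_eq hF]
    rw [(hr.fun_mul hs).fderiv, Real.rpow_sub hF0, Real.rpow_one]
    simp
    left
    ring
  have hpos := (metricMatrix_posDef g p 0).det_pos
  have hq : fderiv ℝ (fun x => chartForm g p x u u / F (chartPoint p x)) 0 u =
      (fderiv ℝ (fun x => chartForm g p x u u) 0 u * F (chartPoint p 0) -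
        chartForm g p 0 u u * fderiv ℝ (fun x => F (chartPoint p x)) 0 u) /
          F (chartPoint p 0) ^ 2 := by
    have hi : HasFDerivAt (fun x => (F (chartPoint p x))⁻¹)
        (-(F (chartPoint p 0) ^ 2)⁻¹ • fderiv ℝ (fun x => F (chartPoint p x)) 0) 0 :=
      (hasDerivAt_inv hF0.ne').comp_hasFDerivAt (0 : EuclideanSpace ℝ (Fin n)) hdF.hasFDerivAt
    simp only [div_eq_mul_inv]
    rw [(hdc.hasFDerivAt.fun_mul hi).fderiv]
    simp only [add_apply, smul_apply, smul_eq_mul]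
    field_simp
    ring
  rw [hq, hdet, div_eq_zero_iff, or_iff_left (pow_pos hF0 2).ne', sub_eq_zero]
  have hn : (0 : ℝ) < n + 1 := by positivity
  field_simp

end EquatorCondition

/-! ### Riemannian metrics from smooth families of scalar products -/

section MetricFamilies

variable {n : ℕ}

/-- Families of scalar products on the tangent spaces of `𝕊ⁿ` that are smooth in charts. -/
structure IsMetricFamily
    (b : ∀ p : Sph n, TangentSpace (𝓡 n) p →ₗ[ℝ] TangentSpace (𝓡 n) p →ₗ[ℝ] ℝ) : Prop where
  symm : ∀ p v w, b p v w = b p w v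
  pos : ∀ p v, v ≠ 0 → 0 < b p v v
  smooth : ∀ p v w, ContDiffAt ℝ ∞
    (fun x => b (chartPoint p x) (chartVector p x v) (chartVector p x w)) 0

/-- On the compact unit sphere b(v, v) attains a positive minimum c, so b(v, v) ≥ c ‖v‖ ^ 2
everywhere. -/
theorem isVonNBounded_of_pos {V : Type*} [NormedAddCommGroup V] [NormedSpace ℝ V]
    [FiniteDimensional ℝ V] (b : V →ₗ[ℝ] V →ₗ[ℝ] ℝ) (hb : ∀ v, v ≠ 0 → 0 < b v v) :
    Bornology.IsVonNBounded ℝ {v : V | b v v < 1} := by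
  rw [NormedSpace.isVonNBounded_iff]
  have hc : Continuous fun v => b v v := by
    have h : Continuous fun v => b.toContinuousBilinearMap v v := by fun_prop
    exact h
  rcases (Metric.sphere (0 : V) 1).eq_empty_or_nonempty with he | hne
  -- An empty unit sphere means that the space is zero.
  · refine (Bornology.IsBounded.subset (Bornology.isBounded_singleton (x := (0 : V)))) ?_
    intro v _
    by_contra hv
    have : ‖v‖⁻¹ • v ∈ Metric.sphere (0 : V) 1 := by
      rw [mem_sphere_zero_iff_norm, norm_smul, norm_inv, norm_norm]
      exact inv_mul_cancel₀ (norm_ne_zero_iff.2 hv)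
    rw [he] at this
    exact this
  · obtain ⟨m, hm, hmin⟩ := (isCompact_sphere (0 : V) 1).exists_isMinOn hne hc.continuousOn
    have hm1 : ‖m‖ = 1 := mem_sphere_zero_iff_norm.1 hm
    have hc0 : 0 < b m m := hb m fun h => by simp [h] at hm1
    have hle : ∀ v, b m m * ‖v‖ ^ 2 ≤ b v v := by
      intro v
      by_cases hv : v = 0
      · simp [hv]
      have hv' : ‖v‖ ≠ 0 := norm_ne_zero_iff.2 hv
      have h1 : ‖v‖⁻¹ • v ∈ Metric.sphere (0 : V) 1 := by
        rw [mem_sphere_zero_iff_norm, norm_smul, norm_inv, norm_norm]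
        exact inv_mul_cancel₀ hv'
      have h2 : b m m ≤ b (‖v‖⁻¹ • v) (‖v‖⁻¹ • v) := hmin h1
      simp only [map_smul, LinearMap.smul_apply, smul_eq_mul] at h2
      calc b m m * ‖v‖ ^ 2 ≤ (‖v‖⁻¹ * (‖v‖⁻¹ * b v v)) * ‖v‖ ^ 2 := by gcongr
        _ = b v v := by field_simp
    refine (Metric.isBounded_ball (x := (0 : V)) (r := 1 / b m m + 1)).subset fun v hv => ?_
    rw [mem_ball_zero_iff]
    have h1 : b m m * ‖v‖ ^ 2 < 1 := (hle v).trans_lt hv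
    have h2 : ‖v‖ ^ 2 < 1 / b m m := by rwa [lt_div_iff₀' hc0]
    nlinarith [sq_nonneg (‖v‖ - 1), norm_nonneg v]

instance (p : Sph n) : FiniteDimensional ℝ (TangentSpace (𝓡 n) p) :=
  inferInstanceAs (FiniteDimensional ℝ (EuclideanSpace ℝ (Fin n)))

instance (p : Sph n) : T2Space (TangentSpace (𝓡 n) p) :=
  inferInstanceAs (T2Space (EuclideanSpace ℝ (Fin n)))

/-- The continuous bilinear form underlying a bilinear form on a tangent space. -/
def tangentForm {p : Sph n} (b : TangentSpace (𝓡 n) p →ₗ[ℝ] TangentSpace (𝓡 n) p →ₗ[ℝ] ℝ) :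
    TangentSpace (𝓡 n) p →L[ℝ] TangentSpace (𝓡 n) p →L[ℝ] ℝ :=
  b.toContinuousBilinearMap

theorem trivializationAt_form_apply
    (b : ∀ p : Sph n, TangentSpace (𝓡 n) p →L[ℝ] TangentSpace (𝓡 n) p →L[ℝ] ℝ) (p : Sph n)
    (x v w : EuclideanSpace ℝ (Fin n)) :
    (trivializationAt (EuclideanSpace ℝ (Fin n) →L[ℝ] EuclideanSpace ℝ (Fin n) →L[ℝ] ℝ)
        (fun b : Sph n => TangentSpace (𝓡 n) b →L[ℝ] TangentSpace (𝓡 n) b →L[ℝ] ℝ) p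
        ⟨chartPoint p x, b (chartPoint p x)⟩).2 v w =
      b (chartPoint p x) (chartVector p x v) (chartVector p x w) := by
  have hb := chartPoint_mem_source p x
  have hs : ∀ v, (trivializationAt (EuclideanSpace ℝ (Fin n))
      (TangentSpace (𝓡 n) : Sph n → Type _) p).symm (chartPoint p x) v = chartVector p x v :=
    fun v => symm_trivializationAt_eq_mfderiv p x v (by rw [extChartAt_target_eq]; trivial)
  rw [hom_trivializationAt_apply]
  dsimp only
  rw [inCoordinates_apply_eq₂ hb hb (Set.mem_univ _)]
  rw [hs, hs]
  exact linearMapAt_trivial p _ _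

theorem contMDiffAt_of_comp_chartPoint {V : Type*} [NormedAddCommGroup V] [NormedSpace ℝ V]
    {f : Sph n → V} {p : Sph n} (hf : ContDiffAt ℝ ∞ (fun x => f (chartPoint p x)) 0) :
    ContMDiffAt (𝓡 n) 𝓘(ℝ, V) ∞ f p := by
  have h1 : ContMDiffAt (𝓡 n) 𝓘(ℝ, V) ∞
      ((fun x => f (chartPoint p x)) ∘ extChartAt (𝓡 n) p) p :=
    ContMDiffAt.comp_of_eq (I' := 𝓘(ℝ, EuclideanSpace ℝ (Fin n))) hf.contMDiffAt
      contMDiffAt_extChartAt (extChartAt_self p)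
  refine h1.congr_of_eventuallyEq ?_
  filter_upwards [extChartAt_source_mem_nhds (I := 𝓡 n) p] with q hq
  exact congrArg f ((extChartAt (𝓡 n) p).left_inv hq).symm

theorem contDiffAt_clm_of_apply {V E F : Type*} [NormedAddCommGroup V] [NormedSpace ℝ V]
    [NormedAddCommGroup E] [NormedSpace ℝ E] [NormedAddCommGroup F] [NormedSpace ℝ F]
    [FiniteDimensional ℝ E] {L : V → E →L[ℝ] F} {x : V}
    (hL : ∀ v, ContDiffAt ℝ ∞ (fun y => L y v) x) : ContDiffAt ℝ ∞ L x := by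
  let d := Module.finrank ℝ E
  have hd : d = Module.finrank ℝ (Fin d → ℝ) := (Module.finrank_fin_fun ℝ).symm
  let e₁ := ContinuousLinearEquiv.ofFinrankEq hd
  let e₂ := (e₁.arrowCongr (1 : F ≃L[ℝ] F)).trans (ContinuousLinearEquiv.piRing (Fin d))
  rw [← Function.id_comp L, ← e₂.symm_comp_self]
  exact e₂.symm.contDiff.contDiffAt.comp x (contDiffAt_pi.mpr fun i => hL _)

/-- The Riemannian metric given by a smooth family of scalar products. -/
def IsMetricFamily.riemMetric
    {b : ∀ p : Sph n, TangentSpace (𝓡 n) p →ₗ[ℝ] TangentSpace (𝓡 n) p →ₗ[ℝ] ℝ}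
    (hb : IsMetricFamily b) : RiemMetric n (Sph n) where
  inner p := tangentForm (b p)
  symm := hb.symm
  pos := hb.pos
  isVonNBounded p := isVonNBounded_of_pos (V := EuclideanSpace ℝ (Fin n)) (b p) (hb.pos p)
  contMDiff p := by
    rw [Bundle.contMDiffAt_section]
    refine contMDiffAt_of_comp_chartPoint (contDiffAt_clm_of_apply fun v =>
      contDiffAt_clm_of_apply fun w => ?_)
    refine (hb.smooth p v w).congr_of_eventuallyEq (Filter.Eventually.of_forall fun x => ?_)
    exact trivializationAt_form_apply (fun p => tangentForm (b p)) p x v w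

theorem riemMetric_ext {g g' : RiemMetric n (Sph n)}
    (h : ∀ p v w, g.inner p v w = g'.inner p v w) : g = g' := by
  have h1 : g.inner = g'.inner := by
    funext p
    ext v w
    exact h p v w
  cases g
  cases g'
  cases h1
  rfl

/-- The family of scalar products underlying a Riemannian metric. -/
def metricFamily (g : RiemMetric n (Sph n)) (p : Sph n) :
    TangentSpace (𝓡 n) p →ₗ[ℝ] TangentSpace (𝓡 n) p →ₗ[ℝ] ℝ :=
  LinearMap.mk₂ ℝ (fun v w => g.inner p v w)
    (fun _ _ _ => by simp) (fun _ _ _ => by simp) (fun _ _ _ => by simp) (fun _ _ _ => by simp)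

theorem isMetricFamily_metricFamily (g : RiemMetric n (Sph n)) :
    IsMetricFamily (metricFamily g) where
  symm := g.symm
  pos := g.pos
  smooth := contDiffAt_chartForm g

end MetricFamilies

/-! ### Existence and uniqueness of volume normalisations -/

section VolumeNormalisations

variable {n : ℕ}

theorem det_gram_sum {V : Type*} [AddCommGroup V] [Module ℝ V] (β : V →ₗ[ℝ] V →ₗ[ℝ] ℝ)
    (h : Fin n → V) (C : Matrix (Fin n) (Fin n) ℝ) {e : Fin n → V} (he : ∀ i, e i = ∑ k, C i k • h k) :
    (Matrix.of fun i j => β (e i) (e j)).det =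
      C.det ^ 2 * (Matrix.of fun i j => β (h i) (h j)).det := by
  have h1 : (Matrix.of fun i j => β (e i) (e j)) =
      C * (Matrix.of fun i j => β (h i) (h j)) * C.transpose := by
    ext i j
    simp only [he, Matrix.of_apply, map_sum, map_smul, LinearMap.sum_apply, LinearMap.smul_apply,
      smul_eq_mul, Matrix.mul_apply, Matrix.transpose_apply]
    refine Finset.sum_congr rfl fun k _ => ?_
    rw [Finset.sum_mul, Finset.mul_sum]
    exact Finset.sum_congr rfl fun l _ => by ring
  rw [h1, Matrix.det_mul, Matrix.det_mul, Matrix.det_transpose]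
  ring

/-- The canonical metric as a family of bilinear forms. -/
def roundFamily (p : Sph n) : TangentSpace (𝓡 n) p →ₗ[ℝ] TangentSpace (𝓡 n) p →ₗ[ℝ] ℝ :=
  (innerₗ (EuclideanSpace ℝ (Fin (n + 1)))).compl₁₂ (tangentIncl p).toLinearMap
    (tangentIncl p).toLinearMap

theorem chartVector_eq_sum (p : Sph n) (x w : EuclideanSpace ℝ (Fin n)) :
    chartVector p x w = ∑ i, w i • coordVector p x i := by
  conv_lhs => rw [eq_sum_single w]
  rw [map_sum]
  exact Finset.sum_congr rfl fun i _ => map_smul _ _ _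

theorem chartVector_surjective (p : Sph n) (x : EuclideanSpace ℝ (Fin n)) :
    Function.Surjective (chartVector p x) := by
  have h : Module.finrank ℝ (EuclideanSpace ℝ (Fin n)) =
      Module.finrank ℝ (TangentSpace (𝓡 n) (chartPoint p x)) := rfl
  exact (LinearMap.injective_iff_surjective_of_finrank_eq_finrank
    (f := (chartVector p x).toLinearMap) h).1 (chartVector_injective p x)

theorem roundFamily_coordVector (p : Sph n) (x : EuclideanSpace ℝ (Fin n)) (i j : Fin n) :
    roundFamily (chartPoint p x) (coordVector p x i) (coordVector p x j) =
      if i = j then (4 / (‖x‖ ^ 2 + 4)) ^ 2 else 0 := by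
  change ⟪tangentIncl (chartPoint p x) (chartVector p x (EuclideanSpace.single i 1)),
        tangentIncl (chartPoint p x) (chartVector p x (EuclideanSpace.single j 1))⟫ = _
  rw [tangentIncl_chartVector, tangentIncl_chartVector, inner_fderiv_chartMap,
    EuclideanSpace.inner_single_left]
  simp

/-- The frame is chosen point by point, without any continuity in p; it serves only to evaluate Gram
determinants. -/
theorem exists_orthonormal_frame (p : Sph n) : ∃ h : Fin n → TangentSpace (𝓡 n) p,
    (∀ i j, roundFamily p (h i) (h j) = if i = j then 1 else 0) ∧
      ∀ v, ∃ c : Fin n → ℝ, v = ∑ k, c k • h k := by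
  have h : ∃ h : Fin n → TangentSpace (𝓡 n) (chartPoint p 0),
    (∀ i j, roundFamily (chartPoint p 0) (h i) (h j) = if i = j then 1 else 0) ∧
      ∀ v, ∃ c : Fin n → ℝ, v = ∑ k, c k • h k := by
    -- At the centre of the chart the conformal factor 4 / (0 + 4) is 1, so the coordinate vectors
    -- are orthonormal.
    refine ⟨fun i => coordVector p 0 i, fun i j => ?_, fun v => ?_⟩
    · rw [roundFamily_coordVector]
      simp
    · obtain ⟨y, rfl⟩ := chartVector_surjective p 0 v
      exact ⟨y, chartVector_eq_sum p 0 y⟩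
  rwa [chartPoint_zero] at h

/-- An orthonormal frame of the tangent space at `p`. -/
def frame (p : Sph n) : Fin n → TangentSpace (𝓡 n) p := (exists_orthonormal_frame p).choose

theorem roundFamily_frame (p : Sph n) (i j : Fin n) :
    roundFamily p (frame p i) (frame p j) = if i = j then 1 else 0 :=
  (exists_orthonormal_frame p).choose_spec.1 i j

theorem exists_eq_sum_frame (p : Sph n) (v : TangentSpace (𝓡 n) p) :
    ∃ c : Fin n → ℝ, v = ∑ k, c k • frame p k :=
  (exists_orthonormal_frame p).choose_spec.2 v

theorem det_gram_round_frame (p : Sph n) :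
    (Matrix.of fun i j => roundFamily p (frame p i) (frame p j)).det = 1 := by
  have : (Matrix.of fun i j => roundFamily p (frame p i) (frame p j)) = 1 := by
    ext i j
    rw [Matrix.of_apply, roundFamily_frame, Matrix.one_apply]
  rw [this, Matrix.det_one]

/-- Passing from the frame to arbitrary vectors multiplies both Gram determinants by the same det(C)
^ 2, so their ratio is a function of the point alone. -/
theorem det_gram_eq (p : Sph n) (β : TangentSpace (𝓡 n) p →ₗ[ℝ] TangentSpace (𝓡 n) p →ₗ[ℝ] ℝ)
    (e : Fin n → TangentSpace (𝓡 n) p) :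
    (Matrix.of fun i j => β (e i) (e j)).det =
      (Matrix.of fun i j => β (frame p i) (frame p j)).det *
        (Matrix.of fun i j => roundFamily p (e i) (e j)).det := by
  choose (C : Matrix (Fin n) (Fin n) ℝ) hC using fun i => exists_eq_sum_frame p (e i)
  rw [det_gram_sum β (frame p) C hC, det_gram_sum (roundFamily p) (frame p) C hC,
    det_gram_round_frame]
  ring

theorem det_gram_frame_pos {p : Sph n}
    {β : TangentSpace (𝓡 n) p →ₗ[ℝ] TangentSpace (𝓡 n) p →ₗ[ℝ] ℝ}
    (hs : ∀ v w, β v w = β w v) (hp : ∀ v, v ≠ 0 → 0 < β v v) :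
    0 < (Matrix.of fun i j => β (frame p i) (frame p j)).det := by
  refine (Matrix.PosDef.of_dotProduct_mulVec_pos ?_ fun v hv => ?_).det_pos
  · ext i j
    simp [hs]
  · have h1 : ∀ β : TangentSpace (𝓡 n) p →ₗ[ℝ] TangentSpace (𝓡 n) p →ₗ[ℝ] ℝ,
        star v ⬝ᵥ (Matrix.of fun i j => β (frame p i) (frame p j)).mulVec v =
        β (∑ i, v i • frame p i) (∑ i, v i • frame p i) := by
      intro β
      simp only [map_sum, map_smul, LinearMap.sum_apply, LinearMap.smul_apply, smul_eq_mul,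
        dotProduct, Matrix.mulVec, Finset.mul_sum, Pi.star_apply, star_trivial, Matrix.of_apply]
      rw [Finset.sum_comm]
      exact Finset.sum_congr rfl fun i _ => Finset.sum_congr rfl fun j _ => by ring
    rw [h1]
    refine hp _ fun h0 => hv ?_
    -- The same identity for the canonical metric, whose matrix in the frame is the identity, turns
    -- a vanishing combination into v ⬝ v = 0.
    have h2 := h1 (roundFamily p)
    rw [h0, map_zero] at h2
    have h3 : (Matrix.of fun i j => roundFamily p (frame p i) (frame p j)) = 1 := by
      ext i j
      rw [Matrix.of_apply, roundFamily_frame, Matrix.one_apply]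
    rw [h3, Matrix.one_mulVec] at h2
    simpa using h2

theorem volumeElement_round_frame (p : Sph n) : volumeElement (roundTensor n) p (frame p) = 1 := by
  have h : volumeElement (roundTensor n) p (frame p) =
    √(Matrix.of fun i j => roundFamily p (frame p i) (frame p j)).det := rfl
  rw [h, det_gram_round_frame, Real.sqrt_one]

/-- An orthonormal frame reads off D ^ α, and a non-zero power is injective on positive numbers. For
the exponent (n - 1) / 4 this is where n ≠ 1 matters. -/
theorem IsVolumeNormalisation.unique {b : TwoTensor n} {α : ℝ} (hα : α ≠ 0) {D D' : Sph n → ℝ}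
    (h : IsVolumeNormalisation b α D) (h' : IsVolumeNormalisation b α D') : D = D' := by
  funext p
  have h1 := h.2.2 p (frame p)
  rw [h'.2.2 p (frame p), volumeElement_round_frame, mul_one, mul_one] at h1
  exact ((Real.rpow_left_inj (h'.2.1 p).le (h.2.1 p).le hα).1 h1).symm

theorem IsMetricFamily.exists_isVolumeNormalisation
    {b : ∀ p : Sph n, TangentSpace (𝓡 n) p →ₗ[ℝ] TangentSpace (𝓡 n) p →ₗ[ℝ] ℝ}
    (hb : IsMetricFamily b) {α : ℝ} (hα : α ≠ 0) :
    ∃ D, IsVolumeNormalisation (fun p v w => b p v w) α D := by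
  have hpos := fun p => det_gram_frame_pos (hb.symm p) (hb.pos p)
  -- The volume element is the square root of the Gram determinant, hence the exponent 1 / (2 α).
  refine ⟨fun p => (Matrix.of fun i j => b p (frame p i) (frame p j)).det ^ (1 / (2 * α)),
    fun p => contMDiffAt_of_comp_chartPoint ?_, fun p => Real.rpow_pos_of_pos (hpos p) _,
    fun p e => ?_⟩
  -- The frame need not vary smoothly, so its Gram determinant is rewritten as the one of the
  -- coordinate fields divided by the power of the conformal factor.
  · have h1 : ∀ x, (Matrix.of fun i j => b (chartPoint p x) (frame (chartPoint p x) i)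
        (frame (chartPoint p x) j)).det = (Matrix.of fun i j => b (chartPoint p x)
          (coordVector p x i) (coordVector p x j)).det * (((4 / (‖x‖ ^ 2 + 4)) ^ 2) ^ n)⁻¹ := by
      intro x
      have h2 : (Matrix.of fun i j => roundFamily (chartPoint p x) (coordVector p x i)
          (coordVector p x j)).det = ((4 / (‖x‖ ^ 2 + 4)) ^ 2) ^ n := by
        have : (Matrix.of fun i j => roundFamily (chartPoint p x) (coordVector p x i)
          (coordVector p x j)) = Matrix.diagonal fun _ => (4 / (‖x‖ ^ 2 + 4)) ^ 2 := by
          ext i j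
          rw [Matrix.of_apply, roundFamily_coordVector, Matrix.diagonal_apply]
        rw [this, Matrix.det_diagonal]
        simp
      have h3 := det_gram_eq (chartPoint p x) (b (chartPoint p x)) (coordVector p x)
      rw [h2] at h3
      have h4 : ((4 / (‖x‖ ^ 2 + 4)) ^ 2) ^ n ≠ 0 := by positivity
      exact (eq_mul_inv_iff_mul_eq₀ h4).2 h3.symm
    have hs : ContDiffAt ℝ ∞ (fun x : EuclideanSpace ℝ (Fin n) =>
        (((4 / (‖x‖ ^ 2 + 4)) ^ 2) ^ n)⁻¹) 0 := by
      have h0 : ContDiff ℝ ∞ (fun x : EuclideanSpace ℝ (Fin n) => ‖x‖ ^ 2 + 4) :=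
        (contDiff_norm_sq ℝ).add contDiff_const
      refine ContDiffAt.inv (((contDiffAt_const.div h0.contDiffAt ?_).pow 2).pow n) ?_
      · positivity
      · positivity
    have hd : ContDiffAt ℝ ∞ (fun x : EuclideanSpace ℝ (Fin n) =>
        (Matrix.of fun i j => b (chartPoint p x)
          (coordVector p x i) (coordVector p x j)).det) 0 := by
      simp only [Matrix.det_apply, Matrix.of_apply]
      refine ContDiffAt.sum fun σ _ => ContDiffAt.const_smul _ (contDiffAt_prod fun i _ => ?_)
      exact hb.smooth p _ _
    refine ContDiffAt.rpow_const_of_ne ?_ (hpos _).ne'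
    simp only [h1]
    exact hd.mul hs
  · have h1 : volumeElement (roundTensor n) p e =
      √(Matrix.of fun i j => roundFamily p (e i) (e j)).det := rfl
    have h2 : volumeElement (fun p v w => b p v w) p e =
      √(Matrix.of fun i j => b p (e i) (e j)).det := rfl
    rw [h1, h2, det_gram_eq, Real.sqrt_mul (hpos p).le, ← Real.rpow_mul (hpos p).le,
      show 1 / (2 * α) * α = 1 / 2 by field_simp, Real.sqrt_eq_rpow]

end VolumeNormalisations

/-! ### The metric of a curvature tensor -/

section CurvatureMetrics

variable {n : ℕ}

/-- The two-tensor `k_R` as a family of bilinear forms. -/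
def curvFamily (R : FourTensor n) (p : Sph n) :
    TangentSpace (𝓡 n) p →ₗ[ℝ] TangentSpace (𝓡 n) p →ₗ[ℝ] ℝ :=
  LinearMap.mk₂ ℝ (fun v w => curvTwoTensor R p v w)
    (fun _ _ _ => by simp [curvTwoTensor]) (fun _ _ _ => by simp [curvTwoTensor])
    (fun _ _ _ => by simp [curvTwoTensor]) (fun _ _ _ => by simp [curvTwoTensor])

theorem curvFamily_apply (R : FourTensor n) (p : Sph n) (v w : TangentSpace (𝓡 n) p) :
    curvFamily R p v w = curvTwoTensor R p v w := rfl

theorem curvFamily_chartVector (R : FourTensor n) (p : Sph n) (x v w : EuclideanSpace ℝ (Fin n)) :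
    curvFamily R (chartPoint p x) (chartVector p x v) (chartVector p x w) =
      R (chartMap p x) (fderiv ℝ (chartMap p) x v) (chartMap p x)
        (fderiv ℝ (chartMap p) x w) := by
  rw [← tangentIncl_chartVector, ← tangentIncl_chartVector]
  rfl

theorem map_eq_sum_single {m : ℕ} {V : Type*} [AddCommMonoid V] [Module ℝ V]
    (L : EuclideanSpace ℝ (Fin m) →ₗ[ℝ] V) (x : EuclideanSpace ℝ (Fin m)) :
    L x = ∑ i, x i • L (EuclideanSpace.single i 1) := by
  conv_lhs => rw [eq_sum_single x]
  rw [map_sum]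
  exact Finset.sum_congr rfl fun i _ => map_smul _ _ _

theorem contDiffAt_fourTensor (R : FourTensor n) {V : Type*} [NormedAddCommGroup V]
    [NormedSpace ℝ V] {f₁ f₂ f₃ f₄ : V → EuclideanSpace ℝ (Fin (n + 1))} {a : V}
    (h₁ : ContDiffAt ℝ ∞ f₁ a) (h₂ : ContDiffAt ℝ ∞ f₂ a) (h₃ : ContDiffAt ℝ ∞ f₃ a)
    (h₄ : ContDiffAt ℝ ∞ f₄ a) :
    ContDiffAt ℝ ∞ (fun x => R (f₁ x) (f₂ x) (f₃ x) (f₄ x)) a := by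
  have hc : ∀ {f : V → EuclideanSpace ℝ (Fin (n + 1))}, ContDiffAt ℝ ∞ f a → ∀ i,
      ContDiffAt ℝ ∞ (fun x => f x i) a :=
    fun h i => (EuclideanSpace.proj (𝕜 := ℝ) i).contDiff.contDiffAt.comp a h
  have he : ∀ x, R (f₁ x) (f₂ x) (f₃ x) (f₄ x) = ∑ i, f₁ x i * ∑ j, f₂ x j * ∑ k, f₃ x k *
      R (EuclideanSpace.single i 1) (EuclideanSpace.single j 1) (EuclideanSpace.single k 1)
        (f₄ x) := by
    intro x
    rw [map_eq_sum_single R]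
    simp only [LinearMap.sum_apply, LinearMap.smul_apply, smul_eq_mul]
    refine Finset.sum_congr rfl fun i _ => congrArg _ ?_
    rw [map_eq_sum_single (R _)]
    simp only [LinearMap.sum_apply, LinearMap.smul_apply, smul_eq_mul]
    refine Finset.sum_congr rfl fun j _ => congrArg _ ?_
    rw [map_eq_sum_single (R _ _)]
    simp only [LinearMap.sum_apply, LinearMap.smul_apply, smul_eq_mul]
  simp only [he]
  refine ContDiffAt.sum fun i _ => (hc h₁ i).mul <| ContDiffAt.sum fun j _ => (hc h₂ j).mul <|
    ContDiffAt.sum fun k _ => (hc h₃ k).mul ?_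
  exact (LinearMap.toContinuousLinearMap (R _ _ _)).contDiff.contDiffAt.comp a h₄

theorem contDiff_fderiv_chartMap (p : Sph n) (v : EuclideanSpace ℝ (Fin n)) :
    ContDiff ℝ ∞ (fun x => fderiv ℝ (chartMap p) x v) :=
  ((contDiff_chartMap p).fderiv_right (by simp)).clm_apply contDiff_const

theorem HasPositiveSec.pos {R : FourTensor n} (hR : HasPositiveSec R)
    {x y : EuclideanSpace ℝ (Fin (n + 1))} (hx : ‖x‖ = 1) (hy : y ≠ 0) (h : ⟪x, y⟫ = 0) :
    0 < R x y x y := by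
  have hy' : ‖y‖ ≠ 0 := norm_ne_zero_iff.2 hy
  have h1 := hR x (‖y‖⁻¹ • y) hx
    (by rw [norm_smul, norm_inv, norm_norm, inv_mul_cancel₀ hy']) (by rw [inner_smul_right, h, mul_zero])
  simp only [map_smul, LinearMap.smul_apply, smul_eq_mul] at h1
  have h2 : R x y x y = ‖y‖ ^ 2 * (‖y‖⁻¹ * (‖y‖⁻¹ * R x y x y)) := by field_simp
  rw [h2]
  positivity

theorem isMetricFamily_curvFamily (R : PositiveCurvatureTensor n) :
    IsMetricFamily (curvFamily R.1) where
  symm p v w := R.2.1.pair_symm _ _ _ _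
  pos p v hv := R.2.2.pos (norm_eq_of_mem_sphere p)
    (fun h => hv (tangentIncl_eq_zero_iff.1 h)) (inner_tangentIncl p v)
  smooth p v w := by
    simp only [curvFamily_chartVector]
    exact contDiffAt_fourTensor R.1 (contDiff_chartMap p).contDiffAt
      (contDiff_fderiv_chartMap p v).contDiffAt (contDiff_chartMap p).contDiffAt
      (contDiff_fderiv_chartMap p w).contDiffAt

theorem IsAlgCurvatureTensor.apply_self_left {R : FourTensor n} (hR : IsAlgCurvatureTensor R)
    (x z w : EuclideanSpace ℝ (Fin (n + 1))) : R x x z w = 0 := by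
  linarith [hR.skew_left x x z w]

theorem IsAlgCurvatureTensor.apply_self_right {R : FourTensor n} (hR : IsAlgCurvatureTensor R)
    (x y z : EuclideanSpace ℝ (Fin (n + 1))) : R x y z z = 0 := by
  linarith [hR.skew_right x y z z]

/-- Skew-symmetry in each pair makes this a quadratic function of the bivector, and the bivector is
multiplied by the determinant of the change of vectors. -/
theorem IsAlgCurvatureTensor.apply_plane {R : FourTensor n} (hR : IsAlgCurvatureTensor R)
    (x y : EuclideanSpace ℝ (Fin (n + 1))) (a b c d : ℝ) :
    R (a • x + b • y) (c • x + d • y) (a • x + b • y) (c • x + d • y) =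
      (a * d - b * c) ^ 2 * R x y x y := by
  simp only [map_add, map_smul, LinearMap.add_apply, LinearMap.smul_apply, smul_eq_mul,
    hR.apply_self_left, hR.apply_self_right, hR.skew_left y x, hR.skew_right x y y x]
  ring

/-- The line s ↦ s u in the chart runs along the great circle in the plane of p and J u. In terms of
p and J u, position and velocity have determinant 4 / (|u|² s² + 4), and `apply_plane` does the
rest. -/
theorem curvFamily_chartVector_line {R : FourTensor n} (hR : IsAlgCurvatureTensor R) (p : Sph n)
    (u : EuclideanSpace ℝ (Fin n)) : ∃ c : ℝ, ∀ s : ℝ,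
      curvFamily R (chartPoint p (s • u)) (chartVector p (s • u) u) (chartVector p (s • u) u) =
        c * (4 / (‖u‖ ^ 2 * s ^ 2 + 4)) ^ 2 := by
  obtain ⟨J, hJ1, hJ2, hJ⟩ := exists_chartMap_eq p
  refine ⟨R p (J u) p (J u), fun s => ?_⟩
  rw [curvFamily_chartVector, fderiv_chartMap_apply_eq hJ, hJ]
  have hr : ‖s • u‖ ^ 2 = ‖u‖ ^ 2 * s ^ 2 := by rw [norm_smul, mul_pow, Real.norm_eq_abs, sq_abs, mul_comm]
  have hi : ⟪s • u, u⟫ = s * ‖u‖ ^ 2 := by rw [real_inner_smul_left, real_inner_self_eq_norm_sq]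
  rw [hr, hi, J.map_smul]
  set r := ‖u‖ ^ 2
  have hN : r * s ^ 2 + 4 ≠ 0 := by positivity
  have h1 : (r * s ^ 2 + 4)⁻¹ • ((4 : ℝ) • s • J u - (r * s ^ 2 - 4) •
      (p : EuclideanSpace ℝ (Fin (n + 1)))) =
      (-(r * s ^ 2 - 4) / (r * s ^ 2 + 4)) • (p : EuclideanSpace ℝ (Fin (n + 1))) +
        (4 * s / (r * s ^ 2 + 4)) • J u := by
    module
  have h2 : (4 / (r * s ^ 2 + 4)) • J u - (8 * (s * r) / (r * s ^ 2 + 4) ^ 2) • s • J u -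
      (16 * (s * r) / (r * s ^ 2 + 4) ^ 2) • (p : EuclideanSpace ℝ (Fin (n + 1))) =
      (-(16 * (s * r) / (r * s ^ 2 + 4) ^ 2)) • (p : EuclideanSpace ℝ (Fin (n + 1))) +
        (4 / (r * s ^ 2 + 4) - 8 * (s * r) / (r * s ^ 2 + 4) ^ 2 * s) • J u := by
    module
  rw [h1, h2, hR.apply_plane]
  field_simp
  ring

/-- Along the line s ↦ s u the function is even in s, hence stationary at the centre: k_R is a first
integral of the great circles. -/
theorem fderiv_curvFamily {R : FourTensor n} (hR : IsAlgCurvatureTensor R) (p : Sph n)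
    (u : EuclideanSpace ℝ (Fin n)) :
    fderiv ℝ (fun x => curvFamily R (chartPoint p x) (chartVector p x u) (chartVector p x u)) 0 u
      = 0 := by
  have hd : DifferentiableAt ℝ (fun x => curvFamily R (chartPoint p x) (chartVector p x u)
      (chartVector p x u)) ((0 : ℝ) • u) := by
    simp only [curvFamily_chartVector]
    exact (contDiffAt_fourTensor R (contDiff_chartMap p).contDiffAt
      (contDiff_fderiv_chartMap p u).contDiffAt (contDiff_chartMap p).contDiffAt
      (contDiff_fderiv_chartMap p u).contDiffAt).differentiableAt (by simp)
  obtain ⟨c, hc⟩ := curvFamily_chartVector_line hR p u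
  have h1 : HasDerivAt (fun s : ℝ => s • u) u 0 := by
    simpa using (hasDerivAt_id (0 : ℝ)).smul_const u
  have h2 := hd.hasFDerivAt.comp_hasDerivAt (0 : ℝ) h1
  rw [zero_smul] at h2
  have h3 : HasDerivAt (fun s : ℝ => c * (4 / (‖u‖ ^ 2 * s ^ 2 + 4)) ^ 2) 0 0 := by
    have h4 : HasDerivAt (fun s : ℝ => ‖u‖ ^ 2 * s ^ 2 + 4) 0 0 := by
      simpa using (((hasDerivAt_id (0 : ℝ)).pow 2).const_mul (‖u‖ ^ 2)).add_const 4
    have h5 := (((h4.fun_inv (by simp)).const_mul 4).fun_pow 2).const_mul c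
    simpa [div_eq_mul_inv] using h5
  refine h2.unique (h3.congr_of_eventuallyEq (Filter.Eventually.of_forall fun s => hc s))

theorem volumeElement_smul {b : TwoTensor n} {c : ℝ} (p : Sph n) (hc : 0 < c)
    (e : Fin n → TangentSpace (𝓡 n) p) :
    √(Matrix.of fun i j => c * b p (e i) (e j)).det = c ^ ((n : ℝ) / 2) * volumeElement b p e := by
  have h1 : (Matrix.of fun i j => c * b p (e i) (e j)) =
      c • (Matrix.of fun i j => b p (e i) (e j)) := rfl
  rw [h1, Matrix.det_smul, Fintype.card_fin, Real.sqrt_mul (by positivity), Real.sqrt_eq_rpow,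
    ← Real.rpow_natCast_mul hc.le, mul_one_div]
  rfl

theorem IsMetricFamily.smul
    {b : ∀ p : Sph n, TangentSpace (𝓡 n) p →ₗ[ℝ] TangentSpace (𝓡 n) p →ₗ[ℝ] ℝ}
    (hb : IsMetricFamily b) {c : Sph n → ℝ} (hc : ContMDiff (𝓡 n) 𝓘(ℝ) ∞ c)
    (hc0 : ∀ p, 0 < c p) : IsMetricFamily (fun p => c p • b p) where
  symm p v w := congrArg (c p * ·) (hb.symm p v w)
  pos p v hv := mul_pos (hc0 p) (hb.pos p v hv)
  smooth p v w := ((hc.comp (contMDiff_chartPoint p)).contDiff.contDiffAt).mul (hb.smooth p v w)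

theorem IsVolumeNormalisation.contMDiff_one_div {b : TwoTensor n} {α : ℝ} {D : Sph n → ℝ}
    (h : IsVolumeNormalisation b α D) : ContMDiff (𝓡 n) 𝓘(ℝ) ∞ (fun p => 1 / D p) := fun p =>
  ((contDiffAt_const (c := (1 : ℝ))).div contDiffAt_id (h.2.1 p).ne').contMDiffAt.comp p (h.1 p)

/-- Dividing b by D divides its volume element by D ^ (n / 2), and α - n / 2 = -β. This exchanges
D_R, with exponent (n - 1) / 4, and F_g = 1 / D_R, with exponent (n + 1) / 4. -/
theorem IsVolumeNormalisation.one_div_smul {b b' : TwoTensor n} {α β : ℝ} {D : Sph n → ℝ}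
    (h : IsVolumeNormalisation b α D) (hb : ∀ p v w, b' p v w = 1 / D p * b p v w)
    (hαβ : α + β = n / 2) : IsVolumeNormalisation b' β (fun p => 1 / D p) := by
  refine ⟨h.contMDiff_one_div, fun p => one_div_pos.2 (h.2.1 p), fun p e => ?_⟩
  have hb' : volumeElement b' p e =
      √(Matrix.of fun i j => 1 / D p * b p (e i) (e j)).det := by
    rw [volumeElement]
    simp only [hb]
  rw [hb', volumeElement_smul p (one_div_pos.2 (h.2.1 p)), h.2.2, ← mul_assoc]
  congr 1
  dsimp only
  rw [one_div, Real.inv_rpow (h.2.1 p).le, Real.inv_rpow (h.2.1 p).le,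
    ← Real.rpow_neg (h.2.1 p).le, ← Real.rpow_neg (h.2.1 p).le, ← Real.rpow_add (h.2.1 p)]
  congr 1
  linear_combination hαβ

theorem sub_one_div_four_ne_zero (hn : 2 ≤ n) : ((n : ℝ) - 1) / 4 ≠ 0 := by
  have : (2 : ℝ) ≤ n := by exact_mod_cast hn
  have : (0 : ℝ) < ((n : ℝ) - 1) / 4 := by linarith
  exact this.ne'

variable (hn : 2 ≤ n)

/-- The function `D_R`. -/
def curvDensity (R : PositiveCurvatureTensor n) : Sph n → ℝ :=
  ((isMetricFamily_curvFamily R).exists_isVolumeNormalisation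
    (sub_one_div_four_ne_zero hn)).choose

theorem isVolumeNormalisation_curvDensity (R : PositiveCurvatureTensor n) :
    IsVolumeNormalisation (curvTwoTensor R.1) (((n : ℝ) - 1) / 4) (curvDensity hn R) :=
  ((isMetricFamily_curvFamily R).exists_isVolumeNormalisation
    (sub_one_div_four_ne_zero hn)).choose_spec

/-- The metric `g_R = k_R / D_R`. -/
def curvMetric (R : PositiveCurvatureTensor n) : RiemMetric n (Sph n) :=
  ((isMetricFamily_curvFamily R).smul (isVolumeNormalisation_curvDensity hn R).contMDiff_one_div
    fun p => one_div_pos.2 ((isVolumeNormalisation_curvDensity hn R).2.1 p)).riemMetric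

theorem curvMetric_inner (R : PositiveCurvatureTensor n) (p : Sph n)
    (v w : TangentSpace (𝓡 n) p) :
    (curvMetric hn R).inner p v w = 1 / curvDensity hn R p * curvTwoTensor R.1 p v w := rfl

theorem isVolumeNormalisation_curvMetric (R : PositiveCurvatureTensor n) :
    IsVolumeNormalisation (metricTensor (curvMetric hn R)) (((n : ℝ) + 1) / 4)
      (fun p => 1 / curvDensity hn R p) :=
  (isVolumeNormalisation_curvDensity hn R).one_div_smul (fun _ _ _ => rfl) (by ring)

/-- For g_R the density F is 1 / D_R, so g_R / F is k_R again. -/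
theorem hasMinimalEquators_curvMetric (R : PositiveCurvatureTensor n) :
    HasMinimalEquators (curvMetric hn R) := by
  rw [hasMinimalEquators_iff (isVolumeNormalisation_curvMetric hn R)]
  intro p u
  have hD := isVolumeNormalisation_curvDensity hn R
  have h : (fun x => chartForm (curvMetric hn R) p x u u / (1 / curvDensity hn R (chartPoint p x)))
      = fun x => curvFamily R.1 (chartPoint p x) (chartVector p x u) (chartVector p x u) := by
    funext x
    have h0 := (hD.2.1 (chartPoint p x)).ne'
    rw [chartForm_apply, curvMetric_inner, curvFamily_apply]
    field_simp
  rw [h]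
  exact fderiv_curvFamily R.2.1 p u

end CurvatureMetrics

/-! ### Biquadratic forms and algebraic curvature tensors -/

section CurvatureTensors

variable {n : ℕ}

section Biquadratic

variable {E : Type*} [AddCommGroup E] [Module ℝ E]

/-- The polarisation in `x` of a family `Q x` of bilinear forms. -/
def polarForm (Q : E → E →ₗ[ℝ] E →ₗ[ℝ] ℝ) (x z : E) : E →ₗ[ℝ] E →ₗ[ℝ] ℝ :=
  (1 / 2 : ℝ) • (Q (x + z) - Q x - Q z)

theorem polarForm_apply (Q : E → E →ₗ[ℝ] E →ₗ[ℝ] ℝ) (x z y w : E) :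
    polarForm Q x z y w = 1 / 2 * (Q (x + z) y w - Q x y w - Q z y w) := rfl

variable {Q : E → E →ₗ[ℝ] E →ₗ[ℝ] ℝ} (hs : ∀ x y z, Q x y z = Q x z y)
  (hQ : ∀ x y, Q x y y = Q y x x)

theorem polarForm_comm (x z y w : E) : polarForm Q x z y w = polarForm Q z x y w := by
  rw [polarForm_apply, polarForm_apply, add_comm x z]
  ring

include hs in
theorem polarForm_symm (x z y w : E) : polarForm Q x z y w = polarForm Q x z w y := by
  simp only [polarForm_apply, hs _ y w]

include hs hQ in
-- Polarised in both pairs, the form involves only the values Q_x(y, y), which are symmetric in x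
-- and y. In particular it is bilinear in x and z, although Q was not assumed to be quadratic in x.
theorem polarForm_swap (x z y w : E) : polarForm Q x z y w = polarForm Q y w x z := by
  have h1 : ∀ x y w, Q x y w = 1 / 2 * (Q x (y + w) (y + w) - Q x y y - Q x w w) := by
    intro x y w
    simp only [map_add, LinearMap.add_apply, hs x w y]
    ring
  rw [polarForm_apply, polarForm_apply, h1 (x + z), h1 x, h1 z, h1 (y + w), h1 y, h1 w]
  simp only [hQ _ x, hQ _ z, hQ _ (x + z)]
  ring

include hs hQ in
theorem polarForm_self (x y w : E) : polarForm Q x x y w = Q x y w := by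
  have h1 : ∀ x y w, Q x y w = 1 / 2 * (Q x (y + w) (y + w) - Q x y y - Q x w w) := by
    intro x y w
    simp only [map_add, LinearMap.add_apply, hs x w y]
    ring
  have h2 : ∀ y, Q (x + x) y y = 4 * Q x y y := by
    intro y
    rw [hQ, hQ x y]
    simp only [map_add, LinearMap.add_apply]
    ring
  rw [polarForm_apply, h1 (x + x), h2, h2, h2, h1 x y w]
  ring

end Biquadratic

/-- Let P be the polarisation of Q. Skew-symmetrising P gives the symmetries and the Bianchi
identity, and polarising Q_x(x, y) = 0 gives P(x, x; y, y) + 2 P(x, y; x, y) = 0, which recovers Q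
on the diagonal. -/
theorem exists_isAlgCurvatureTensor
    {Q : EuclideanSpace ℝ (Fin (n + 1)) → EuclideanSpace ℝ (Fin (n + 1)) →ₗ[ℝ]
      EuclideanSpace ℝ (Fin (n + 1)) →ₗ[ℝ] ℝ} (hs : ∀ x y z, Q x y z = Q x z y)
    (hQ : ∀ x y, Q x y y = Q y x x) (h0 : ∀ x y, Q x x y = 0) :
    ∃ R : FourTensor n, IsAlgCurvatureTensor R ∧ ∀ x y, R x y x y = Q x y y := by
  have hc := polarForm_comm (Q := Q)
  have hsy := polarForm_symm hs
  have hsw := polarForm_swap hs hQ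
  have ha : ∀ x x' z y w, polarForm Q (x + x') z y w =
      polarForm Q x z y w + polarForm Q x' z y w := by
    intro x x' z y w
    rw [hsw, hsw x, hsw x', map_add]
    rfl
  have hm : ∀ (r : ℝ) x z y w, polarForm Q (r • x) z y w = r * polarForm Q x z y w := by
    intro r x z y w
    rw [hsw, hsw x, map_smul]
    rfl
  have ha' : ∀ x z z' y w, polarForm Q x (z + z') y w =
      polarForm Q x z y w + polarForm Q x z' y w := by
    intro x z z' y w
    rw [hc, ha, hc x, hc x]
  have hm' : ∀ (r : ℝ) x z y w, polarForm Q x (r • z) y w = r * polarForm Q x z y w := by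
    intro r x z y w
    rw [hc, hm, hc x]
  -- On the diagonal P(x, x; y, y) - P(x, y; x, y) = (3 / 2) Q_x(y, y), hence the factor 2 / 3.
  let R : FourTensor n := LinearMap.mk₂ ℝ
    (fun x y => LinearMap.mk₂ ℝ
      (fun z w => (2 / 3) * (polarForm Q x z y w - polarForm Q x w y z))
      (fun z z' w => by rw [ha', map_add]; ring)
      (fun r z w => by rw [hm', map_smul, smul_eq_mul, smul_eq_mul]; ring)
      (fun z w w' => by rw [ha', map_add]; ring)
      (fun r z w => by rw [hm', map_smul, smul_eq_mul, smul_eq_mul]; ring))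
    (fun x x' y => by
      ext z w
      simp only [LinearMap.mk₂_apply, LinearMap.add_apply, ha]
      ring)
    (fun r x y => by
      ext z w
      simp only [LinearMap.mk₂_apply, LinearMap.smul_apply, smul_eq_mul, hm]
      ring)
    (fun x y y' => by
      ext z w
      simp only [LinearMap.mk₂_apply, LinearMap.add_apply, map_add]
      ring)
    (fun r x y => by
      ext z w
      simp only [LinearMap.mk₂_apply, LinearMap.smul_apply, smul_eq_mul, map_smul]
      ring)
  have hR : ∀ x y z w, R x y z w = (2 / 3) * (polarForm Q x z y w - polarForm Q x w y z) :=
    fun x y z w => rfl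
  have h3 : ∀ x y, polarForm Q x x x y = 0 := fun x y => by rw [polarForm_self hs hQ, h0]
  -- Comparing the vanishing at x + y and at x - y separates the terms of even degree in y from the
  -- odd ones.
  have h4 : ∀ x y, polarForm Q x x y y + 2 * polarForm Q x y x y = 0 := by
    intro x y
    have e1 := h3 (x + y) y
    have e2 := h3 (x + (-1 : ℝ) • y) y
    have e3 := h3 x y
    have e4 := h3 y y
    simp only [ha, ha', hm, hm', map_add, map_smul, LinearMap.add_apply, LinearMap.smul_apply,
      smul_eq_mul, hc y x] at e1 e2
    linarith
  refine ⟨R, ⟨fun x y z w => ?_, fun x y z w => ?_, fun x y z w => ?_, fun x y z w => ?_⟩,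
    fun x y => ?_⟩
  · rw [hR, hR, hsw y z x w, hsw y w x z]
    ring
  · rw [hR, hR]
    ring
  · rw [hR, hR, hc z x, hsy x z w y, hsw z y w x, hc w x, hsy x w z y]
  · rw [hR, hR, hR, hsy x w y z, hsy x y z w, hsy x z y w]
    ring
  · rw [hR, hsy x y y x, ← polarForm_self hs hQ]
    linarith [h4 x y]

/-- The difference S of the tensors satisfies S(x, y, x, w) = 0 after one polarisation, so it is
also skew in its first and third arguments and therefore totally skew. The Bianchi identity then
reads 3 S = 0. -/
theorem IsAlgCurvatureTensor.ext_of_diagonal {R R' : FourTensor n} (hR : IsAlgCurvatureTensor R)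
    (hR' : IsAlgCurvatureTensor R') (h : ∀ x y, R x y x y = R' x y x y) : R = R' := by
  have h1 : ∀ x y w, R x y x w = R' x y x w := by
    intro x y w
    have e := h x (y + w)
    simp only [map_add, LinearMap.add_apply] at e
    linarith [h x y, h x w, hR.pair_symm x y x w, hR'.pair_symm x y x w]
  have h2 : ∀ x y z w, R x y z w - R' x y z w = -(R z y x w - R' z y x w) := by
    intro x y z w
    have e := h1 (x + z) y w
    simp only [map_add, LinearMap.add_apply] at e
    linarith [h1 x y w, h1 z y w]
  ext x y z w
  have b := hR.bianchi x y z w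
  have b' := hR'.bianchi x y z w
  have c1 := h2 x z y w
  have c2 := h2 z y x w
  have c3 := h2 y x z w
  linarith [hR.skew_right x z w y, hR'.skew_right x z w y, hR.pair_symm x w y z,
    hR'.pair_symm x w y z, hR.skew_left y z x w, hR'.skew_left y z x w, hR.skew_left x y z w,
    hR'.skew_left x y z w, hR.skew_left z y x w, hR'.skew_left z y x w, hR.skew_left x z y w,
    hR'.skew_left x z y w]

theorem IsAlgCurvatureTensor.ext_of_sphere {R R' : FourTensor n} (hR : IsAlgCurvatureTensor R)
    (hR' : IsAlgCurvatureTensor R')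
    (h : ∀ (p : Sph n) v, curvTwoTensor R p v v = curvTwoTensor R' p v v) : R = R' := by
  refine hR.ext_of_diagonal hR' fun x y => ?_
  by_cases hx : x = 0
  · simp [hx]
  have hx' : ‖x‖ ≠ 0 := norm_ne_zero_iff.2 hx
  let p : Sph n := ⟨‖x‖⁻¹ • x, by
    rw [mem_sphere_zero_iff_norm, norm_smul, norm_inv, norm_norm, inv_mul_cancel₀ hx']⟩
  let a := ⟪(p : EuclideanSpace ℝ (Fin (n + 1))), y⟫
  obtain ⟨v, hv⟩ := exists_tangentIncl_eq p (w := y - a • (p : EuclideanSpace ℝ (Fin (n + 1)))) (by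
    rw [inner_sub_right, inner_smul_right, real_inner_self_eq_norm_sq, norm_eq_of_mem_sphere p]
    simp [a])
  have hxp : x = ‖x‖ • (p : EuclideanSpace ℝ (Fin (n + 1))) + (0 : ℝ) • tangentIncl p v := by
    simp [p, smul_smul, hx']
  have hy : y = a • (p : EuclideanSpace ℝ (Fin (n + 1))) + (1 : ℝ) • tangentIncl p v := by
    rw [hv]
    module
  have h1 := h p v
  rw [curvTwoTensor, curvTwoTensor] at h1
  rw [hxp, hy, hR.apply_plane, hR'.apply_plane, h1]

end CurvatureTensors

/-! ### The curvature tensor of a family constant along great circles -/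

section GreatCircles

variable {n : ℕ}

open Classical in
/-- The point of `𝕊ⁿ` in the direction of a non-zero vector. -/
def direction (x : EuclideanSpace ℝ (Fin (n + 1))) : Sph n :=
  -- The value at 0 is arbitrary: `homogForm` multiplies it by ‖x‖ ^ 2.
  if hx : x = 0 then ⟨EuclideanSpace.single 0 1, by simp⟩ else ⟨‖x‖⁻¹ • x, by
    rw [mem_sphere_zero_iff_norm, norm_smul, norm_inv, norm_norm,
      inv_mul_cancel₀ (norm_ne_zero_iff.2 hx)]⟩

theorem coe_direction {x : EuclideanSpace ℝ (Fin (n + 1))} (hx : x ≠ 0) :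
    (direction x : EuclideanSpace ℝ (Fin (n + 1))) = ‖x‖⁻¹ • x := by
  rw [direction, dif_neg hx]

theorem coe_direction_of_norm {x : EuclideanSpace ℝ (Fin (n + 1))} (hx : ‖x‖ = 1) :
    (direction x : EuclideanSpace ℝ (Fin (n + 1))) = x := by
  rw [coe_direction (by rintro rfl; simp at hx), hx, inv_one, one_smul]

theorem direction_coe (p : Sph n) : direction (p : EuclideanSpace ℝ (Fin (n + 1))) = p :=
  Subtype.ext (coe_direction_of_norm (norm_eq_of_mem_sphere p))

theorem direction_smul {x : EuclideanSpace ℝ (Fin (n + 1))} {r : ℝ} (hr : 0 < r) :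
    direction (r • x) = direction x := by
  by_cases hx : x = 0
  · rw [hx, smul_zero]
  refine Subtype.ext ?_
  rw [coe_direction (smul_ne_zero hr.ne' hx), coe_direction hx, norm_smul, Real.norm_eq_abs,
    abs_of_pos hr, smul_smul]
  congr 1
  field_simp

theorem exists_tangentProj (p : Sph n) :
    ∃ τ : EuclideanSpace ℝ (Fin (n + 1)) →ₗ[ℝ] TangentSpace (𝓡 n) p,
      ∀ w, tangentIncl p (τ w) = w - ⟪(p : EuclideanSpace ℝ (Fin (n + 1))), w⟫ •
        (p : EuclideanSpace ℝ (Fin (n + 1))) := by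
  obtain ⟨s, hs⟩ := (tangentIncl p).toLinearMap.exists_leftInverse_of_injective
    (LinearMap.ker_eq_bot.2 (tangentIncl_injective p))
  refine ⟨s ∘ₗ (LinearMap.id - (innerₗ _ (p : EuclideanSpace ℝ (Fin (n + 1)))).smulRight
    (p : EuclideanSpace ℝ (Fin (n + 1)))), fun w => ?_⟩
  have h0 : ⟪(p : EuclideanSpace ℝ (Fin (n + 1))),
      w - ⟪(p : EuclideanSpace ℝ (Fin (n + 1))), w⟫ • (p : EuclideanSpace ℝ (Fin (n + 1)))⟫ = 0 := by
    rw [inner_sub_right, inner_smul_right, real_inner_self_eq_norm_sq, norm_eq_of_mem_sphere p]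
    simp
  obtain ⟨v, hv⟩ := exists_tangentIncl_eq p h0
  have h1 : s (tangentIncl p v) = v := LinearMap.congr_fun hs v
  change tangentIncl p (s (w - ⟪(p : EuclideanSpace ℝ (Fin (n + 1))), w⟫ •
    (p : EuclideanSpace ℝ (Fin (n + 1))))) = _
  rw [← hv, h1]

/-- The orthogonal projection onto the tangent space at `p`. -/
def tangentProj (p : Sph n) : EuclideanSpace ℝ (Fin (n + 1)) →ₗ[ℝ] TangentSpace (𝓡 n) p :=
  (exists_tangentProj p).choose

theorem tangentIncl_tangentProj (p : Sph n) (w : EuclideanSpace ℝ (Fin (n + 1))) :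
    tangentIncl p (tangentProj p w) = w - ⟪(p : EuclideanSpace ℝ (Fin (n + 1))), w⟫ •
        (p : EuclideanSpace ℝ (Fin (n + 1))) :=
  (exists_tangentProj p).choose_spec w

theorem tangentProj_tangentIncl (p : Sph n) (v : TangentSpace (𝓡 n) p) :
    tangentProj p (tangentIncl p v) = v := by
  apply tangentIncl_injective
  rw [tangentIncl_tangentProj, inner_tangentIncl, zero_smul, sub_zero]

theorem tangentProj_self (p : Sph n) :
    tangentProj p (p : EuclideanSpace ℝ (Fin (n + 1))) = 0 := by
  apply tangentIncl_injective
  rw [tangentIncl_tangentProj, real_inner_self_eq_norm_sq, norm_eq_of_mem_sphere p]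
  simp

/-- The homogeneous extension of a family of bilinear forms on the tangent spaces of `𝕊ⁿ`. -/
def homogForm (b : ∀ p : Sph n, TangentSpace (𝓡 n) p →ₗ[ℝ] TangentSpace (𝓡 n) p →ₗ[ℝ] ℝ)
    (x : EuclideanSpace ℝ (Fin (n + 1))) :
    EuclideanSpace ℝ (Fin (n + 1)) →ₗ[ℝ] EuclideanSpace ℝ (Fin (n + 1)) →ₗ[ℝ] ℝ :=
  (‖x‖ ^ 2) • (b (direction x)).compl₁₂ (tangentProj (direction x)) (tangentProj (direction x))

variable {b : ∀ p : Sph n, TangentSpace (𝓡 n) p →ₗ[ℝ] TangentSpace (𝓡 n) p →ₗ[ℝ] ℝ}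

theorem homogForm_apply (x y z : EuclideanSpace ℝ (Fin (n + 1))) :
    homogForm b x y z = ‖x‖ ^ 2 * b (direction x) (tangentProj (direction x) y)
      (tangentProj (direction x) z) := rfl

theorem homogForm_coe (p : Sph n) (y z : EuclideanSpace ℝ (Fin (n + 1))) :
    homogForm b p y z = b p (tangentProj p y) (tangentProj p z) := by
  rw [homogForm_apply, norm_eq_of_mem_sphere p, direction_coe, one_pow, one_mul]

theorem homogForm_coe_tangentIncl (p : Sph n) (v w : TangentSpace (𝓡 n) p) :
    homogForm b p (tangentIncl p v) (tangentIncl p w) = b p v w := by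
  rw [homogForm_coe, tangentProj_tangentIncl, tangentProj_tangentIncl]

theorem homogForm_smul {r : ℝ} (hr : 0 < r) (x y z : EuclideanSpace ℝ (Fin (n + 1))) :
    homogForm b (r • x) y z = r ^ 2 * homogForm b x y z := by
  rw [homogForm_apply, homogForm_apply, direction_smul hr, norm_smul, Real.norm_eq_abs,
    mul_pow, sq_abs, mul_assoc]

theorem homogForm_symm (hb : ∀ p v w, b p v w = b p w v) (x y z : EuclideanSpace ℝ (Fin (n + 1))) :
    homogForm b x y z = homogForm b x z y := by
  rw [homogForm_apply, homogForm_apply, hb]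

theorem homogForm_self_left (x y : EuclideanSpace ℝ (Fin (n + 1))) : homogForm b x x y = 0 := by
  by_cases hx : x = 0
  · simp [hx]
  have h : tangentProj (direction x) x = 0 := by
    have h1 : x = ‖x‖ • (direction x : EuclideanSpace ℝ (Fin (n + 1))) := by
      rw [coe_direction hx, smul_smul, mul_inv_cancel₀ (norm_ne_zero_iff.2 hx), one_smul]
    have h2 := tangentProj_self (direction x)
    calc tangentProj (direction x) x
        = tangentProj (direction x) (‖x‖ • (direction x : EuclideanSpace ℝ (Fin (n + 1)))) := by
          rw [← h1]
      _ = 0 := by rw [map_smul, h2, smul_zero]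
  rw [homogForm_apply, h]
  simp

theorem norm_cos_add_sin {x y : EuclideanSpace ℝ (Fin (n + 1))} (hx : ‖x‖ = 1) (hy : ‖y‖ = 1)
    (hxy : ⟪x, y⟫ = 0) (t : ℝ) : ‖Real.cos t • x + Real.sin t • y‖ = 1 := by
  have h : ‖Real.cos t • x + Real.sin t • y‖ ^ 2 = 1 := by
    rw [norm_add_sq_real, real_inner_smul_left, real_inner_smul_right, hxy, norm_smul, norm_smul,
      hx, hy]
    simp [Real.cos_sq_add_sin_sq]
  rwa [pow_eq_one_iff_of_nonneg (norm_nonneg _) two_ne_zero] at h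

/-- Passage from the chart at x to the unit-speed great circle: the angle t corresponds to the
coordinate vector 2 tan(t / 2) u. The reparametrisation changes the velocity by a factor that is
stationary at t = 0, so it does not affect the derivative. -/
theorem hasDerivAt_homogForm_circle_zero
    (hd : ∀ (p : Sph n) (u : EuclideanSpace ℝ (Fin n)), HasFDerivAt (fun x =>
      b (chartPoint p x) (chartVector p x u) (chartVector p x u)) (fderiv ℝ (fun x =>
      b (chartPoint p x) (chartVector p x u) (chartVector p x u)) 0) 0)
    (hk : ∀ (p : Sph n) (u : EuclideanSpace ℝ (Fin n)), fderiv ℝ (fun x =>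
      b (chartPoint p x) (chartVector p x u) (chartVector p x u)) 0 u = 0)
    {x y : EuclideanSpace ℝ (Fin (n + 1))} (hx : ‖x‖ = 1) (hy : ‖y‖ = 1) (hxy : ⟪x, y⟫ = 0) :
    HasDerivAt (fun t => homogForm b (Real.cos t • x + Real.sin t • y)
      (Real.cos t • y - Real.sin t • x) (Real.cos t • y - Real.sin t • x)) 0 0 := by
  let p : Sph n := ⟨x, mem_sphere_zero_iff_norm.2 hx⟩
  obtain ⟨J, -, hJ2, hJ⟩ := exists_chartMap_eq p
  obtain ⟨u, rfl⟩ := hJ2 y hxy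
  have hu : ‖u‖ ^ 2 = 1 := by rw [← J.norm_map, hy, one_pow]
  let f := fun x => b (chartPoint p x) (chartVector p x u) (chartVector p x u)
  -- The image of u under the derivative of the inverse chart is cos²(t / 2) times the unit tangent;
  -- inserted twice into b, this gives the factor cos⁻⁴(t / 2).
  have h1 : ∀ t : ℝ, Real.cos (t / 2) ≠ 0 →
      homogForm b (Real.cos t • x + Real.sin t • J u) (Real.cos t • J u - Real.sin t • x)
        (Real.cos t • J u - Real.sin t • x) = ((Real.cos (t / 2))⁻¹ ^ 2) ^ 2 *
          f ((2 * Real.sin (t / 2) / Real.cos (t / 2)) • u) := by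
    intro t ht
    have hc : Real.cos t = 2 * Real.cos (t / 2) ^ 2 - 1 := by
      rw [← Real.cos_two_mul]
      ring_nf
    have hs : Real.sin t = 2 * Real.sin (t / 2) * Real.cos (t / 2) := by
      rw [← Real.sin_two_mul]
      ring_nf
    have hcs := Real.sin_sq_add_cos_sq (t / 2)
    set C := Real.cos (t / 2)
    set S := Real.sin (t / 2)
    have hr : ‖(2 * S / C) • u‖ ^ 2 = 4 * S ^ 2 / C ^ 2 := by
      rw [norm_smul, mul_pow, hu, Real.norm_eq_abs, sq_abs]
      ring
    have hi : ⟪(2 * S / C) • u, u⟫ = 2 * S / C := by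
      rw [real_inner_smul_left, real_inner_self_eq_norm_sq, hu, mul_one]
    have hN : 4 * S ^ 2 / C ^ 2 + 4 = 4 / C ^ 2 := by
      field_simp
      linear_combination hcs
    have hN' : 4 * S ^ 2 / C ^ 2 - 4 = 4 * (1 - 2 * C ^ 2) / C ^ 2 := by
      field_simp
      linear_combination hcs
    have e1 : chartMap p ((2 * S / C) • u) = Real.cos t • x + Real.sin t • J u := by
      rw [hJ, hr, hN, hN', J.map_smul, hc, hs]
      match_scalars <;> field_simp
      ring
    have e2 : fderiv ℝ (chartMap p) ((2 * S / C) • u) u =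
        (C ^ 2) • (Real.cos t • J u - Real.sin t • x) := by
      rw [fderiv_chartMap_apply_eq hJ, hr, hi, hN, J.map_smul, hc, hs]
      match_scalars <;> field_simp
      · linear_combination (-32) * hcs
      · ring
    have e3 : Real.cos t • J u - Real.sin t • x =
        (C⁻¹ ^ 2) • fderiv ℝ (chartMap p) ((2 * S / C) • u) u := by
      rw [e2, smul_smul, inv_pow, inv_mul_cancel₀ (pow_ne_zero 2 ht), one_smul]
    rw [e3, ← e1, ← tangentIncl_chartVector]
    simp only [map_smul, LinearMap.smul_apply, smul_eq_mul]
    rw [show chartMap p ((2 * S / C) • u) =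
      (chartPoint p ((2 * S / C) • u) : EuclideanSpace ℝ (Fin (n + 1))) from rfl,
      homogForm_coe_tangentIncl]
    ring
  have hC : HasDerivAt (fun t : ℝ => Real.cos (t / 2)) 0 0 := by
    simpa using ((hasDerivAt_id (0 : ℝ)).div_const 2).cos
  have hS : HasDerivAt (fun t : ℝ => Real.sin (t / 2)) (1 / 2) 0 := by
    simpa using ((hasDerivAt_id (0 : ℝ)).div_const 2).sin
  have hCi : HasDerivAt (fun t : ℝ => (Real.cos (t / 2))⁻¹) 0 0 := by
    simpa using hC.fun_inv (by simp)
  have hX : HasDerivAt (fun t : ℝ => (2 * Real.sin (t / 2) / Real.cos (t / 2)) • u) u 0 := by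
    have h := ((hS.const_mul 2).fun_mul hCi).smul_const u
    simpa [div_eq_mul_inv] using h
  have h2 : HasDerivAt (fun t : ℝ => f ((2 * Real.sin (t / 2) / Real.cos (t / 2)) • u)) 0 0 := by
    have h := HasFDerivAt.comp_hasDerivAt_of_eq (0 : ℝ) (hd p u) hX (by simp)
    rw [hk] at h
    exact h
  have h3 := ((hCi.fun_pow 2).fun_pow 2).fun_mul h2
  have h4 : HasDerivAt (fun t : ℝ => ((Real.cos (t / 2))⁻¹ ^ 2) ^ 2 *
          f ((2 * Real.sin (t / 2) / Real.cos (t / 2)) • u)) 0 0 := by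
    simpa using h3
  refine h4.congr_of_eventuallyEq ?_
  filter_upwards [hC.continuousAt.eventually_ne (y := (0 : ℝ)) (by simp)] with t ht
  exact h1 t ht

/-- The circle can be restarted at any of its points, so the derivative vanishes at every time and
not only at 0. -/
theorem homogForm_circle
    (hd : ∀ (p : Sph n) (u : EuclideanSpace ℝ (Fin n)), HasFDerivAt (fun x =>
      b (chartPoint p x) (chartVector p x u) (chartVector p x u)) (fderiv ℝ (fun x =>
      b (chartPoint p x) (chartVector p x u) (chartVector p x u)) 0) 0)
    (hk : ∀ (p : Sph n) (u : EuclideanSpace ℝ (Fin n)), fderiv ℝ (fun x =>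
      b (chartPoint p x) (chartVector p x u) (chartVector p x u)) 0 u = 0)
    {x y : EuclideanSpace ℝ (Fin (n + 1))} (hx : ‖x‖ = 1) (hy : ‖y‖ = 1) (hxy : ⟪x, y⟫ = 0)
    (t : ℝ) : homogForm b (Real.cos t • x + Real.sin t • y)
      (Real.cos t • y - Real.sin t • x) (Real.cos t • y - Real.sin t • x) = homogForm b x y y := by
  let f := fun t => homogForm b (Real.cos t • x + Real.sin t • y)
      (Real.cos t • y - Real.sin t • x) (Real.cos t • y - Real.sin t • x)
  have h1 : ∀ t, HasDerivAt f 0 t := by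
    intro t
    have hx' := norm_cos_add_sin hx hy hxy t
    have hy' : ‖Real.cos t • y - Real.sin t • x‖ = 1 := by
      have h := norm_cos_add_sin (y := -x) hy ((norm_neg x).trans hx)
        (by rw [inner_neg_right, real_inner_comm, hxy, neg_zero]) t
      rwa [smul_neg, ← sub_eq_add_neg] at h
    have hxy' : ⟪Real.cos t • x + Real.sin t • y, Real.cos t • y - Real.sin t • x⟫ = 0 := by
      simp only [inner_add_left, inner_sub_right, real_inner_smul_left, real_inner_smul_right, hxy,
        real_inner_comm x y, real_inner_self_eq_norm_sq, hx, hy]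
      ring
    have h0 := hasDerivAt_homogForm_circle_zero hd hk hx' hy' hxy'
    have h2 : HasDerivAt (fun s => s - t) 1 t := (hasDerivAt_id t).sub_const t
    have h3 := HasDerivAt.comp_of_eq t h0 h2 (sub_self t).symm
    rw [zero_mul] at h3
    refine h3.congr_of_eventuallyEq (Filter.Eventually.of_forall fun s => ?_)
    have e1 : Real.cos s • x + Real.sin s • y =
        Real.cos (s - t) • (Real.cos t • x + Real.sin t • y) +
          Real.sin (s - t) • (Real.cos t • y - Real.sin t • x) := by
      have c := Real.cos_add (s - t) t
      have d := Real.sin_add (s - t) t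
      rw [sub_add_cancel] at c d
      rw [c, d]
      module
    have e2 : Real.cos s • y - Real.sin s • x =
        Real.cos (s - t) • (Real.cos t • y - Real.sin t • x) -
          Real.sin (s - t) • (Real.cos t • x + Real.sin t • y) := by
      have c := Real.cos_add (s - t) t
      have d := Real.sin_add (s - t) t
      rw [sub_add_cancel] at c d
      rw [c, d]
      module
    simp only [f, Function.comp_apply]
    rw [e1, e2]
  have h2 := is_const_of_deriv_eq_zero (fun t => (h1 t).differentiableAt)
    (fun t => (h1 t).deriv) t 0
  simpa [f] using h2

theorem exists_polar (x y : EuclideanSpace ℝ (Fin (n + 1))) (hn : n ≠ 0) (hx : ‖x‖ = 1) :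
    ∃ e : EuclideanSpace ℝ (Fin (n + 1)), ‖e‖ = 1 ∧ ⟪x, e⟫ = 0 ∧ ∃ t : ℝ,
      y = ‖y‖ • (Real.cos t • x + Real.sin t • e) := by
  obtain ⟨e, he, hxe, a, c, hy⟩ : ∃ e : EuclideanSpace ℝ (Fin (n + 1)), ‖e‖ = 1 ∧ ⟪x, e⟫ = 0 ∧
      ∃ a c : ℝ, y = a • x + c • e := by
    by_cases h : y - ⟪x, y⟫ • x = 0
    -- If y is a multiple of x, any unit vector orthogonal to x serves as e; one exists because n ≠
    -- 0.
    · let p : Sph n := ⟨x, mem_sphere_zero_iff_norm.2 hx⟩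
      obtain ⟨J, hJ, -⟩ := exists_chartMap_eq p
      refine ⟨J (EuclideanSpace.single ⟨0, Nat.pos_of_ne_zero hn⟩ 1), ?_, hJ _, ⟪x, y⟫, 0, ?_⟩
      · rw [J.norm_map]
        simp
      · rw [zero_smul, add_zero]
        exact sub_eq_zero.1 h
    · have h' := norm_ne_zero_iff.2 h
      refine ⟨‖y - ⟪x, y⟫ • x‖⁻¹ • (y - ⟪x, y⟫ • x), ?_, ?_, ⟪x, y⟫, ‖y - ⟪x, y⟫ • x‖, ?_⟩
      · rw [norm_smul, norm_inv, norm_norm, inv_mul_cancel₀ h']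
      · rw [real_inner_smul_right, inner_sub_right, real_inner_smul_right,
          real_inner_self_eq_norm_sq, hx]
        simp
      · rw [smul_smul, mul_inv_cancel₀ h', one_smul]
        abel
  -- The angle is the argument of a + ci, where a and c are the coordinates of y in the orthonormal
  -- pair x, e.
  refine ⟨e, he, hxe, Complex.arg ⟨a, c⟩, ?_⟩
  have h1 : ‖y‖ = ‖(⟨a, c⟩ : ℂ)‖ := by
    rw [← sq_eq_sq₀ (norm_nonneg _) (norm_nonneg _), Complex.sq_norm, Complex.normSq_mk, hy,
      norm_add_sq_real, real_inner_smul_left, real_inner_smul_right, hxe, norm_smul, norm_smul,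
      mul_pow, mul_pow, he, hx, Real.norm_eq_abs, Real.norm_eq_abs, sq_abs, sq_abs]
    ring
  rw [h1, smul_add, smul_smul, smul_smul, Complex.norm_mul_cos_arg, Complex.norm_mul_sin_arg, hy]

/-- By homogeneity x and y may be taken to be unit vectors q and z on one great circle, at angle t.
Their components along the base point drop out, leaving sin² t times the value on the unit tangent
at q, respectively at z, and these agree by `homogForm_circle`. -/
theorem homogForm_swap (hn : n ≠ 0)
    (hd : ∀ (p : Sph n) (u : EuclideanSpace ℝ (Fin n)), HasFDerivAt (fun x =>
      b (chartPoint p x) (chartVector p x u) (chartVector p x u)) (fderiv ℝ (fun x =>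
      b (chartPoint p x) (chartVector p x u) (chartVector p x u)) 0) 0)
    (hk : ∀ (p : Sph n) (u : EuclideanSpace ℝ (Fin n)), fderiv ℝ (fun x =>
      b (chartPoint p x) (chartVector p x u) (chartVector p x u)) 0 u = 0)
    (hs : ∀ p v w, b p v w = b p w v)
    (x y : EuclideanSpace ℝ (Fin (n + 1))) : homogForm b x y y = homogForm b y x x := by
  have h0 : ∀ y z w, homogForm b 0 z w = homogForm b y 0 0 := by
    intro y z w
    simp [homogForm_apply]
  by_cases hx : x = 0
  · rw [hx, h0]
  by_cases hy : y = 0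
  · rw [hy, h0]
  have hx' := norm_pos_iff.2 hx
  have hy' := norm_pos_iff.2 hy
  have hx1 : ‖‖x‖⁻¹ • x‖ = 1 := by
    rw [norm_smul, norm_inv, norm_norm, inv_mul_cancel₀ hx'.ne']
  obtain ⟨e, he, hxe, t, hyt⟩ := exists_polar (‖x‖⁻¹ • x) y hn hx1
  have hxe' : x = ‖x‖ • ‖x‖⁻¹ • x := by rw [smul_smul, mul_inv_cancel₀ hx'.ne', one_smul]
  set q := ‖x‖⁻¹ • x
  clear_value q
  have hc := homogForm_circle hd hk hx1 he hxe t
  set z := Real.cos t • q + Real.sin t • e with hz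
  -- Seen from z, the point q lies at angle -t on the same circle.
  have hq : q = Real.cos t • z - Real.sin t • (Real.cos t • e - Real.sin t • q) := by
    rw [hz]
    match_scalars
    · linear_combination -Real.cos_sq_add_sin_sq t
    · ring
  have h1 : homogForm b q z z = Real.sin t ^ 2 * homogForm b q e e := by
    rw [hz]
    simp only [map_add, map_smul, LinearMap.add_apply, LinearMap.smul_apply, smul_eq_mul,
      homogForm_self_left, homogForm_symm hs q e q]
    ring
  have h2 : homogForm b z q q = Real.sin t ^ 2 * homogForm b q e e := by
    rw [← hc]
    set e' := Real.cos t • e - Real.sin t • q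
    rw [hq]
    simp only [map_sub, map_smul, LinearMap.sub_apply, LinearMap.smul_apply, smul_eq_mul,
      homogForm_self_left, homogForm_symm hs z e' z]
    ring
  rw [hxe', hyt, homogForm_smul hx', homogForm_smul hy']
  simp only [map_smul, LinearMap.smul_apply, smul_eq_mul, h1, h2]
  ring

theorem IsMetricFamily.exists_curvatureTensor (hn : n ≠ 0) (hb : IsMetricFamily b)
    (hk : ∀ (p : Sph n) (u : EuclideanSpace ℝ (Fin n)), fderiv ℝ (fun x =>
      b (chartPoint p x) (chartVector p x u) (chartVector p x u)) 0 u = 0) :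
    ∃ R : PositiveCurvatureTensor n, ∀ p v w, curvTwoTensor R.1 p v w = b p v w := by
  obtain ⟨R, hR, hRb⟩ := exists_isAlgCurvatureTensor (homogForm_symm hb.symm)
    (homogForm_swap hn (fun p u => ((hb.smooth p u u).differentiableAt (by simp)).hasFDerivAt) hk
      hb.symm) homogForm_self_left
  have h1 : ∀ p v, curvTwoTensor R p v v = b p v v := by
    intro p v
    rw [curvTwoTensor, hRb, homogForm_coe_tangentIncl]
  refine ⟨⟨R, hR, fun v w hv hw hvw => ?_⟩, fun p v w => ?_⟩
  · let p : Sph n := ⟨v, mem_sphere_zero_iff_norm.2 hv⟩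
    obtain ⟨u, rfl⟩ := exists_tangentIncl_eq p hvw
    have h2 := h1 p u
    rw [curvTwoTensor] at h2
    change 0 < R p (tangentIncl p u) p (tangentIncl p u)
    rw [h2]
    refine hb.pos p u ?_
    rintro rfl
    simp at hw
  · have h2 := h1 p (v + w)
    have h3 := h1 p v
    have h4 := h1 p w
    simp only [← curvFamily_apply, map_add, LinearMap.add_apply] at h2 h3 h4 ⊢
    have h5 : curvFamily R p v w = curvFamily R p w v := hR.pair_symm _ _ _ _
    linarith [hb.symm p v w]

end GreatCircles

/-! ### The bijection between curvature tensors and metrics -/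

section Bijection

variable {n : ℕ}

theorem exists_isVolumeNormalisation_metricTensor (g : RiemMetric n (Sph n)) :
    ∃ F, IsVolumeNormalisation (metricTensor g) (((n : ℝ) + 1) / 4) F :=
  (isMetricFamily_metricFamily g).exists_isVolumeNormalisation (by positivity)

theorem exists_curvatureTensor_of_minimal (hn : n ≠ 0) {g : RiemMetric n (Sph n)}
    (hg : HasMinimalEquators g) {F : Sph n → ℝ}
    (hF : IsVolumeNormalisation (metricTensor g) (((n : ℝ) + 1) / 4) F) :
    ∃ R : PositiveCurvatureTensor n,
      ∀ p v w, curvTwoTensor R.1 p v w = 1 / F p * g.inner p v w := by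
  refine ((isMetricFamily_metricFamily g).smul hF.contMDiff_one_div
    fun p => one_div_pos.2 (hF.2.1 p)).exists_curvatureTensor hn fun p u => ?_
  rw [← (hasMinimalEquators_iff hF).1 hg p u]
  congr 2
  funext x
  exact (one_div_mul_eq_div _ _)

theorem isVolumeNormalisation_unique_metric {g : RiemMetric n (Sph n)} {F F' : Sph n → ℝ}
    (hF : IsVolumeNormalisation (metricTensor g) (((n : ℝ) + 1) / 4) F)
    (hF' : IsVolumeNormalisation (metricTensor g) (((n : ℝ) + 1) / 4) F') : F = F' :=
  hF.unique (by positivity) hF'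

/-- The curvature tensor `R_g`. -/
def metricCurvature (hn : n ≠ 0) (g : MinimalEquatorMetric n) : PositiveCurvatureTensor n :=
  (exists_curvatureTensor_of_minimal hn g.2
    (exists_isVolumeNormalisation_metricTensor g.1).choose_spec).choose

theorem curvTwoTensor_metricCurvature (hn : n ≠ 0) (g : MinimalEquatorMetric n) {F : Sph n → ℝ}
    (hF : IsVolumeNormalisation (metricTensor g.1) (((n : ℝ) + 1) / 4) F) (p : Sph n)
    (v w : TangentSpace (𝓡 n) p) :
    curvTwoTensor (metricCurvature hn g).1 p v w = 1 / F p * g.1.inner p v w := by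
  have h0 := (exists_isVolumeNormalisation_metricTensor g.1).choose_spec
  rw [isVolumeNormalisation_unique_metric hF h0]
  exact (exists_curvatureTensor_of_minimal hn g.2 h0).choose_spec p v w

/-- The bijection `R ↦ g_R`. -/
def curvEquiv (hn : 2 ≤ n) : PositiveCurvatureTensor n ≃ MinimalEquatorMetric n where
  toFun R := ⟨curvMetric hn R, hasMinimalEquators_curvMetric hn R⟩
  invFun := metricCurvature (by omega)
  left_inv R := by
    refine Subtype.ext (IsAlgCurvatureTensor.ext_of_sphere (metricCurvature (by omega) _).2.1 R.2.1
      fun p v => ?_)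
    refine (curvTwoTensor_metricCurvature _ ⟨curvMetric hn R, hasMinimalEquators_curvMetric hn R⟩
      (isVolumeNormalisation_curvMetric hn R) p v v).trans ?_
    rw [curvMetric_inner]
    have h := ((isVolumeNormalisation_curvDensity hn R).2.1 p).ne'
    field_simp
  right_inv g := by
    obtain ⟨F, hF⟩ := exists_isVolumeNormalisation_metricTensor g.1
    have hk := curvTwoTensor_metricCurvature (by omega) g hF
    -- The tensor k_g has density 1 / F, so by uniqueness D of R_g is 1 / F, and dividing k_g by it
    -- returns g.
    have hD := (hF.one_div_smul hk (β := ((n : ℝ) - 1) / 4) (by ring)).unique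
      (sub_one_div_four_ne_zero hn) (isVolumeNormalisation_curvDensity hn _)
    refine Subtype.ext (riemMetric_ext fun p v w => ?_)
    rw [curvMetric_inner, hk, ← hD]
    have h := (hF.2.1 p).ne'
    field_simp

theorem curvEquiv_inner (hn : 2 ≤ n) (R : PositiveCurvatureTensor n) (p : Sph n)
    (v w : TangentSpace (𝓡 n) p) :
    (curvEquiv hn R).1.inner p v w = 1 / curvDensity hn R p * curvTwoTensor R.1 p v w := rfl

theorem curvTwoTensor_eq_iff (hn : 2 ≤ n) (g : MinimalEquatorMetric n) {F : Sph n → ℝ}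
    (hF : IsVolumeNormalisation (metricTensor g.1) (((n : ℝ) + 1) / 4) F) {R : FourTensor n}
    (hR : IsAlgCurvatureTensor R) :
    (∀ (p : Sph n) (v : TangentSpace (𝓡 n) p),
      curvTwoTensor R p v v = (1 / F p) * g.1.inner p v v) ↔ R = ((curvEquiv hn).symm g).1 := by
  have hk := curvTwoTensor_metricCurvature (by omega) g hF
  refine ⟨fun h => hR.ext_of_sphere ((curvEquiv hn).symm g).2.1 fun p v => (h p v).trans (hk p v v).symm,
    ?_⟩
  rintro rfl p v
  exact hk p v v

end Bijection

/-! ### The action on curvature tensors -/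

section CurvatureAction

variable {n : ℕ}

/-- The pull-back of a four-linear form by a linear map, multiplied by a constant. -/
def tensorPullback (c : ℝ) (L : EuclideanSpace ℝ (Fin (n + 1)) →ₗ[ℝ] EuclideanSpace ℝ (Fin (n + 1)))
    (R : FourTensor n) : FourTensor n :=
  LinearMap.mk₂ ℝ
    (fun x y => LinearMap.mk₂ ℝ (fun z w => c * R (L x) (L y) (L z) (L w))
      (fun _ _ _ => by simp [mul_add]) (fun _ _ _ => by simp; ring)
      (fun _ _ _ => by simp [mul_add]) (fun _ _ _ => by simp; ring))
    (fun _ _ _ => by ext; simp [mul_add]) (fun _ _ _ => by ext; simp; ring)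
    (fun _ _ _ => by ext; simp [mul_add]) (fun _ _ _ => by ext; simp; ring)

theorem tensorPullback_apply (c : ℝ)
    (L : EuclideanSpace ℝ (Fin (n + 1)) →ₗ[ℝ] EuclideanSpace ℝ (Fin (n + 1)))
    (R : FourTensor n) (x y z w : EuclideanSpace ℝ (Fin (n + 1))) :
    tensorPullback c L R x y z w = c * R (L x) (L y) (L z) (L w) := rfl

theorem IsAlgCurvatureTensor.tensorPullback {R : FourTensor n} (hR : IsAlgCurvatureTensor R) (c : ℝ)
    (L : EuclideanSpace ℝ (Fin (n + 1)) →ₗ[ℝ] EuclideanSpace ℝ (Fin (n + 1))) :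
    IsAlgCurvatureTensor (tensorPullback c L R) where
  skew_left x y z w := by
    rw [tensorPullback_apply, tensorPullback_apply, hR.skew_left, mul_neg]
  skew_right x y z w := by
    rw [tensorPullback_apply, tensorPullback_apply, hR.skew_right, mul_neg]
  pair_symm x y z w := by
    rw [tensorPullback_apply, tensorPullback_apply, hR.pair_symm]
  bianchi x y z w := by
    rw [tensorPullback_apply, tensorPullback_apply, tensorPullback_apply, ← mul_add, ← mul_add,
      hR.bianchi, mul_zero]

/-- Orthonormal pairs suffice: Gram-Schmidt changes R(x, y, x, y) only by a squared determinant. -/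
theorem PositiveCurvatureTensor.pos (R : PositiveCurvatureTensor n)
    {x y : EuclideanSpace ℝ (Fin (n + 1))} (hx : x ≠ 0) (hy : ∀ a : ℝ, y ≠ a • x) :
    0 < R.1 x y x y := by
  have hx' := norm_ne_zero_iff.2 hx
  have h1 : ⟪‖x‖⁻¹ • x, y - (⟪x, y⟫ / ‖x‖ ^ 2) • x⟫ = 0 := by
    rw [inner_sub_right, real_inner_smul_left, real_inner_smul_left, real_inner_smul_right,
      real_inner_self_eq_norm_sq]
    field_simp
    ring
  have h2 := R.2.2.pos (x := ‖x‖⁻¹ • x)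
    (by rw [norm_smul, norm_inv, norm_norm, inv_mul_cancel₀ hx']) (sub_ne_zero.2 (hy _)) h1
  have h3 := R.2.1.apply_plane x y ‖x‖⁻¹ 0 (-(⟪x, y⟫ / ‖x‖ ^ 2)) 1
  rw [show ‖x‖⁻¹ • x + (0 : ℝ) • y = ‖x‖⁻¹ • x by module,
    show (-(⟪x, y⟫ / ‖x‖ ^ 2)) • x + (1 : ℝ) • y = y - (⟪x, y⟫ / ‖x‖ ^ 2) • x by module] at h3
  rw [h3] at h2
  exact pos_of_mul_pos_right h2 (sq_nonneg _)

theorem det_ne_zero (T : GL (Fin (n + 1)) ℝ) :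
    (T : Matrix (Fin (n + 1)) (Fin (n + 1)) ℝ).det ≠ 0 :=
  ((Matrix.isUnit_iff_isUnit_det _).1 T.isUnit).ne_zero

/-- The factor `|det T| ^ (-4 / (n + 1))`. -/
def detFactor (T : GL (Fin (n + 1)) ℝ) : ℝ :=
  (|(T : Matrix (Fin (n + 1)) (Fin (n + 1)) ℝ).det| ^ (4 / ((n : ℝ) + 1)))⁻¹

theorem detFactor_pos (T : GL (Fin (n + 1)) ℝ) : 0 < detFactor T :=
  inv_pos.2 (Real.rpow_pos_of_pos (abs_pos.2 (det_ne_zero T)) _)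

theorem detFactor_mul (S T : GL (Fin (n + 1)) ℝ) :
    detFactor (S * T) = detFactor S * detFactor T := by
  rw [detFactor, Units.val_mul, Matrix.det_mul, abs_mul,
    Real.mul_rpow (abs_nonneg _) (abs_nonneg _), mul_inv]
  rfl

/-- The exponent 4 / (n + 1) is the one that offsets the degree four of R under scalars, so that the
action descends to the projective group. -/
theorem detFactor_scalar (u : ℝˣ) :
    detFactor (Matrix.GeneralLinearGroup.scalar (Fin (n + 1)) u) = ((u : ℝ) ^ 4)⁻¹ := by
  have h : ((Matrix.GeneralLinearGroup.scalar (Fin (n + 1)) u : GL (Fin (n + 1)) ℝ) :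
      Matrix (Fin (n + 1)) (Fin (n + 1)) ℝ).det = (u : ℝ) ^ (n + 1) := by
    simp
  rw [detFactor, h, abs_pow, ← Real.rpow_natCast_mul (abs_nonneg _)]
  have h1 : ((n + 1 : ℕ) : ℝ) * (4 / ((n : ℝ) + 1)) = (4 : ℕ) := by
    push_cast
    field_simp
  rw [h1, Real.rpow_natCast, Even.pow_abs (by decide)]

theorem linMap_mul (S T : GL (Fin (n + 1)) ℝ) (x : EuclideanSpace ℝ (Fin (n + 1))) :
    linMap (S * T) x = linMap S (linMap T x) := by
  simp [linMap, Matrix.toEuclideanLin]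

theorem linMap_scalar (u : ℝˣ) (x : EuclideanSpace ℝ (Fin (n + 1))) :
    linMap (Matrix.GeneralLinearGroup.scalar (Fin (n + 1)) u) x = (u : ℝ) • x := by
  have h : ((Matrix.GeneralLinearGroup.scalar (Fin (n + 1)) u : GL (Fin (n + 1)) ℝ) :
      Matrix (Fin (n + 1)) (Fin (n + 1)) ℝ) = Matrix.diagonal fun _ => (u : ℝ) := rfl
  ext i
  simp [linMap, Matrix.toEuclideanLin, h, Matrix.mulVec_diagonal]

/-- The curvature tensor `R · [T]`. -/
def curvAct (T : GL (Fin (n + 1)) ℝ) (R : PositiveCurvatureTensor n) : PositiveCurvatureTensor n :=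
  ⟨tensorPullback (detFactor T) (linMap T) R.1, R.2.1.tensorPullback _ _, fun v w hv hw hvw => by
    refine mul_pos (detFactor_pos T) (R.pos (linMap_ne_zero T ?_) fun a ha => ?_)
    · rintro rfl
      simp at hv
    · rw [← map_smul, ← sub_eq_zero, ← map_sub] at ha
      have h1 : w - a • v = 0 := by
        by_contra h
        exact linMap_ne_zero T h ha
      have h2 : ⟪w - a • v, w⟫ = 1 := by
        rw [inner_sub_left, real_inner_smul_left, hvw, real_inner_self_eq_norm_sq, hw]
        norm_num
      rw [h1, inner_zero_left] at h2
      exact zero_ne_one h2⟩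

theorem curvAct_apply (T : GL (Fin (n + 1)) ℝ) (R : PositiveCurvatureTensor n)
    (x y z w : EuclideanSpace ℝ (Fin (n + 1))) : (curvAct T R).1 x y z w =
      detFactor T * R.1 (linMap T x) (linMap T y) (linMap T z) (linMap T w) := rfl

theorem curvAct_mul (S T : GL (Fin (n + 1)) ℝ) (R : PositiveCurvatureTensor n) :
    curvAct (S * T) R = curvAct T (curvAct S R) := by
  refine Subtype.ext ?_
  ext x y z w
  simp only [curvAct_apply, detFactor_mul, linMap_mul]
  ring

theorem curvAct_scalar (u : ℝˣ) (R : PositiveCurvatureTensor n) :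
    curvAct (Matrix.GeneralLinearGroup.scalar (Fin (n + 1)) u) R = R := by
  refine Subtype.ext ?_
  ext x y z w
  simp only [curvAct_apply, detFactor_scalar, linMap_scalar, map_smul, LinearMap.smul_apply,
    smul_eq_mul]
  have := u.ne_zero
  field_simp

theorem curvAct_eq_of_mk_eq {S T : GL (Fin (n + 1)) ℝ}
    (h : Matrix.ProjGenLinGroup.mk S = Matrix.ProjGenLinGroup.mk T)
    (R : PositiveCurvatureTensor n) : curvAct S R = curvAct T R := by
  obtain ⟨u, rfl⟩ := Matrix.ProjGenLinGroup.mk_eq_mk_iff.1 h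
  rw [curvAct_mul, curvAct_scalar]

/-- The right action of `PGL(n + 1, ℝ)` on curvature tensors. -/
@[reducible]
def curvMulAction :
    MulAction (Matrix.ProjGenLinGroup (Fin (n + 1)) ℝ)ᵐᵒᵖ (PositiveCurvatureTensor n) where
  -- Any representative will do, by `curvAct_eq_of_mk_eq`.
  smul γ R := curvAct (Matrix.ProjGenLinGroup.mk_surjective γ.unop).choose R
  one_smul R := by
    refine (curvAct_eq_of_mk_eq ?_ R).trans (curvAct_scalar 1 R)
    rw [(Matrix.ProjGenLinGroup.mk_surjective _).choose_spec, map_one, map_one]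
    rfl
  mul_smul γ δ R := by
    refine (curvAct_eq_of_mk_eq ?_ R).trans (curvAct_mul _ _ R)
    rw [(Matrix.ProjGenLinGroup.mk_surjective _).choose_spec, map_mul,
      (Matrix.ProjGenLinGroup.mk_surjective _).choose_spec,
      (Matrix.ProjGenLinGroup.mk_surjective _).choose_spec]
    rfl

theorem curvMulAction_mk (T : GL (Fin (n + 1)) ℝ) (R : PositiveCurvatureTensor n) :
    curvMulAction.smul (MulOpposite.op (Matrix.ProjGenLinGroup.mk T)) R = curvAct T R :=
  curvAct_eq_of_mk_eq (Matrix.ProjGenLinGroup.mk_surjective _).choose_spec R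

end CurvatureAction

/-! ### The action on metrics -/

section MetricAction

variable {n : ℕ}

theorem coe_sphereMap (T : GL (Fin (n + 1)) ℝ) (p : Sph n) :
    (sphereMap T p : EuclideanSpace ℝ (Fin (n + 1))) =
      ‖linMap T p‖⁻¹ • linMap T (p : EuclideanSpace ℝ (Fin (n + 1))) := rfl

theorem contDiffAt_linMap (T : GL (Fin (n + 1)) ℝ) (x : EuclideanSpace ℝ (Fin (n + 1))) :
    ContDiffAt ℝ ∞ (linMap T) x :=
  (LinearMap.toContinuousLinearMap (linMap T)).contDiff.contDiffAt

theorem linMap_coe_ne_zero (T : GL (Fin (n + 1)) ℝ) (p : Sph n) :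
    linMap T (p : EuclideanSpace ℝ (Fin (n + 1))) ≠ 0 :=
  linMap_ne_zero T (ne_zero_of_mem_unit_sphere p)

theorem contMDiff_sphereMap (T : GL (Fin (n + 1)) ℝ) :
    ContMDiff (𝓡 n) (𝓡 n) ∞ (sphereMap T) := by
  have := Fact.mk (@finrank_euclideanSpace_fin ℝ _ (n + 1))
  refine ContMDiff.codRestrict_sphere (f := fun p : Sph n =>
    ‖linMap T p‖⁻¹ • linMap T (p : EuclideanSpace ℝ (Fin (n + 1)))) (fun p => ?_) _
  have h : ContDiffAt ℝ ∞ (fun x : EuclideanSpace ℝ (Fin (n + 1)) =>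
      ‖linMap T x‖⁻¹ • linMap T x) p :=
    (((contDiffAt_linMap T _).norm ℝ (linMap_coe_ne_zero T p)).inv
      (norm_ne_zero_iff.2 (linMap_coe_ne_zero T p))).smul (contDiffAt_linMap T _)
  exact h.contMDiffAt.comp p (contMDiff_sphere_coe p)

/-- Differentiating the factor 1 / |Tx| only adds a multiple of φ(T)(p). Its size a is left
unspecified, because curvature tensors and determinants ignore it. -/
theorem tangentIncl_mfderiv_sphereMap (T : GL (Fin (n + 1)) ℝ) (p : Sph n) :
    ∃ a : TangentSpace (𝓡 n) p → ℝ, ∀ v,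
      tangentIncl (sphereMap T p) (mfderiv (𝓡 n) (𝓡 n) (sphereMap T) p v) =
        ‖linMap T p‖⁻¹ • linMap T (tangentIncl p v) +
          a v • (sphereMap T p : EuclideanSpace ℝ (Fin (n + 1))) := by
  have hc : ∀ q : Sph n, MDifferentiableAt (𝓡 n) 𝓘(ℝ, EuclideanSpace ℝ (Fin (n + 1)))
      ((↑) : Sph n → EuclideanSpace ℝ (Fin (n + 1))) q :=
    fun q => (contMDiff_sphere_coe q).mdifferentiableAt (by simp)
  have hT0 := norm_ne_zero_iff.2 (linMap_coe_ne_zero T p)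
  have hL : HasFDerivAt (linMap T) (LinearMap.toContinuousLinearMap (linMap T))
      (p : EuclideanSpace ℝ (Fin (n + 1))) :=
    (LinearMap.toContinuousLinearMap (linMap T)).hasFDerivAt
  have hN : DifferentiableAt ℝ (fun x => ‖linMap T x‖⁻¹) (p : EuclideanSpace ℝ (Fin (n + 1))) :=
    (hL.differentiableAt.norm ℝ (linMap_coe_ne_zero T p)).inv hT0
  have hF := hN.hasFDerivAt.fun_smul hL
  have h1 := fun v => mfderiv_comp_apply p (hc (sphereMap T p))
    ((contMDiff_sphereMap T p).mdifferentiableAt (by simp)) v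
  have h2 := fun v => mfderiv_comp_apply p hF.differentiableAt.mdifferentiableAt (hc p) v
  refine ⟨fun v => fderiv ℝ (fun x => ‖linMap T x‖⁻¹) (p : EuclideanSpace ℝ (Fin (n + 1)))
    (tangentIncl p v) * ‖linMap T p‖, fun v => ?_⟩
  refine (h1 v).symm.trans ((h2 v).trans ?_)
  rw [mfderiv_eq_fderiv, hF.fderiv]
  rw [coe_sphereMap, smul_smul, mul_assoc, mul_inv_cancel₀ hT0, mul_one]
  rfl

/-- Each of the four arguments carries a factor 1 / |Tp|, and the components along φ(T)(p) vanish by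
skew-symmetry. -/
theorem curvTwoTensor_pullback (R : PositiveCurvatureTensor n) (T : GL (Fin (n + 1)) ℝ) (p : Sph n)
    (v w : TangentSpace (𝓡 n) p) :
    curvTwoTensor (curvAct T R).1 p v w = detFactor T * ‖linMap T p‖ ^ 4 *
      curvTwoTensor R.1 (sphereMap T p) (mfderiv (𝓡 n) (𝓡 n) (sphereMap T) p v)
        (mfderiv (𝓡 n) (𝓡 n) (sphereMap T) p w) := by
  obtain ⟨a, ha⟩ := tangentIncl_mfderiv_sphereMap T p
  have hT0 := norm_ne_zero_iff.2 (linMap_coe_ne_zero T p)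
  rw [curvTwoTensor, curvTwoTensor, ha, ha, curvAct_apply]
  simp only [map_add, map_smul, LinearMap.add_apply, LinearMap.smul_apply, smul_eq_mul,
    R.2.1.apply_self_left, R.2.1.apply_self_right]
  simp only [coe_sphereMap, map_smul, LinearMap.smul_apply, smul_eq_mul]
  field_simp
  ring

/-- Adjoining the unit normal q gives a square matrix M for which M Mᵀ is block diagonal, with
blocks 1 and the Gram matrix. -/
theorem det_gram_eq_sq {q : EuclideanSpace ℝ (Fin (n + 1))} (hq : ‖q‖ = 1)
    {w : Fin n → EuclideanSpace ℝ (Fin (n + 1))} (hw : ∀ i, ⟪q, w i⟫ = 0) :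
    (Matrix.of fun i j => ⟪w i, w j⟫).det =
      (Matrix.of fun i j => (Fin.cons q w : Fin (n + 1) → EuclideanSpace ℝ (Fin (n + 1))) i j).det
        ^ 2 := by
  set M : Matrix (Fin (n + 1)) (Fin (n + 1)) ℝ :=
    Matrix.of fun i j => (Fin.cons q w : Fin (n + 1) → EuclideanSpace ℝ (Fin (n + 1))) i j
  have h1 : ∀ i j, (M * M.transpose) i j =
      ⟪(Fin.cons q w : Fin (n + 1) → EuclideanSpace ℝ (Fin (n + 1))) i,
        (Fin.cons q w : Fin (n + 1) → EuclideanSpace ℝ (Fin (n + 1))) j⟫ := by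
    intro i j
    rw [Matrix.mul_apply, PiLp.inner_apply]
    exact Finset.sum_congr rfl fun k _ => by simp [M, mul_comm]
  have h2 : M.det ^ 2 = (M * M.transpose).det := by
    rw [Matrix.det_mul, Matrix.det_transpose, sq]
  rw [h2, Matrix.det_succ_row_zero, Fin.sum_univ_succ, Finset.sum_eq_zero fun j _ => ?_]
  · rw [h1, Fin.cons_zero, real_inner_self_eq_norm_sq, hq]
    simp only [Fin.val_zero, pow_zero, one_pow, mul_one, one_mul, add_zero]
    congr 1
    ext i j
    rw [Matrix.submatrix_apply, h1]
    simp
  · rw [h1, Fin.cons_zero, Fin.cons_succ, hw]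
    simp

/-- This is the square of the Jacobian |det T| / |Tp| ^ (n + 1) of φ(T). With the normal adjoined,
both Gram determinants become determinants of size n + 1, related by T / |Tp|. -/
theorem det_gram_sphereMap (T : GL (Fin (n + 1)) ℝ) (p : Sph n)
    (e : Fin n → TangentSpace (𝓡 n) p) :
    (Matrix.of fun i j => roundFamily (sphereMap T p)
      (mfderiv (𝓡 n) (𝓡 n) (sphereMap T) p (e i))
      (mfderiv (𝓡 n) (𝓡 n) (sphereMap T) p (e j))).det =
      ((‖linMap T p‖⁻¹) ^ (n + 1) * (T : Matrix (Fin (n + 1)) (Fin (n + 1)) ℝ).det) ^ 2 *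
        (Matrix.of fun i j => roundFamily p (e i) (e j)).det := by
  obtain ⟨a, ha⟩ := tangentIncl_mfderiv_sphereMap T p
  have h1 := det_gram_eq_sq (norm_eq_of_mem_sphere (sphereMap T p))
    (w := fun i => tangentIncl (sphereMap T p) (mfderiv (𝓡 n) (𝓡 n) (sphereMap T) p (e i)))
    fun i => inner_tangentIncl _ _
  have h2 := det_gram_eq_sq (norm_eq_of_mem_sphere p) (w := fun i => tangentIncl p (e i))
    fun i => inner_tangentIncl _ _
  refine h1.trans (Eq.trans ?_ (congrArg _ h2.symm))
  rw [← mul_pow]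
  congr 1
  set M : Matrix (Fin (n + 1)) (Fin (n + 1)) ℝ := Matrix.of fun i j =>
    (Fin.cons (p : EuclideanSpace ℝ (Fin (n + 1))) (fun i => tangentIncl p (e i)) :
      Fin (n + 1) → EuclideanSpace ℝ (Fin (n + 1))) i j with hM
  have h3 : ∀ i j, (‖linMap T p‖⁻¹ • (M * (T : Matrix (Fin (n + 1)) (Fin (n + 1)) ℝ).transpose)) i j
      = (‖linMap T p‖⁻¹ • linMap T ((Fin.cons (p : EuclideanSpace ℝ (Fin (n + 1)))
        (fun i => tangentIncl p (e i)) : Fin (n + 1) → EuclideanSpace ℝ (Fin (n + 1))) i)) j := by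
    intro i j
    rw [Matrix.smul_apply, Matrix.mul_apply, PiLp.smul_apply]
    congr 1
    simp only [linMap, Matrix.toLpLin_apply, Matrix.mulVec, dotProduct, Matrix.transpose_apply]
    exact Finset.sum_congr rfl fun k _ => mul_comm _ _
  have h4 : (‖linMap T p‖⁻¹ • (M * (T : Matrix (Fin (n + 1)) (Fin (n + 1)) ℝ).transpose)).det =
      ‖linMap T p‖⁻¹ ^ (n + 1) * (T : Matrix (Fin (n + 1)) (Fin (n + 1)) ℝ).det * M.det := by
    rw [Matrix.det_smul, Matrix.det_mul, Matrix.det_transpose, Fintype.card_fin]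
    ring
  rw [← h4]
  -- The rows differ from those of the transformed matrix by multiples a(eᵢ) of row 0, which itself
  -- is unchanged.
  refine Matrix.det_eq_of_forall_row_eq_smul_add_const
    (Fin.cons 0 fun i => a (e i) : Fin (n + 1) → ℝ) 0 (by simp) fun i j => ?_
  rw [h3, h3, Matrix.of_apply]
  refine Fin.cases ?_ (fun i => ?_) i
  · simp [coe_sphereMap]
  · simp only [Fin.cons_succ, Fin.cons_zero, ha, PiLp.add_apply, PiLp.smul_apply, coe_sphereMap]
    rfl

/-- The factor m scales volume elements by m ^ (n / 2) and the Jacobian of φ(T) is m ^ (-(n + 1) /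
4). Together they give m ^ ((n - 1) / 4), so D acquires exactly the factor m that k acquires, and
the metric is pulled back without any factor. -/
theorem curvDensity_curvAct (hn : 2 ≤ n) (R : PositiveCurvatureTensor n) (T : GL (Fin (n + 1)) ℝ)
    (p : Sph n) : curvDensity hn (curvAct T R) p =
      detFactor T * ‖linMap T p‖ ^ 4 * curvDensity hn R (sphereMap T p) := by
  have hD := isVolumeNormalisation_curvDensity hn R
  have hD' := isVolumeNormalisation_curvDensity hn (curvAct T R)
  have hT := norm_pos_iff.2 (linMap_coe_ne_zero T p)
  have hd := detFactor_pos T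
  have hm : 0 < detFactor T * ‖linMap T p‖ ^ 4 := by positivity
  set m := detFactor T * ‖linMap T p‖ ^ 4 with hm_def
  have h1 := hD'.2.2 p (frame p)
  rw [volumeElement_round_frame, mul_one] at h1
  have h2 : volumeElement (curvTwoTensor (curvAct T R).1) p (frame p) =
      m ^ ((n : ℝ) / 2) * volumeElement (curvTwoTensor R.1) (sphereMap T p)
        (fun i => mfderiv (𝓡 n) (𝓡 n) (sphereMap T) p (frame p i)) := by
    rw [← volumeElement_smul (sphereMap T p) hm, volumeElement]
    simp only [curvTwoTensor_pullback]
    rfl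
  have h3 : volumeElement (roundTensor n) (sphereMap T p)
      (fun i => mfderiv (𝓡 n) (𝓡 n) (sphereMap T) p (frame p i)) =
      ‖linMap T p‖⁻¹ ^ (n + 1) * |(T : Matrix (Fin (n + 1)) (Fin (n + 1)) ℝ).det| := by
    have h := det_gram_sphereMap T p (frame p)
    rw [det_gram_round_frame, mul_one] at h
    refine (congrArg Real.sqrt h).trans ?_
    rw [Real.sqrt_sq_eq_abs, abs_mul, abs_of_pos (by positivity)]
  have h4 : ‖linMap T p‖⁻¹ ^ (n + 1) * |(T : Matrix (Fin (n + 1)) (Fin (n + 1)) ℝ).det| =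
      m ^ (-(((n : ℝ) + 1) / 4)) := by
    have hdet := abs_pos.2 (det_ne_zero T)
    have e1 : detFactor T ^ (-(((n : ℝ) + 1) / 4)) =
        |(T : Matrix (Fin (n + 1)) (Fin (n + 1)) ℝ).det| := by
      rw [detFactor, ← Real.rpow_neg hdet.le, ← Real.rpow_mul hdet.le]
      have : -(4 / ((n : ℝ) + 1)) * -(((n : ℝ) + 1) / 4) = 1 := by field_simp
      rw [this, Real.rpow_one]
    have e2 : (‖linMap T p‖ ^ 4) ^ (-(((n : ℝ) + 1) / 4)) = ‖linMap T p‖⁻¹ ^ (n + 1) := by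
      rw [← Real.rpow_natCast_mul hT.le, inv_pow, ← Real.rpow_natCast, ← Real.rpow_neg hT.le]
      congr 1
      push_cast
      ring
    rw [hm_def, Real.mul_rpow hd.le (by positivity), e1, e2, mul_comm]
  rw [h2, hD.2.2, h3, h4] at h1
  have h5 : (m * curvDensity hn R (sphereMap T p)) ^ (((n : ℝ) - 1) / 4) =
      curvDensity hn (curvAct T R) p ^ (((n : ℝ) - 1) / 4) := by
    rw [← h1, Real.mul_rpow hm.le (hD.2.1 _).le,
      show ((n : ℝ) - 1) / 4 = (n : ℝ) / 2 + -(((n : ℝ) + 1) / 4) by ring, Real.rpow_add hm]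
    ring
  exact ((Real.rpow_left_inj (mul_pos hm (hD.2.1 _)).le (hD'.2.1 p).le
    (sub_one_div_four_ne_zero hn)).1 h5).symm

theorem curvEquiv_curvAct_inner (hn : 2 ≤ n) (R : PositiveCurvatureTensor n)
    (T : GL (Fin (n + 1)) ℝ) (p : Sph n) (v w : TangentSpace (𝓡 n) p) :
    (curvEquiv hn (curvAct T R)).1.inner p v w =
      (curvEquiv hn R).1.inner (sphereMap T p) (mfderiv (𝓡 n) (𝓡 n) (sphereMap T) p v)
        (mfderiv (𝓡 n) (𝓡 n) (sphereMap T) p w) := by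
  have hD := ((isVolumeNormalisation_curvDensity hn R).2.1 (sphereMap T p)).ne'
  have hT := (norm_pos_iff.2 (linMap_coe_ne_zero T p)).ne'
  have hd := (detFactor_pos T).ne'
  rw [curvEquiv_inner, curvEquiv_inner, curvDensity_curvAct, curvTwoTensor_pullback]
  field_simp

/-- The right action of `PGL(n + 1, ℝ)` on metrics with minimal equators. -/
@[reducible]
def metricMulAction (hn : 2 ≤ n) :
    MulAction (Matrix.ProjGenLinGroup (Fin (n + 1)) ℝ)ᵐᵒᵖ (MinimalEquatorMetric n) where
  -- Transporting the action through the bijection makes equivariance automatic and keeps the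
  -- equators minimal; that it is the pull-back is `curvEquiv_curvAct_inner`.
  smul γ g := curvEquiv hn (curvMulAction.smul γ ((curvEquiv hn).symm g))
  one_smul g := by
    refine (congrArg (curvEquiv hn) (curvMulAction.one_smul _)).trans ?_
    exact (curvEquiv hn).apply_symm_apply g
  mul_smul γ δ g := by
    refine congrArg (curvEquiv hn) ((curvMulAction.mul_smul γ δ _).trans ?_)
    exact congrArg (curvMulAction.smul γ) ((curvEquiv hn).symm_apply_apply _).symm

end MetricAction

end MinimalEquators

end

open MinimalEquators

theorem theoremA (n : ℕ) (hn : 2 ≤ n) :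
    ∃ (_ : MulAction (Matrix.ProjGenLinGroup (Fin (n + 1)) ℝ)ᵐᵒᵖ (PositiveCurvatureTensor n))
      (_ : MulAction (Matrix.ProjGenLinGroup (Fin (n + 1)) ℝ)ᵐᵒᵖ (MinimalEquatorMetric n))
      (Φ : PositiveCurvatureTensor n ≃ MinimalEquatorMetric n),
      -- the right action of `[T]` on curvature tensors
      (∀ (T : GL (Fin (n + 1)) ℝ) (R : PositiveCurvatureTensor n)
          (x y z w : EuclideanSpace ℝ (Fin (n + 1))),
        (MulOpposite.op (Matrix.ProjGenLinGroup.mk T) • R).1 x y z w =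
          (|(T : Matrix (Fin (n + 1)) (Fin (n + 1)) ℝ).det| ^ (4 / ((n : ℝ) + 1)))⁻¹ *
            R.1 (linMap T x) (linMap T y) (linMap T z) (linMap T w)) ∧
      -- the right action of `[T]` on metrics, by pull-back
      (∀ (T : GL (Fin (n + 1)) ℝ) (g : MinimalEquatorMetric n) (p : Sph n)
          (v w : TangentSpace (𝓡 n) p),
        (MulOpposite.op (Matrix.ProjGenLinGroup.mk T) • g).1.inner p v w =
          g.1.inner (sphereMap T p) (mfderiv (𝓡 n) (𝓡 n) (sphereMap T) p v)
            (mfderiv (𝓡 n) (𝓡 n) (sphereMap T) p w)) ∧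
      -- equivariance
      (∀ (γ : Matrix.ProjGenLinGroup (Fin (n + 1)) ℝ) (R : PositiveCurvatureTensor n),
        Φ (MulOpposite.op γ • R) = MulOpposite.op γ • Φ R) ∧
      -- the map `R ↦ g_R = k_R / D_R`
      (∀ R : PositiveCurvatureTensor n,
        (∃! D : Sph n → ℝ, IsVolumeNormalisation (curvTwoTensor R.1) (((n : ℝ) - 1) / 4) D) ∧
        ∀ D : Sph n → ℝ, IsVolumeNormalisation (curvTwoTensor R.1) (((n : ℝ) - 1) / 4) D →
          ∀ (p : Sph n) (v w : TangentSpace (𝓡 n) p),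
            (Φ R).1.inner p v w = (1 / D p) * curvTwoTensor R.1 p v w) ∧
      -- the inverse map: `k_g = g / F_g`, and `R_g` is determined by `R_g(p, v, p, v) = k_g(v, v)`
      (∀ g : MinimalEquatorMetric n,
        (∃! F : Sph n → ℝ, IsVolumeNormalisation (metricTensor g.1) (((n : ℝ) + 1) / 4) F) ∧
        ∀ F : Sph n → ℝ, IsVolumeNormalisation (metricTensor g.1) (((n : ℝ) + 1) / 4) F →
          ∀ R : FourTensor n, IsAlgCurvatureTensor R →
            ((∀ (p : Sph n) (v : TangentSpace (𝓡 n) p),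
                curvTwoTensor R p v v = (1 / F p) * g.1.inner p v v) ↔
              R = (Φ.symm g).1)) := by
  refine ⟨curvMulAction, metricMulAction hn, curvEquiv hn, fun T R x y z w => ?_,
    fun T g p v w => ?_, fun γ R => ?_, fun R => ⟨?_, fun D hD p v w => ?_⟩,
    fun g => ⟨?_, fun F hF R hR => curvTwoTensor_eq_iff hn g hF hR⟩⟩
  · exact congrArg (fun R : PositiveCurvatureTensor n => R.1 x y z w) (curvMulAction_mk T R)
  · refine (congrArg (fun R => (curvEquiv hn R).1.inner p v w)
      (curvMulAction_mk T ((curvEquiv hn).symm g))).trans ?_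
    rw [curvEquiv_curvAct_inner, Equiv.apply_symm_apply]
  · exact congrArg (fun R => curvEquiv hn (curvMulAction.smul (MulOpposite.op γ) R))
      ((curvEquiv hn).symm_apply_apply R).symm
  · exact ⟨_, isVolumeNormalisation_curvDensity hn R, fun D hD =>
      hD.unique (sub_one_div_four_ne_zero hn) (isVolumeNormalisation_curvDensity hn R)⟩
  · rw [hD.unique (sub_one_div_four_ne_zero hn) (isVolumeNormalisation_curvDensity hn R),
      curvEquiv_inner]
  · obtain ⟨F, hF⟩ := exists_isVolumeNormalisation_metricTensor g.1
    exact ⟨F, hF, fun F' hF' => isVolumeNormalisation_unique_metric hF' hF⟩
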